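/- **Theorem (Induction Theorem).** Conventions. All $*$-algebras are complex. Hilbert modules are right modules with inner product linear in the second variable, and representations of $C^*$-algebras on Hilbert modules are nondegenerate. A representation of a unital $*$-algebra $A$ on a Hilbert $D$-module $\mathcal E$ is a dense $D$-submodule $\mathfrak E\subseteq\mathcal E$ with a unital homomorphism $\pi\colon A\to\mathrm{End}_D(\mathfrak E)$ such that $\langle\pi(a)\xi,\eta\rangle=\langle\xi,\pi(a^*)\eta\rangle$; it is closed if $\mathfrak E$ is complete for the graph norms $\|\langle\xi,\xi\rangle+\langle\pi(a)\xi,\pi(a)\xi\rangle\|^{1/2}$, $a\in A$, and a core is an $A,D$-invariant subspace of $\mathfrak E$ that is dense for these norms. An isometric intertwiner from $(\mathfrak E_1,\pi_1)$ to $(\mathfrak E_2,\pi_2)$ is a (not necessarily adjointable) isometry $I\colon\mathcal E_1\to\mathcal E_2$ of Hilbert $D$-modules with $I(\mathfrak E_1)\subseteq\mathfrak E_2$ and $I\pi_1(a)\xi=\pi_2(a)I\xi$ for $\xi\in\mathfrak E_1$. For a correspondence $\mathcal F$ from $D_1$ to $D_2$, $\pi\otimes_{D_1}1$ is the closure of the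 representation $\pi(a)\otimes1$ on the image of $\mathfrak E\odot\mathcal F$ in $\mathcal E\otimes_{D_1}\mathcal F$. A $C^*$-hull of a class of closed ("integrable") representations of $A$ is a $C^*$-algebra $B$ with bijections $\Phi$, for all Hilbert modules $\mathcal E$ over all $C^*$-algebras, from the representations of $B$ on $\mathcal E$ onto the integrable representations of $A$ on $\mathcal E$, such that an isometry intertwines $\varrho_1$ and $\varrho_2$ if and only if it intertwines $\Phi(\varrho_1)$ and $\Phi(\varrho_2)$, and such that $\Phi(\varrho\otimes_{D_1}1_{\mathcal F})=\Phi(\varrho)\otimes_{D_1}1_{\mathcal F}$ for every correspondence $\mathcal F$ from $D_1$ to $D_2$. Let $G$ be a discrete group with unit $e$ and let $A=\bigoplus_{g\in G}A_g$ be a $G$-graded unital $*$-algebra ($A_gA_h\subseteq A_{gh}$, $A_g^*=A_{g^{-1}}$, $1\in A_e$). Let a class of integrable representations of $A_e$ with a $C^*$-hull $B_e$ be given. Let $(\mathfrak B_e,\mu_e)$ be the integrable representation of $A_e$ on $B_e$ that corresponds to the identity representation of $B_e$ on itself. A representation $(\mathfrak F,\varphi)$ of $A_e$ on $\mathcal F$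 is inducible if $\sum_{k,l}\langle\xi_k,\varphi(a_k^*a_l)\xi_l\rangle\ge0$ for all $g\in G$, $a_1,\dots,a_n\in A_g$, $\xi_1,\dots,\xi_n\in\mathfrak F$. Then the induced representation of $A$ is the closure of left multiplication on the image of $A\odot\mathfrak F$ in its Hilbert module completion $A\otimes_{A_e}\mathcal F$ for the inner product $\langle a_1\otimes\xi_1,a_2\otimes\xi_2\rangle=\delta_{g,h}\langle\xi_1,\varphi(a_1^*a_2)\xi_2\rangle$ for $a_1\in A_g$, $a_2\in A_h$. Assume that integrability is compatible with induction: if $\varphi$ is an inducible, integrable representation of $A_e$, then the restriction to $A_e$ of the induced representation of $A$ is integrable. Call a closed representation of $A$ integrable if its restriction to $A_e$ is integrable. Let $B_e^+$ be the quotient of $B_e$ by the closed two-sided ideal generated by the negative parts $\bigl(\sum_{k,l}b_k^*\,\mu_e(a_k^*a_l)b_l\bigr)_-$ for $g\in G$, $a_1,\dots,a_n\in A_g$, $b_1,\dots,b_n\in\mathfrak B_e$; let $q\colon B_e\to B_e^+$ be the quotient map, $\mathfrak B_e^+=q(\mathfrak B_e)$ and $\mu_e^+(a)q(b)=q(\mu_e(a)b)$.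 For $g\in G$, let $B_g^+=A_g\otimes_{A_e}B_e^+$ be the Hilbert $B_e^+$-module completion of $A_g\odot\mathfrak B_e^+$ for the inner product $\langle a_1\otimes b_1,a_2\otimes b_2\rangle=b_1^*\mu_e^+(a_1^*a_2)b_2$. Then: 1. $B_e^+$ and the Hilbert modules $B_g^+$ are well defined, and there is a unique Fell bundle structure over $G$ on $(B_g^+)_{g\in G}$ such that, for every integrable representation $\pi$ of $A$ on a Hilbert module $\mathcal E$, there are bounded linear maps $\bar\pi_g^+\colon B_g^+\to\mathbb B(\mathcal E)$ with $\bar\pi_g^+(a\otimes q(b))=\pi(a)\bar\pi_e(b)$ for $a\in A_g$, $b\in\mathfrak B_e$, which form a representation of the Fell bundle; here $\bar\pi_e$ is the representation of $B_e$ that corresponds to $\pi|_{A_e}$. Under the canonical isomorphism $A_e\otimes_{A_e}B_e^+\cong B_e^+$, $a\otimes b\mapsto\mu_e^+(a)b$, the Fell bundle structure restricts to the $C^*$-algebra structure of $B_e^+$ and induces the Hilbert $B_e^+$-module structure on each $B_g^+$, that is, $x\cdot b$ is the product in the Fell bundle and $\langle x,y\rangle=x^*y$. 2. The section $C^*$-algebra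 $B$ of this Fell bundle, that is, the completion of the $*$-algebra $\bigoplus_{g\in G}B_g^+$ in its maximal $C^*$-seminorm, exists and is a $C^*$-hull for the integrable representations of $A$. The bijections may be chosen such that the representation of $B$ corresponding to an integrable representation $\pi$ of $A$ restricts to $\bar\pi_g^+$ on $B_g^+$ for all $g\in G$. -/

import Mathlib

open scoped DirectSum

universe u

noncomputable section

namespace FellInduction

/-! ## Hilbert modules -/

/-- Positivity in a C*-algebra. -/
def IsPos {D : Type u} [NonUnitalCStarAlgebra D] (d : D) : Prop :=
  ∃ c : D, d = star c * c

/-- A (right) Hilbert module over a C*-algebra `D`; the inner product is linear in the second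
variable. (Mathlib's `CStarModule` is a left module for this convention, which does not allow a
C*-algebra to act on itself by left multiplication.) -/
structure HilbertModule (D : Type u) [NonUnitalCStarAlgebra D] : Type (u + 1) where
  carrier : Type u
  [normed : NormedAddCommGroup carrier]
  [space : NormedSpace ℂ carrier]
  [complete : CompleteSpace carrier]
  /-- the right action `x · d` -/
  act : carrier → D → carrier
  /-- the `D`-valued inner product `⟨x, y⟩` -/
  inner : carrier → carrier → D
  add_act : ∀ x y d, act (x + y) d = act x d + act y d
  act_add : ∀ x d e, act x (d + e) = act x d + act x e
  act_mul : ∀ x d e, act x (d * e) = act (act x d) e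
  smul_act : ∀ (z : ℂ) x d, act (z • x) d = z • act x d
  act_smul : ∀ (z : ℂ) x d, act x (z • d) = z • act x d
  inner_add_right : ∀ x y z, inner x (y + z) = inner x y + inner x z
  inner_smul_right : ∀ (z : ℂ) x y, inner x (z • y) = z • inner x y
  inner_act_right : ∀ x y d, inner x (act y d) = inner x y * d
  star_inner : ∀ x y, star (inner x y) = inner y x
  inner_self_pos : ∀ x, IsPos (inner x x)
  inner_self_eq_zero : ∀ x, inner x x = 0 → x = 0
  norm_sq_eq : ∀ x, ‖x‖ ^ 2 = ‖inner x x‖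

instance {D : Type u} [NonUnitalCStarAlgebra D] : CoeSort (HilbertModule D) (Type u) :=
  ⟨HilbertModule.carrier⟩

attribute [instance] HilbertModule.normed HilbertModule.space HilbertModule.complete

/-- A C*-algebra as a Hilbert module over itself, with `⟨x, y⟩ = x* y`. -/
abbrev HilbertModule.self (B : Type u) [NonUnitalCStarAlgebra B] : HilbertModule B where
  carrier := B
  act x d := x * d
  inner x y := star x * y
  add_act := add_mul
  act_add := mul_add
  act_mul x d e := (mul_assoc x d e).symm
  smul_act z x d := smul_mul_assoc z x d
  act_smul z x d := mul_smul_comm z x d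
  inner_add_right x y z := mul_add _ _ _
  inner_smul_right z x y := mul_smul_comm _ _ _
  inner_act_right x y d := (mul_assoc _ _ _).symm
  star_inner x y := by simp
  inner_self_pos x := ⟨x, rfl⟩
  inner_self_eq_zero x h := (CStarRing.star_mul_self_eq_zero_iff x).1 h
  norm_sq_eq x := by rw [CStarRing.norm_star_mul_self, sq]

/-- An isometry of Hilbert `D`-modules (not necessarily adjointable). -/
structure ModuleIsometry {D : Type u} [NonUnitalCStarAlgebra D] (E₁ E₂ : HilbertModule D) where
  toLin : E₁ →ₗ[ℂ] E₂
  map_act : ∀ x d, toLin (E₁.act x d) = E₂.act (toLin x) d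
  map_inner : ∀ x y, E₂.inner (toLin x) (toLin y) = E₁.inner x y

/-! ## Representations of C*-algebras on Hilbert modules -/

/-- A (nondegenerate) representation of the C*-algebra `B` on `E` by adjointable operators.
An operator on a Hilbert module that has an adjoint is automatically `D`-linear. -/
@[ext]
structure CStarRep (B : Type u) [NonUnitalCStarAlgebra B] {D : Type u} [NonUnitalCStarAlgebra D]
    (E : HilbertModule D) where
  toFun : B →ₗ[ℂ] (E →L[ℂ] E)
  map_mul : ∀ b c x, toFun (b * c) x = toFun b (toFun c x)
  adjoint : ∀ b x y, E.inner (toFun b x) y = E.inner x (toFun (star b) y)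
  nondegenerate : Dense (Submodule.span ℂ {y : E | ∃ b x, y = toFun b x} : Set E)

/-- Products are dense in a C*-algebra. -/
theorem dense_span_mul (B : Type u) [NonUnitalCStarAlgebra B] :
    Dense (Submodule.span ℂ {y : B | ∃ b x : B, y = b * x} : Set B) := by
  let _ := CStarAlgebra.spectralOrder B
  have _ := CStarAlgebra.spectralOrderedRing B
  intro x
  have h := (CStarAlgebra.increasingApproximateUnit B)
  have ht := h.tendsto_mul_right x
  have := h.neBot
  refine mem_closure_of_tendsto ht (Filter.Eventually.of_forall fun b => ?_)
  exact Submodule.subset_span ⟨_, _, rfl⟩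

/-- The identity representation of `B` on itself, by left multiplication. -/
def CStarRep.idRep (B : Type u) [NonUnitalCStarAlgebra B] : CStarRep B (HilbertModule.self B) where
  toFun := (ContinuousLinearMap.mul ℂ B).toLinearMap
  map_mul b c x := mul_assoc b c x
  adjoint b x y := by simp [mul_assoc]
  nondegenerate := dense_span_mul B

/-- `I` intertwines two representations of a C*-algebra. -/
def CStarRep.Intertwines {B : Type u} [NonUnitalCStarAlgebra B] {D : Type u}
    [NonUnitalCStarAlgebra D] {E₁ E₂ : HilbertModule D} (ρ₁ : CStarRep B E₁) (ρ₂ : CStarRep B E₂)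
    (I : ModuleIsometry E₁ E₂) : Prop :=
  ∀ b x, I.toLin (ρ₁.toFun b x) = ρ₂.toFun b (I.toLin x)

/-! ## Representations of *-algebras by unbounded operators -/

section StarAlgebra

variable (A : Type u) [Ring A] [Algebra ℂ A] [StarRing A] [StarModule ℂ A]

/-- A representation of a unital *-algebra on a Hilbert module, with its domain. -/
@[ext]
structure Rep {D : Type u} [NonUnitalCStarAlgebra D] (E : HilbertModule D) where
  dom : Submodule ℂ E
  dense : Dense (dom : Set E)
  act_mem : ∀ x ∈ dom, ∀ d, E.act x d ∈ dom
  toFun : A →ₐ[ℂ] Module.End ℂ dom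
  map_act : ∀ a (x : dom) d, (toFun a ⟨E.act x d, act_mem x x.2 d⟩ : E) = E.act (toFun a x) d
  adjoint : ∀ a (x y : dom), E.inner (toFun a x) y = E.inner x (toFun (star a) y)

variable {A}

namespace Rep

variable {D : Type u} [NonUnitalCStarAlgebra D] {E E₁ E₂ : HilbertModule D}

/-- The graph topology on the domain, as a uniform structure: it is generated by the maps
`ξ ↦ (ξ, π(a)ξ)` for `a ∈ A`, that is, by the graph norms
`‖⟨ξ, ξ⟩ + ⟨π(a)ξ, π(a)ξ⟩‖^{1/2}`, each of which is equivalent to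
`max ‖ξ‖ ‖π(a)ξ‖`. -/
@[reducible] def graphUniformSpace (π : Rep A E) : UniformSpace π.dom :=
  ⨅ a : A, UniformSpace.comap (fun ξ : π.dom => ((ξ : E), (π.toFun a ξ : E))) inferInstance

/-- A representation is closed if its domain is complete in the graph topology. -/
def IsClosed (π : Rep A E) : Prop :=
  @CompleteSpace π.dom π.graphUniformSpace

/-- A core is a subspace of the domain, invariant under `A` and `D`, that is dense in the domain
for the graph topology. -/
structure IsCore (π : Rep A E) (X : Submodule ℂ E) : Prop where
  le_dom : X ≤ π.dom
  map_mem : ∀ a (x : π.dom), (x : E) ∈ X → (π.toFun a x : E) ∈ X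
  act_mem : ∀ x ∈ X, ∀ d, E.act x d ∈ X
  dense : @Dense π.dom π.graphUniformSpace.toTopologicalSpace {x | (x : E) ∈ X}

/-- `I` is an (isometric) intertwiner between two representations of a *-algebra. -/
def Intertwines (π₁ : Rep A E₁) (π₂ : Rep A E₂) (I : ModuleIsometry E₁ E₂) : Prop :=
  ∀ x : π₁.dom, ∃ h : I.toLin x ∈ π₂.dom,
    ∀ a, I.toLin (π₁.toFun a x) = π₂.toFun a ⟨I.toLin x, h⟩

/-- Restriction to a *-subalgebra, with the same domain. -/
def restrict (π : Rep A E) (S : StarSubalgebra ℂ A) : Rep S E where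
  dom := π.dom
  dense := π.dense
  act_mem := π.act_mem
  toFun := π.toFun.comp S.toSubalgebra.val
  map_act a x d := π.map_act a x d
  adjoint a x y := π.adjoint a x y

end Rep

end StarAlgebra

/-! ## Interior tensor products -/

/-- `T` with the bilinear map `τ` is the interior tensor product of the Hilbert `D₁`-module `E`
with the correspondence `(F, φ)` from `D₁` to `D₂`: it is the completion of the algebraic tensor
product for the inner product `⟨x₁ ⊗ y₁, x₂ ⊗ y₂⟩ = ⟨y₁, ⟨x₁, x₂⟩ · y₂⟩`. This determines
`(T, τ)` up to a unique unitary. -/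
structure IsInteriorTensor {D₁ D₂ : Type u} [NonUnitalCStarAlgebra D₁] [NonUnitalCStarAlgebra D₂]
    (E : HilbertModule D₁) (F : HilbertModule D₂) (φ : CStarRep D₁ F) (T : HilbertModule D₂)
    (τ : E →ₗ[ℂ] F →ₗ[ℂ] T) : Prop where
  map_act : ∀ x y d, τ x (F.act y d) = T.act (τ x y) d
  inner_eq : ∀ x₁ y₁ x₂ y₂,
    T.inner (τ x₁ y₁) (τ x₂ y₂) = F.inner y₁ (φ.toFun (E.inner x₁ x₂) y₂)
  dense : Dense (Submodule.span ℂ {t : T | ∃ x y, t = τ x y} : Set T)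

section Tensor

variable {D₁ D₂ : Type u} [NonUnitalCStarAlgebra D₁] [NonUnitalCStarAlgebra D₂]
  {E : HilbertModule D₁} {F : HilbertModule D₂} {T : HilbertModule D₂}

/-- `σ = ρ ⊗ 1` on the interior tensor product `(T, τ)`, for representations of a C*-algebra. -/
def CStarRep.IsTensor {B : Type u} [NonUnitalCStarAlgebra B] (ρ : CStarRep B E)
    (τ : E →ₗ[ℂ] F →ₗ[ℂ] T) (σ : CStarRep B T) : Prop :=
  ∀ b x y, σ.toFun b (τ x y) = τ (ρ.toFun b x) y

/-- `π' = π ⊗ 1` on the interior tensor product `(T, τ)`, for representations of a *-algebra: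
`π'` is the closure of the representation `a ↦ π(a) ⊗ 1` whose domain is the image of the
algebraic tensor product of `dom π` and `F`. -/
structure Rep.IsTensor {A : Type u} [Ring A] [Algebra ℂ A] [StarRing A] [StarModule ℂ A]
    (π : Rep A E) (τ : E →ₗ[ℂ] F →ₗ[ℂ] T) (π' : Rep A T) : Prop where
  closed : π'.IsClosed
  core : π'.IsCore (Submodule.span ℂ {t : T | ∃ (x : π.dom) (y : F), t = τ x y})
  map_tensor : ∀ a (x : π.dom) (y : F) (h : τ x y ∈ π'.dom),
    (π'.toFun a ⟨τ x y, h⟩ : T) = τ (π.toFun a x) y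

end Tensor

/-! ## Classes of integrable representations and C*-hulls -/

/-- A class of ("integrable") closed representations of `A` on Hilbert modules. -/
structure RepClass (A : Type u) [Ring A] [Algebra ℂ A] [StarRing A] [StarModule ℂ A] where
  Mem : ∀ {D : Type u} [NonUnitalCStarAlgebra D] {E : HilbertModule D}, Rep A E → Prop
  closed : ∀ {D : Type u} [NonUnitalCStarAlgebra D] {E : HilbertModule D} (π : Rep A E),
    Mem π → π.IsClosed

/-- The data that make the C*-algebra `B` a C*-hull for a class of integrable representations:
a family of bijections from the representations of `B` to the integrable representations of `A`
on the same Hilbert module, compatible with isometric intertwiners and interior tensor products. -/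
structure CStarHull {A : Type u} [Ring A] [Algebra ℂ A] [StarRing A] [StarModule ℂ A]
    (𝓘 : RepClass A) (B : Type u) [NonUnitalCStarAlgebra B] where
  Φ : ∀ {D : Type u} [NonUnitalCStarAlgebra D] {E : HilbertModule D}, CStarRep B E → Rep A E
  bijOn : ∀ {D : Type u} [NonUnitalCStarAlgebra D] (E : HilbertModule D),
    Set.BijOn (Φ (E := E)) Set.univ {π | 𝓘.Mem π}
  isometric : ∀ {D : Type u} [NonUnitalCStarAlgebra D] {E₁ E₂ : HilbertModule D}
    (ρ₁ : CStarRep B E₁) (ρ₂ : CStarRep B E₂) (I : ModuleIsometry E₁ E₂),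
    ρ₁.Intertwines ρ₂ I ↔ (Φ ρ₁).Intertwines (Φ ρ₂) I
  tensor : ∀ {D₁ D₂ : Type u} [NonUnitalCStarAlgebra D₁] [NonUnitalCStarAlgebra D₂]
    {E : HilbertModule D₁} {F : HilbertModule D₂} {φ : CStarRep D₁ F} {T : HilbertModule D₂}
    {τ : E →ₗ[ℂ] F →ₗ[ℂ] T}, IsInteriorTensor E F φ T τ →
    ∀ (ρ : CStarRep B E) (σ : CStarRep B T), ρ.IsTensor τ σ → (Φ ρ).IsTensor τ (Φ σ)

section Universal

variable {A : Type u} [Ring A] [Algebra ℂ A] [StarRing A] [StarModule ℂ A]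
  {𝓘 : RepClass A} {B : Type u} [NonUnitalCStarAlgebra B]

/-- The universal integrable representation of `A` on the C*-hull `B`. -/
def CStarHull.univ (H : CStarHull 𝓘 B) : Rep A (HilbertModule.self B) :=
  H.Φ (CStarRep.idRep B)

/-- The inclusion of the domain of the universal representation into `B`. -/
def CStarHull.val (H : CStarHull 𝓘 B) (b : H.univ.dom) : B := b.1

end Universal

/-! ## Graded *-algebras -/

/-- A `G`-grading of the unital *-algebra `A`. -/
structure StarGrading (G : Type u) [Group G] (A : Type u) [Ring A] [Algebra ℂ A] [StarRing A]
    [StarModule ℂ A] where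
  fibre : G → Submodule ℂ A
  one_mem : (1 : A) ∈ fibre 1
  mul_mem : ∀ {g h : G} {a b : A}, a ∈ fibre g → b ∈ fibre h → a * b ∈ fibre (g * h)
  star_mem : ∀ {g : G} {a : A}, a ∈ fibre g → star a ∈ fibre g⁻¹
  independent : iSupIndep fibre
  iSup_eq_top : iSup fibre = ⊤

section Graded

variable {G : Type u} [Group G] {A : Type u} [Ring A] [Algebra ℂ A] [StarRing A] [StarModule ℂ A]

/-- The unit fibre `A_e`, a unital *-subalgebra. -/
def StarGrading.unitFibre (𝒜 : StarGrading G A) : StarSubalgebra ℂ A where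
  carrier := 𝒜.fibre 1
  mul_mem' ha hb := by simpa using 𝒜.mul_mem ha hb
  add_mem' ha hb := (𝒜.fibre 1).add_mem ha hb
  algebraMap_mem' r := by
    rw [Algebra.algebraMap_eq_smul_one]
    exact (𝒜.fibre 1).smul_mem r 𝒜.one_mem
  star_mem' ha := by simpa using 𝒜.star_mem ha

/-- The element `a* b` of `A_e`, for `a, b ∈ A_g`. -/
def StarGrading.starMul (𝒜 : StarGrading G A) {g : G} (a b : 𝒜.fibre g) : 𝒜.unitFibre :=
  ⟨star (a : A) * (b : A), by
    have h := 𝒜.mul_mem (𝒜.star_mem a.2) b.2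
    rw [inv_mul_cancel] at h
    exact h⟩

/-- A representation of `A` is integrable if its restriction to `A_e` is integrable. -/
def RepClass.extend (𝒜 : StarGrading G A) (𝓘 : RepClass 𝒜.unitFibre) : RepClass A where
  Mem π := π.IsClosed ∧ 𝓘.Mem (π.restrict 𝒜.unitFibre)
  closed _ h := h.1

variable {D : Type u} [NonUnitalCStarAlgebra D]

/-- Inducible representations of `A_e`. -/
def IsInducible (𝒜 : StarGrading G A) {F : HilbertModule D} (φ : Rep 𝒜.unitFibre F) : Prop :=
  ∀ (g : G) (n : ℕ) (a : Fin n → 𝒜.fibre g) (ξ : Fin n → φ.dom),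
    IsPos (∑ k, ∑ l, F.inner (ξ k) (φ.toFun (𝒜.starMul (a k) (a l)) (ξ l)))

/-- `π` on `T` is the representation of `A` induced from the representation `φ` of `A_e` on `F`:
`T` is the Hilbert module completion of the algebraic tensor product of `A` and `dom φ`, where
`ι a ξ` is the class of `a ⊗ ξ`, for the inner product that makes different fibres orthogonal and
is `⟨ξ, φ(a* b) η⟩` inside a fibre; and `π` is the closure of the action of `A` by left
multiplication. (As the inner product is `A_e`-balanced, so is `ι`.) -/
structure IsInduced (𝒜 : StarGrading G A) {F : HilbertModule D} (φ : Rep 𝒜.unitFibre F)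
    (T : HilbertModule D) (ι : A →ₗ[ℂ] φ.dom →ₗ[ℂ] T) (π : Rep A T) : Prop where
  map_act : ∀ a (ξ : φ.dom) d, ι a ⟨F.act ξ d, φ.act_mem ξ ξ.2 d⟩ = T.act (ι a ξ) d
  inner_eq : ∀ (g : G) (a b : 𝒜.fibre g) (ξ η : φ.dom),
    T.inner (ι a ξ) (ι b η) = F.inner ξ (φ.toFun (𝒜.starMul a b) η)
  inner_eq_zero : ∀ (g h : G), g ≠ h → ∀ (a : 𝒜.fibre g) (b : 𝒜.fibre h) (ξ η : φ.dom),
    T.inner (ι a ξ) (ι b η) = 0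
  dense : Dense (Submodule.span ℂ {t : T | ∃ a ξ, t = ι a ξ} : Set T)
  closed : π.IsClosed
  core : π.IsCore (Submodule.span ℂ {t : T | ∃ a ξ, t = ι a ξ})
  map_mul : ∀ a b ξ (h : ι b ξ ∈ π.dom), (π.toFun a ⟨ι b ξ, h⟩ : T) = ι (a * b) ξ

/-- Integrability is compatible with induction. -/
def CompatibleWithInduction (𝒜 : StarGrading G A) (𝓘 : RepClass 𝒜.unitFibre) : Prop :=
  ∀ {D : Type u} [NonUnitalCStarAlgebra D] {F : HilbertModule D} (φ : Rep 𝒜.unitFibre F),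
    𝓘.Mem φ → IsInducible 𝒜 φ →
    ∀ (T : HilbertModule D) (ι : A →ₗ[ℂ] φ.dom →ₗ[ℂ] T) (π : Rep A T),
      IsInduced 𝒜 φ T ι π → 𝓘.Mem (π.restrict 𝒜.unitFibre)

end Graded

/-! ## The fibres `B_e⁺` and `B_g⁺` -/

/-- The closed two-sided ideal of `B` generated by `S`. -/
def closedIdeal {B : Type u} [NonUnitalCStarAlgebra B] (S : Set B) : Submodule ℂ B :=
  sInf {I : Submodule ℂ B | IsClosed (I : Set B) ∧
    (∀ b : B, ∀ x ∈ I, b * x ∈ I ∧ x * b ∈ I) ∧ S ⊆ I}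

section Fibres

variable {G : Type u} [Group G] {A : Type u} [Ring A] [Algebra ℂ A] [StarRing A] [StarModule ℂ A]
  {𝒜 : StarGrading G A} {𝓘 : RepClass 𝒜.unitFibre} {Be : Type u} [NonUnitalCStarAlgebra Be]

/-- The negative parts of the elements `∑ b_k* μ_e(a_k* a_l) b_l` for `a_1, …, a_n ∈ A_g` and
`b_1, …, b_n` in the domain of the universal representation `μ_e` of `A_e` on `B_e`. -/
def negativeParts (H : CStarHull 𝓘 Be) : Set Be :=
  {x | ∃ (g : G) (n : ℕ) (a : Fin n → 𝒜.fibre g) (b : Fin n → H.univ.dom),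
    x = (∑ k, ∑ l, star (H.val (b k)) *
      H.val (H.univ.toFun (𝒜.starMul (a k) (a l)) (b l)))⁻}

/-- The C*-algebra `B_e⁺`, which is the quotient of `B_e` by the closed ideal generated by
`negativeParts`, together with the Hilbert `B_e⁺`-modules `B_g⁺ = A_g ⊗_{A_e} B_e⁺`:
`B_g⁺` is the completion of the algebraic tensor product of `A_g` with the image in `B_e⁺` of the
domain of `μ_e`, for the inner product `⟨a₁ ⊗ b₁, a₂ ⊗ b₂⟩ = b₁* μ_e⁺(a₁* a₂) b₂`; here
`ι g a b` is the class of `a ⊗ q b`. These properties determine all data up to unique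
isomorphism. -/
structure PlusFibres (H : CStarHull 𝓘 Be) : Type (u + 1) where
  /-- the quotient `B_e⁺` -/
  unit : Type u
  [alg : NonUnitalCStarAlgebra unit]
  /-- the quotient map -/
  q : Be →⋆ₙₐ[ℂ] unit
  q_surjective : Function.Surjective q
  q_eq_zero_iff : ∀ x, q x = 0 ↔ x ∈ closedIdeal (negativeParts H)
  /-- the Hilbert module `B_g⁺` -/
  fibre : G → HilbertModule unit
  ι : ∀ g, 𝒜.fibre g →ₗ[ℂ] H.univ.dom →ₗ[ℂ] fibre g
  ι_act : ∀ g (a : 𝒜.fibre g) (b : H.univ.dom) (c : Be),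
    ι g a ⟨H.val b * c, H.univ.act_mem b b.2 c⟩ = (fibre g).act (ι g a b) (q c)
  ι_inner : ∀ g (a₁ a₂ : 𝒜.fibre g) (b₁ b₂ : H.univ.dom),
    (fibre g).inner (ι g a₁ b₁) (ι g a₂ b₂) =
      q (star (H.val b₁) * H.val (H.univ.toFun (𝒜.starMul a₁ a₂) b₂))
  ι_dense : ∀ g, Dense (Submodule.span ℂ {x : fibre g | ∃ a b, x = ι g a b} : Set (fibre g))

attribute [instance] PlusFibres.alg

end Fibres

/-! ## Fell bundles -/

section Fell

variable {G : Type u} [Group G]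

/-- A Fell bundle structure over the discrete group `G` on a family of Banach spaces. Identities
between elements of fibres over equal group elements are stated in the total space. The last
field says that `b* b` is positive in the C*-algebra `β 1`. -/
@[ext]
structure FellBundle (β : G → Type u) [∀ g, NormedAddCommGroup (β g)]
    [∀ g, NormedSpace ℂ (β g)] [∀ g, CompleteSpace (β g)] where
  mul : ∀ g h, β g →ₗ[ℂ] β h →ₗ[ℂ] β (g * h)
  star : ∀ g, β g →ₗ⋆[ℂ] β g⁻¹
  mul_assoc : ∀ {g h k} (a : β g) (b : β h) (c : β k),
    (⟨_, mul _ _ (mul _ _ a b) c⟩ : Σ g, β g) = ⟨_, mul _ _ a (mul _ _ b c)⟩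
  norm_mul_le : ∀ {g h} (a : β g) (b : β h), ‖mul _ _ a b‖ ≤ ‖a‖ * ‖b‖
  star_star : ∀ {g} (a : β g), (⟨_, star _ (star _ a)⟩ : Σ g, β g) = ⟨_, a⟩
  star_mul : ∀ {g h} (a : β g) (b : β h),
    (⟨_, star _ (mul _ _ a b)⟩ : Σ g, β g) = ⟨_, mul _ _ (star _ b) (star _ a)⟩
  norm_star : ∀ {g} (a : β g), ‖star _ a‖ = ‖a‖
  norm_star_mul_self : ∀ {g} (a : β g), ‖mul _ _ (star _ a) a‖ = ‖a‖ ^ 2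
  star_mul_self_pos : ∀ {g} (a : β g), ∃ c : β 1,
    (⟨_, mul _ _ (star _ a) a⟩ : Σ g, β g) = ⟨_, mul _ _ (star _ c) c⟩

variable {β : G → Type u} [∀ g, NormedAddCommGroup (β g)]
    [∀ g, NormedSpace ℂ (β g)] [∀ g, CompleteSpace (β g)]

/-- A (nondegenerate) representation of a Fell bundle on a Hilbert module. -/
structure FellBundle.IsRep (𝓕 : FellBundle β) {D : Type u} [NonUnitalCStarAlgebra D]
    {E : HilbertModule D} (σ : ∀ g, β g →L[ℂ] (E →L[ℂ] E)) : Prop where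
  map_mul : ∀ {g h} (a : β g) (b : β h) x, σ _ (𝓕.mul _ _ a b) x = σ _ a (σ _ b x)
  adjoint : ∀ {g} (a : β g) x y, E.inner (σ _ a x) y = E.inner x (σ _ (𝓕.star _ a) y)
  nondegenerate : Dense (Submodule.span ℂ {y : E | ∃ g b x, y = σ g b x} : Set E)

open scoped Classical in
/-- Multiplication in the *-algebra `⨁ g, β g` of a Fell bundle. -/
def FellBundle.sectionMul (𝓕 : FellBundle β) : (⨁ g, β g) →ₗ[ℂ] (⨁ g, β g) →ₗ[ℂ] (⨁ g, β g) :=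
  DirectSum.toModule ℂ G _ fun g => LinearMap.flip <| DirectSum.toModule ℂ G _ fun h =>
    ((𝓕.mul g h).compr₂ (DirectSum.lof ℂ G β (g * h))).flip

open scoped Classical in
/-- Involution in the *-algebra `⨁ g, β g` of a Fell bundle. -/
def FellBundle.sectionStar (𝓕 : FellBundle β) : (⨁ g, β g) →+ (⨁ g, β g) :=
  DirectSum.toAddMonoid fun g => (DirectSum.of β g⁻¹).comp (𝓕.star g).toAddMonoidHom

/-- C*-seminorms on the *-algebra `⨁ g, β g`. -/
structure FellBundle.IsCStarSeminorm (𝓕 : FellBundle β) (p : Seminorm ℂ (⨁ g, β g)) : Prop where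
  mul_le : ∀ x y, p (𝓕.sectionMul x y) ≤ p x * p y
  star_mul_self : ∀ x, p (𝓕.sectionMul (𝓕.sectionStar x) x) = p x ^ 2

/-- `B` with the *-homomorphism `j` is the section C*-algebra of the Fell bundle: the completion
of `⨁ g, β g` in the maximal C*-seminorm. -/
structure FellBundle.IsSectionAlgebra (𝓕 : FellBundle β) (B : Type u) [NonUnitalCStarAlgebra B]
    (j : (⨁ g, β g) →ₗ[ℂ] B) : Prop where
  map_mul : ∀ x y, j (𝓕.sectionMul x y) = j x * j y
  map_star : ∀ x, j (𝓕.sectionStar x) = Star.star (j x)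
  dense : DenseRange j
  maximal : ∀ p : Seminorm ℂ (⨁ g, β g), 𝓕.IsCStarSeminorm p → ∀ x, p x ≤ ‖j x‖

end Fell

/-! ## The Fell bundle of a graded *-algebra -/

section Main

variable {G : Type u} [Group G] {A : Type u} [Ring A] [Algebra ℂ A] [StarRing A] [StarModule ℂ A]
  {𝒜 : StarGrading G A} {𝓘 : RepClass 𝒜.unitFibre} {Be : Type u} [NonUnitalCStarAlgebra Be]
  {H : CStarHull 𝓘 Be}

/-- `σ g : B_g⁺ → 𝔹(E)` is the family of maps induced by an integrable representation `π` of `A`: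
`σ g (a ⊗ b) = π(a) ρ(b)` for `a ∈ A_g` and `b` in the domain of `μ_e`, where `ρ` is the
representation of `B_e` that corresponds to the restriction of `π` to `A_e`. -/
def PlusFibres.IsFibreRep (𝓑 : PlusFibres H) {D : Type u} [NonUnitalCStarAlgebra D]
    {E : HilbertModule D} (π : Rep A E) (σ : ∀ g, 𝓑.fibre g →L[ℂ] (E →L[ℂ] E)) : Prop :=
  ∃ ρ : CStarRep Be E, H.Φ ρ = π.restrict 𝒜.unitFibre ∧
    ∀ g (a : 𝒜.fibre g) (b : H.univ.dom) (x : E), ∃ h : ρ.toFun (H.val b) x ∈ π.dom,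
      σ g (𝓑.ι g a b) x = π.toFun a ⟨ρ.toFun (H.val b) x, h⟩

/-- The Fell bundle structure `𝓕` on the fibres `B_g⁺` turns the maps `B_g⁺ → 𝔹(E)` induced by
any integrable representation of `A` into a representation of the Fell bundle. -/
def PlusFibres.IsCanonical (𝓑 : PlusFibres H) (𝓕 : FellBundle fun g => 𝓑.fibre g) : Prop :=
  ∀ {D : Type u} [NonUnitalCStarAlgebra D] {E : HilbertModule D} (π : Rep A E),
    (𝓘.extend 𝒜).Mem π →
      ∃ σ : ∀ g, 𝓑.fibre g →L[ℂ] (E →L[ℂ] E), 𝓑.IsFibreRep π σ ∧ 𝓕.IsRep σ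

/-- `v : B_e⁺ → A_e ⊗_{A_e} B_e⁺` is the canonical isomorphism (inverse to `a ⊗ b ↦ μ_e⁺(a) b`),
and under it the multiplication and involution of the Fell bundle restrict to those of the
C*-algebra `B_e⁺` and give the Hilbert `B_e⁺`-module structure on each `B_g⁺`, that is,
`x · b` is the product of `x` and `b`, and `⟨x, y⟩ = x* y`. -/
structure PlusFibres.IsUnitIso (𝓑 : PlusFibres H) (𝓕 : FellBundle fun g => 𝓑.fibre g)
    (v : 𝓑.unit ≃ₗᵢ[ℂ] 𝓑.fibre 1) : Prop where
  map_ι : ∀ (a : 𝒜.unitFibre) (b : H.univ.dom),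
    v (𝓑.q (H.val (H.univ.toFun a b))) = 𝓑.ι 1 ⟨a, a.2⟩ b
  map_mul : ∀ b c, (⟨_, 𝓕.mul _ _ (v b) (v c)⟩ : Σ g, 𝓑.fibre g) = ⟨_, v (b * c)⟩
  map_star : ∀ b, (⟨_, 𝓕.star _ (v b)⟩ : Σ g, 𝓑.fibre g) = ⟨_, v (star b)⟩
  mul_eq_act : ∀ {g} (x : 𝓑.fibre g) b,
    (⟨_, 𝓕.mul _ _ x (v b)⟩ : Σ g, 𝓑.fibre g) = ⟨_, (𝓑.fibre g).act x b⟩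
  star_mul_eq_inner : ∀ {g} (x y : 𝓑.fibre g),
    (⟨_, 𝓕.mul _ _ (𝓕.star _ x) y⟩ : Σ g, 𝓑.fibre g) = ⟨_, v ((𝓑.fibre g).inner x y)⟩

open scoped Classical in
/-- The C*-hull structure `K` on the section C*-algebra `(B, j)` is the canonical one: for an
integrable representation `π` of `A`, the corresponding representation of `B` restricts on the
fibres to the maps `B_g⁺ → 𝔹(E)` induced by `π`. -/
def PlusFibres.IsCanonicalHull (𝓑 : PlusFibres H) {B : Type u} [NonUnitalCStarAlgebra B]
    (j : (⨁ g, 𝓑.fibre g) →ₗ[ℂ] B) (K : CStarHull (𝓘.extend 𝒜) B) : Prop :=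
  ∀ {D : Type u} [NonUnitalCStarAlgebra D] {E : HilbertModule D} (ϱ : CStarRep B E),
    ∃ σ : ∀ g, 𝓑.fibre g →L[ℂ] (E →L[ℂ] E), 𝓑.IsFibreRep (K.Φ ϱ) σ ∧
      ∀ g (x : 𝓑.fibre g), ϱ.toFun (j (DirectSum.lof ℂ G (fun g => 𝓑.fibre g) g x)) = σ g x

end Main

end FellInduction

end

open FellInduction

noncomputable section

set_option linter.unusedSectionVars false

namespace FellInduction

section

/-! ## Positive elements and the functional calculus -/

section Positive

variable {D : Type u} [NonUnitalCStarAlgebra D]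

/-! Let `π` be an integrable representation of `A` and let `ρ` be the representation of `B_e` that
corresponds to its restriction to `A_e`. The operators `π(a)ρ(b)` for `a ∈ A_g` satisfy `⟨π(a)ρ(b)ξ,
π(a')ρ(b')η⟩ = ⟨ξ, ρ(b* μ_e(a* a') b')η⟩`, because `a* a'` lies in `A_e`, where the hull describes
the action. Hence `ρ` sends the Gram sums to positive operators, kills their negative parts and
factors through `B_e⁺`; by the same formula `a ⊗ b ↦ π(a)ρ(b)` extends to all of `B_g⁺`
(`exists_fibreRep`). Conversely, modulo the ideal the Gram sums are positive, so the modules `B_g⁺`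
exist (`exists_fibre`).

The Fell bundle is read off from one faithful model. The representation of `A_e` on `B_e⁺` is
inducible (`isInducible_quotRep`), so by compatibility with induction it induces an integrable
representation of `A`, the regular one (`nonempty_regularRep`). It contains each `B_g⁺` as its part
of degree `g`, and `B_g⁺` acts on it isometrically (`norm_op`). So identities in the bundle may be
checked on operators (`sigma_ext`). What remains is that products and adjoints of these operators
come from the fibres, in every integrable representation at once (`op_mul`, `exists_isAdj`).

Two devices make this work. First, the hull only controls isometries, tensor products and closed
representations, so `B_e`-equivariance of other maps must be reduced to these: the projection to
degree `g` through a reflection (`exists_reflection`, `exists_compr`), and the maps `B_g⁺ ⊗ E → E`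
through interior tensor products (`CStarHull.transfer`). This gives the left action of `B_e` on
`B_g⁺` and its compatibility with all integrable representations (`rep_op`). Secondly, `‖π(a)ξ‖² =
‖⟨ξ, π(a* a)ξ⟩‖` shows that the graph topologies of `π` and of its restriction to `A_e` agree
(`tendsto_zero_of_unitFibre`), so closedness and cores pass between the two.

Finally, a C*-seminorm on the sections is bounded on each fibre by the fibre norm, because a
C*-seminorm on a C*-algebra is bounded by its norm (`cstarSeminorm_le_norm`); so the section algebra
exists. Its representations are those of the Fell bundle, and each of these comes from an integrable
representation of `A` (`exists_integrable`). The axioms of a hull for `A` are then deduced from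
those for `A_e`. -/

theorem isPos_iff_nonneg [PartialOrder D] [StarOrderedRing D] {d : D} : IsPos d ↔ 0 ≤ d := by
  rw [CStarAlgebra.nonneg_iff_eq_star_mul_self]
  rfl

theorem IsPos.isSelfAdjoint {d : D} (h : IsPos d) : IsSelfAdjoint d := by
  obtain ⟨c, rfl⟩ := h
  exact IsSelfAdjoint.star_mul_self c

theorem IsPos.sum {ι : Type*} (s : Finset ι) {f : ι → D} (h : ∀ i ∈ s, IsPos (f i)) :
    IsPos (∑ i ∈ s, f i) := by
  let _ := CStarAlgebra.spectralOrder D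
  have _ := CStarAlgebra.spectralOrderedRing D
  simp only [isPos_iff_nonneg] at *
  exact Finset.sum_nonneg h

theorem isClosed_isPos : IsClosed {d : D | IsPos d} := by
  let _ := CStarAlgebra.spectralOrder D
  have _ := CStarAlgebra.spectralOrderedRing D
  simp only [isPos_iff_nonneg]
  exact CStarAlgebra.isClosed_nonneg

theorem IsPos.norm_le_norm {c d : D} (hc : IsPos c) (h : IsPos (d - c)) : ‖c‖ ≤ ‖d‖ := by
  let _ := CStarAlgebra.spectralOrder D
  have _ := CStarAlgebra.spectralOrderedRing D
  rw [isPos_iff_nonneg] at *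
  exact CStarAlgebra.norm_le_norm_of_nonneg_of_le hc (sub_nonneg.1 h)

theorem IsPos.map {C : Type u} [NonUnitalCStarAlgebra C] {d : D} (h : IsPos d)
    (f : D →⋆ₙₐ[ℂ] C) : IsPos (f d) := by
  obtain ⟨c, rfl⟩ := h
  exact ⟨f c, by rw [map_mul, map_star]⟩

/-- For a contraction `b`, the element `1 - b* b` is the square of `1 - d` for some
self-adjoint `d`. -/
theorem exists_two_smul_sub_sq (b : D) (hb : ‖b‖ ≤ 1) :
    ∃ d : D, star d = d ∧ d + d - d * d = star b * b := by
  let _ := CStarAlgebra.spectralOrder D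
  have _ := CStarAlgebra.spectralOrderedRing D
  have hsa : IsSelfAdjoint (star b * b) := IsSelfAdjoint.star_mul_self b
  -- Formally `d = 1 - √(1 - b* b)`, so `(1 - d)² = 1 - b* b`. As `f 0 = 0`, the element `d` exists
  -- without a unit.
  set f : ℝ → ℝ := fun t => 1 - √(1 - t) with hf
  have hfc : Continuous f := by fun_prop
  refine ⟨cfcₙ f (star b * b), cfcₙ_predicate f (star b * b), ?_⟩
  have f0 : f 0 = 0 := by simp [hf]
  rw [← cfcₙ_add f f (star b * b) hfc.continuousOn f0 hfc.continuousOn f0,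
    ← cfcₙ_mul f f (star b * b) hfc.continuousOn f0 hfc.continuousOn f0,
    ← cfcₙ_sub _ _ (star b * b) (by fun_prop) (by simp [f0]) (by fun_prop) (by simp [f0])]
  conv_rhs => rw [← cfcₙ_id' ℝ (star b * b)]
  refine cfcₙ_congr fun t ht => ?_
  have ht1 : t ≤ 1 := by
    have h1 : ‖t‖ ≤ ‖star b * b‖ := by
      simpa [cfcₙ_id' ℝ (star b * b)] using norm_apply_le_norm_cfcₙ (fun t : ℝ => t) (star b * b) ht
    rw [CStarRing.norm_star_mul_self] at h1
    have := le_abs_self t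
    rw [Real.norm_eq_abs] at h1
    nlinarith [norm_nonneg b]
  have := Real.mul_self_sqrt (sub_nonneg.2 ht1)
  simp only [hf]
  nlinarith

/-- For a self-adjoint contraction `h`, the unitary `√(1 - h²) - i h` is of the form `1 + w`. -/
theorem exists_unitary_sub_one (h : D) (hh : IsSelfAdjoint h) (h1 : ‖h‖ ≤ 1) :
    ∃ w : D, star w * w + w + star w = 0 ∧ w * star w + w + star w = 0 ∧
      w - star w = (-2 * Complex.I) • h := by
  -- Subtracting 1 gives `f 0 = 0`, so that `w = f(h) - i h` lies in the nonunital algebra.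
  set f : ℝ → ℝ := fun t => √(1 - t ^ 2) - 1 with hf
  have hfc : Continuous f := by fun_prop
  have f0 : f 0 = 0 := by simp [hf]
  set c := cfcₙ f h with hc
  have hcs : star c = c := cfcₙ_predicate f h
  have hcomm : c * h = h * c := by
    have : h = cfcₙ (fun t : ℝ => t) h := (cfcₙ_id' ℝ h).symm
    conv_lhs => rw [this, hc, ← this]
    conv_rhs => rw [this, hc, ← this]
    have := (cfcₙ_commute_cfcₙ f (fun t : ℝ => t) h).eq
    rwa [cfcₙ_id' ℝ h] at this
  have hsq : c * c + c + c + h * h = 0 := by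
    have e1 : c * c = cfcₙ (fun t => f t * f t) h :=
      (cfcₙ_mul f f h hfc.continuousOn f0 hfc.continuousOn f0).symm
    have e2 : h * h = cfcₙ (fun t : ℝ => t * t) h := by
      rw [cfcₙ_mul (fun t : ℝ => t) (fun t : ℝ => t) h, cfcₙ_id' ℝ h]
    rw [e1, e2, hc, ← cfcₙ_add _ _ h (by fun_prop) (by simp [f0]) (by fun_prop) (by simp [f0]),
      ← cfcₙ_add _ _ h (by fun_prop) (by simp [f0]) (by fun_prop) (by simp [f0]),
      ← cfcₙ_add _ _ h (by fun_prop) (by simp [f0]) (by fun_prop) (by simp)]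
    rw [← cfcₙ_zero ℝ h]
    refine cfcₙ_congr fun t ht => ?_
    have ht1 : |t| ≤ 1 := by
      have h2 : ‖t‖ ≤ ‖h‖ := by
        simpa [cfcₙ_id' ℝ h] using norm_apply_le_norm_cfcₙ (fun t : ℝ => t) h ht
      rw [Real.norm_eq_abs] at h2
      linarith
    have h2 : t ^ 2 ≤ 1 := (sq_le_one_iff_abs_le_one t).2 ht1
    have := Real.mul_self_sqrt (sub_nonneg.2 h2)
    simp only [hf, Pi.zero_apply]
    nlinarith
  have hI : star (Complex.I • h) = -(Complex.I • h) := by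
    rw [star_smul, hh.star_eq]; simp
  have hII : (Complex.I • h) * (Complex.I • h) = -(h * h) := by
    rw [smul_mul_smul_comm]; simp
  have hIc : (Complex.I • h) * c = c * (Complex.I • h) := by
    rw [smul_mul_assoc, mul_smul_comm, hcomm]
  refine ⟨c - Complex.I • h, ?_, ?_, ?_⟩
  · rw [star_sub, hcs, hI, sub_neg_eq_add, add_mul, mul_sub, mul_sub, hII, hIc]
    rw [← hsq]; abel
  · rw [star_sub, hcs, hI, sub_neg_eq_add, sub_mul, mul_add, mul_add, hII, hIc]
    rw [← hsq]; abel
  · rw [star_sub, hcs, hI, mul_smul, neg_smul, two_smul]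
    abel

end Positive

/-- A C*-seminorm on a C*-algebra is bounded by the norm. -/
theorem cstarSeminorm_le_norm {D : Type u} [NonUnitalCStarAlgebra D] (p : Seminorm ℂ D)
    (hmul : ∀ x, p (star x * x) = p x ^ 2) (x : D) : p x ≤ ‖x‖ := by
  have key : ∀ h : D, IsSelfAdjoint h → ‖h‖ ≤ 1 → p h ≤ 1 := by
    intro h hh h1
    obtain ⟨w, hw1, hw2, hw3⟩ := exists_unitary_sub_one h hh h1
    -- Left multiplication by the unitary `1 + w` does not change `x* x`, hence preserves `p` by the
    -- C*-identity. Submultiplicativity of `p` is not needed.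
    have hiso : ∀ (w : D), star w * w + w + star w = 0 → ∀ x, p (x + w * x) = p x := by
      intro w hw x
      have e : star (x + w * x) * (x + w * x) = star x * x := by
        have : star (x + w * x) * (x + w * x) =
            star x * x + star x * ((star w * w + w + star w) * x) := by
          simp only [star_add, star_mul, add_mul, mul_add, mul_assoc]; abel
        rw [this, hw]; simp
      have h2 := hmul (x + w * x)
      rw [e, hmul] at h2
      exact ((pow_left_inj₀ (apply_nonneg p _) (apply_nonneg p _) two_ne_zero).1 h2).symm
    -- `2i h` is the difference of the unitaries `1 + w*` and `1 + w`, both of which preserve `p`.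
    have hle : ∀ x, p (h * x) ≤ p x := by
      intro x
      have e : (2 * Complex.I) • (h * x) = (x + star w * x) - (x + w * x) := by
        have : (x + star w * x) - (x + w * x) = -((w - star w) * x) := by
          rw [sub_mul]; abel
        rw [this, hw3, smul_mul_assoc, ← neg_smul]; congr 1; ring
      have h2 : p ((2 * Complex.I) • (h * x)) ≤ p x + p x := by
        rw [e]
        refine (map_sub_le_add p _ _).trans ?_
        rw [hiso w hw1, hiso (star w) (by rw [star_star, ← hw2]; abel)]
      rw [map_smul_eq_mul] at h2
      simp at h2
      linarith
    -- The previous bound for `x = h` together with the C*-identity `p(h²) = p(h)²`.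
    have h3 : p h ^ 2 ≤ p h := by
      rw [← hmul, hh.star_eq]; exact hle h
    nlinarith [apply_nonneg p h]
  have key2 : ∀ h : D, IsSelfAdjoint h → p h ≤ ‖h‖ := by
    intro h hh
    rcases eq_or_ne h 0 with rfl | h0
    · simp
    have hn : 0 < ‖h‖ := norm_pos_iff.2 h0
    have := key (((‖h‖⁻¹ : ℝ) : ℂ) • h) (by
      rw [IsSelfAdjoint, star_smul, hh.star_eq]; simp) (by
      rw [norm_smul]; simp [hn.ne'])
    rw [map_smul_eq_mul] at this
    simp only [Complex.norm_real, norm_inv, norm_norm] at this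
    rwa [inv_mul_le_iff₀ hn, mul_one] at this
  have h1 := key2 _ (IsSelfAdjoint.star_mul_self x)
  rw [hmul, CStarRing.norm_star_mul_self, ← sq] at h1
  exact (pow_le_pow_iff_left₀ (apply_nonneg p x) (norm_nonneg x) two_ne_zero).1 h1

end

section

/-! ## Completions -/

section Completion

/-- The Banach space completion of a vector space for a seminorm. -/
theorem exists_banach_completion {W : Type u} [AddCommGroup W] [Module ℂ W]
    (p : Seminorm ℂ W) : ∃ (T : Type u) (_ : NormedAddCommGroup T) (_ : NormedSpace ℂ T)
      (_ : CompleteSpace T) (j : W →ₗ[ℂ] T), DenseRange j ∧ ∀ x, ‖j x‖ = p x := by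
  let _ : SeminormedAddCommGroup W := p.toAddGroupSeminorm.toSeminormedAddCommGroup
  let _ : NormedSpace ℂ W := ⟨fun z x => (map_smul_eq_mul p z x).le⟩
  refine ⟨UniformSpace.Completion W, inferInstance, inferInstance, inferInstance,
    (UniformSpace.Completion.toComplL (𝕜 := ℂ) (E := W)).toLinearMap,
    UniformSpace.Completion.denseRange_coe, fun x => ?_⟩
  exact UniformSpace.Completion.norm_coe x

/-- Bounded sesquilinear or bilinear maps extend from a dense subspace. -/
theorem exists_extension₂ {σ : ℂ →+* ℂ} [RingHomIsometric σ] {V T D : Type*} [AddCommGroup V]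
    [Module ℂ V] [NormedAddCommGroup T] [NormedSpace ℂ T] [NormedAddCommGroup D] [NormedSpace ℂ D]
    [CompleteSpace D] (e : V →ₗ[ℂ] T) (he : DenseRange e) (f : V →ₛₗ[σ] V →ₗ[ℂ] D)
    (hf : ∀ x y, ‖f x y‖ ≤ ‖e x‖ * ‖e y‖) :
    ∃ F : T →SL[σ] T →L[ℂ] D, (∀ x y, F (e x) (e y) = f x y) ∧ ∀ s t, ‖F s t‖ ≤ ‖s‖ * ‖t‖ := by
  -- Extend in the second variable first. The resulting operator has norm at most `‖e x‖`, which is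
  -- the bound needed to extend in the first variable.
  let g : V →ₛₗ[σ] T →L[ℂ] D :=
    { toFun := fun x => (f x).extendOfNorm e
      map_add' := fun x y => by
        refine LinearMap.extendOfNorm_unique he (‖e (x + y)‖) (hf (x + y)) _ ?_
        ext z
        simp [LinearMap.extendOfNorm_eq he ⟨_, hf x⟩, LinearMap.extendOfNorm_eq he ⟨_, hf y⟩]
      map_smul' := fun c x => by
        refine LinearMap.extendOfNorm_unique he (‖e (c • x)‖) (hf (c • x)) _ ?_
        ext z
        simp [LinearMap.extendOfNorm_eq he ⟨_, hf x⟩] }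
  have hg : ∀ x, ‖g x‖ ≤ 1 * ‖e x‖ := fun x => by
    rw [one_mul]
    exact LinearMap.opNorm_extendOfNorm_le he (norm_nonneg _) (hf x)
  refine ⟨g.extendOfNorm e, fun x y => ?_, fun s t => ?_⟩
  · rw [LinearMap.extendOfNorm_eq he ⟨1, hg⟩]
    exact LinearMap.extendOfNorm_eq he ⟨_, hf x⟩ y
  · refine (ContinuousLinearMap.le_opNorm _ _).trans ?_
    gcongr
    simpa using LinearMap.norm_extendOfNorm_apply_le he 1 hg s

/-- The completion of a *-algebra for a C*-seminorm. -/
theorem exists_cstar_completion {W : Type u} [AddCommGroup W] [Module ℂ W]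
    (m : W →ₗ[ℂ] W →ₗ[ℂ] W) (s : W →+ W) (hassoc : ∀ x y z, m (m x y) z = m x (m y z))
    (hsmul : ∀ (z : ℂ) x, s (z • x) = star z • s x) (hss : ∀ x, s (s x) = x)
    (hsm : ∀ x y, s (m x y) = m (s y) (s x)) (p : Seminorm ℂ W)
    (hpm : ∀ x y, p (m x y) ≤ p x * p y) (hps : ∀ x, p (m (s x) x) = p x ^ 2) :
    ∃ (B : Type u) (_ : NonUnitalCStarAlgebra B) (j : W →ₗ[ℂ] B),
      (∀ x y, j (m x y) = j x * j y) ∧ (∀ x, j (s x) = star (j x)) ∧ DenseRange j ∧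
      ∀ x, ‖j x‖ = p x := by
  obtain ⟨B, _, _, _, j, hj, hjp⟩ := exists_banach_completion p
  -- `p(x)² = p(x* x) ≤ p(x*) p(x)`; this makes the involution isometric, so that it extends to the
  -- completion.
  have hpstar_le : ∀ x, p x ≤ p (s x) := by
    intro x
    have h := (hps x).symm.le.trans (hpm (s x) x)
    rcases (apply_nonneg p x).eq_or_lt with h0 | h0
    · rw [← h0]; exact apply_nonneg p _
    · nlinarith
  have hpstar : ∀ x, p (s x) = p x := fun x =>
    le_antisymm (by simpa [hss] using hpstar_le (s x)) (hpstar_le x)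
  obtain ⟨M, hM, hMn⟩ := exists_extension₂ j hj (m.compr₂ j) (fun x y => by
    simpa [hjp] using hpm x y)
  let s' : W →ₗ⋆[ℂ] B :=
    { toFun := fun x => j (s x), map_add' := fun x y => by simp
      map_smul' := fun c x => by simp [hsmul] }
  have hs'n : ∀ x, ‖s' x‖ ≤ 1 * ‖j x‖ := fun x => by simp [s', hjp, hpstar]
  set S : B →SL[starRingEnd ℂ] B := s'.extendOfNorm j with hSdef
  have hS : ∀ x, S (j x) = j (s x) := LinearMap.extendOfNorm_eq hj ⟨1, hs'n⟩
  have hMc : Continuous fun t : B × B => M t.1 t.2 := by fun_prop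
  have hSS : ∀ x, S (S x) = x := fun x => by
    refine hj.induction_on x (isClosed_eq (by fun_prop) continuous_id) fun a => ?_
    rw [hS, hS, hss]
  have hMa : ∀ x y z, M (M x y) z = M x (M y z) := fun x y z => by
    refine hj.induction_on₃ (isClosed_eq (by fun_prop) (by fun_prop)) (fun a b c => ?_) x y z
    have h1 : ∀ a b, M (j a) (j b) = j (m a b) := hM
    simp only [h1, hassoc]
  have h1 : ∀ a b, M (j a) (j b) = j (m a b) := hM
  have hSM : ∀ x y, S (M x y) = M (S y) (S x) := fun x y => by
    refine hj.induction_on₂ (isClosed_eq (by fun_prop) (by fun_prop)) (fun a b => ?_) x y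
    simp only [h1, hS, hsm]
  have hC : ∀ x, ‖M (S x) x‖ = ‖x‖ * ‖x‖ := fun x => by
    refine hj.induction_on x (isClosed_eq (by fun_prop) (by fun_prop)) fun a => ?_
    rw [hS, h1, hjp, hps, hjp, sq]
  let _ : NonUnitalNormedRing B :=
    { (inferInstance : NormedAddCommGroup B) with
      mul := fun x y => M x y
      left_distrib := fun x y z => (M x).map_add y z
      right_distrib := fun x y z => by
        change M (x + y) z = M x z + M y z
        simp
      zero_mul := fun x => by change M 0 x = 0; simp
      mul_zero := fun x => (M x).map_zero
      mul_assoc := hMa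
      norm_mul_le := hMn }
  let _ : StarRing B :=
    { star := S, star_involutive := hSS, star_mul := hSM, star_add := fun x y => S.map_add x y }
  refine ⟨B,
    { (inferInstance : NonUnitalNormedRing B), (inferInstance : StarRing B),
      (inferInstance : NormedSpace ℂ B) with
      complete := fun hf => CompleteSpace.complete hf
      norm_mul_self_le := fun x => (hC x).symm.le
      smul_assoc := fun z x y => by change M (z • x) y = z • M x y; simp
      smul_comm := fun z x y => by change z • M x y = M x (z • y); simp
      star_smul := fun z x => by change S (z • x) = star z • S x; simp }, j, ?_, fun x => (hS x).symm, hj, hjp⟩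
  exact fun x y => (h1 x y).symm

end Completion

end

section

/-! ## Quotients of C*-algebras -/

section Quotient

variable {B : Type u} [NonUnitalCStarAlgebra B]

open Unitization in
/-- If `b* b ≤ s + w`, then `b` is small modulo the right ideal generated by `w`. -/
theorem exists_norm_sub_mul_sq_le (w : B) (hw : IsPos w) {s δ : ℝ} (hs : 0 ≤ s) (hδ : 0 < δ) :
    ∃ (u : B) (n : ℝ), u = n • w - n • (w * u) ∧
      ∀ b : B, star (b : Unitization ℂ B) * b ≤ algebraMap ℝ (Unitization ℂ B) s + w →
        ‖b - b * u‖ ^ 2 ≤ s + δ := by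
  let _ := CStarAlgebra.spectralOrder B
  have _ := CStarAlgebra.spectralOrderedRing B
  rw [isPos_iff_nonneg] at hw
  have hwsa : IsSelfAdjoint w := hw.isSelfAdjoint
  have hWsa : IsSelfAdjoint (w : Unitization ℂ B) := hwsa.inr ℂ
  have hW : 0 ≤ (w : Unitization ℂ B) := inr_nonneg_iff.2 hw
  obtain ⟨n, hn0, hn⟩ : ∃ n : ℝ, 0 < n ∧ n⁻¹ ≤ δ := ⟨δ⁻¹, inv_pos.2 hδ, by simp⟩
  -- On the spectrum of `w` this is `nt / (1 + nt)`, so `1 - u = (1 + n w)⁻¹`. The absolute value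
  -- only makes `f` continuous on the whole line.
  set f : ℝ → ℝ := fun t => n * t / (1 + n * |t|) with hf
  have hpos : ∀ t : ℝ, 1 + n * |t| ≠ 0 := fun t => by positivity
  have hfc : Continuous f := by
    simp only [hf]
    exact Continuous.div (by fun_prop) (by fun_prop) hpos
  have f0 : f 0 = 0 := by simp [hf]
  set u := cfcₙ f w with hu
  have husa : IsSelfAdjoint u := cfcₙ_predicate f w
  have hqs : ∀ t ∈ quasispectrum ℝ w, 0 ≤ t := fun t ht => quasispectrum_nonneg_of_nonneg w hw t ht
  have hsp : ∀ t ∈ spectrum ℝ (w : Unitization ℂ B), 0 ≤ t :=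
    fun t ht => spectrum_nonneg_of_nonneg hW ht
  refine ⟨u, n, ?_, fun b hb => ?_⟩
  · have e : w * u = cfcₙ (fun t => t * f t) w := by
      rw [cfcₙ_mul (fun t : ℝ => t) f w (by fun_prop) rfl hfc.continuousOn f0, cfcₙ_id' ℝ w]
    have e1 : n • w = cfcₙ (fun t : ℝ => n • t) w := by
      rw [cfcₙ_smul n (fun t : ℝ => t) w (by fun_prop) rfl, cfcₙ_id' ℝ w]
    rw [e, e1, ← cfcₙ_smul n (fun t => t * f t) w (by fun_prop) (by simp),
      ← cfcₙ_sub _ _ w (by fun_prop) (by simp) (by fun_prop) (by simp)]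
    refine cfcₙ_congr fun t ht => ?_
    have h0 := hqs t ht
    have := hpos t
    simp only [hf, abs_of_nonneg h0, smul_eq_mul] at this ⊢
    field_simp
    ring
  · have huf : (u : Unitization ℂ B) = cfc f (w : Unitization ℂ B) := by
      rw [hu]
      exact (Unitization.real_cfcₙ_eq_cfc_inr w f f0)
    -- `b - b u = b c`, so `‖b - b u‖² = ‖c b* b c‖ ≤ ‖c (s + w) c‖`, and the right-hand side is a
    -- function of `w`.
    set c : Unitization ℂ B := 1 - u with hc
    have hcsa : star c = c := by
      rw [hc, star_sub, star_one, ← Unitization.inr_star, husa.star_eq]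
    have hcf : c = cfc (fun t => 1 - f t) (w : Unitization ℂ B) := by
      rw [cfc_sub (fun _ => (1 : ℝ)) f _ (by fun_prop) hfc.continuousOn,
        cfc_const_one ℝ (w : Unitization ℂ B), ← huf]
    have e0 : ‖b - b * u‖ ^ 2 = ‖star c * (star (b : Unitization ℂ B) * b) * c‖ := by
      have : ((b - b * u : B) : Unitization ℂ B) = b * c := by
        rw [hc, mul_sub, mul_one, inr_sub, inr_mul]
      rw [← norm_inr (𝕜 := ℂ), this, sq, ← CStarRing.norm_star_mul_self, star_mul]
      simp only [mul_assoc]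
    have e1 : star c * (star (b : Unitization ℂ B) * b) * c ≤
        star c * (algebraMap ℝ (Unitization ℂ B) s + w) * c :=
      star_left_conjugate_le_conjugate hb c
    have e2 : 0 ≤ star c * (star (b : Unitization ℂ B) * b) * c := by
      have : star c * (star (b : Unitization ℂ B) * b) * c = star (b * c) * (b * c) := by
        rw [star_mul]; simp only [mul_assoc]
      rw [this]; exact star_mul_self_nonneg _
    have e3 : star c * (algebraMap ℝ (Unitization ℂ B) s + w) * c =
        cfc (fun t => (1 - f t) * (s + t) * (1 - f t)) (w : Unitization ℂ B) := by
      rw [cfc_mul (fun t => (1 - f t) * (s + t)) (fun t => 1 - f t) _ (by fun_prop) (by fun_prop),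
        cfc_mul (fun t => (1 - f t)) (fun t => s + t) _ (by fun_prop) (by fun_prop), ← hcf, hcsa,
        cfc_add (a := (w : Unitization ℂ B)) (fun _ => s) (fun t => t) (by fun_prop) (by fun_prop),
        cfc_const s _, cfc_id' ℝ (w : Unitization ℂ B)]
    rw [e0]
    refine (CStarAlgebra.norm_le_norm_of_nonneg_of_le e2 e1).trans ?_
    rw [e3]
    refine norm_cfc_le (by positivity) fun t ht => ?_
    have h0 := hsp t ht
    have h1 : 1 - f t = (1 + n * t)⁻¹ := by
      have := hpos t
      simp only [hf, abs_of_nonneg h0] at this ⊢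
      field_simp; ring
    have hnt : 0 < 1 + n * t := by positivity
    rw [h1, Real.norm_of_nonneg (by positivity)]
    -- This quotient is at most `s + δ` because `t ≤ n δ t`, which a summand of `δ (1 + n t)²`
    -- absorbs.
    have : (1 + n * t)⁻¹ * (s + t) * (1 + n * t)⁻¹ = (s + t) / (1 + n * t) ^ 2 := by
      field_simp
    rw [this, div_le_iff₀ (by positivity)]
    have h2 : 1 ≤ n * δ := by
      rwa [inv_le_iff_one_le_mul₀ hn0, mul_comm] at hn
    have h3 : t ≤ t * (n * δ) := le_mul_of_one_le_right h0 h2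
    nlinarith [mul_nonneg hs h0, mul_nonneg hn0.le h0, mul_nonneg hs (mul_nonneg hn0.le h0),
      mul_nonneg hδ.le (sq_nonneg (n * t)), mul_nonneg hs (sq_nonneg (n * t))]

open Unitization in
-- Taking real parts gives `b* b + Re y ≤ r`, and `-Re y ≤ ε + (4ε)⁻¹ y* y` follows by expanding the
-- square of `y / (2√ε) + √ε`. It replaces a perturbation `y` from an ideal, which need not be
-- positive, by a positive one from the same ideal.
theorem star_mul_self_le_of_norm_add_le (b y : B) {r ε : ℝ} (h : ‖star b * b + y‖ ≤ r)
    (hε : 0 < ε) : star (b : Unitization ℂ B) * b ≤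
      algebraMap ℝ (Unitization ℂ B) (r + ε) + (((4 * ε)⁻¹ • (star y * y) : B) :
        Unitization ℂ B) := by
  set Y : Unitization ℂ B := Unitization.inr y with hY
  set X : Unitization ℂ B := star (b : Unitization ℂ B) * b + (1 / 2 : ℝ) • (Y + star Y) with hX
  have hXsa : IsSelfAdjoint X := by
    rw [IsSelfAdjoint, hX]
    simp [add_comm]
  have hXn : ‖X‖ ≤ r := by
    set Z : Unitization ℂ B := star (b : Unitization ℂ B) * b + Y with hZ
    have e : X = (1 / 2 : ℝ) • (Z + star Z) := by
      rw [hX, hZ]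
      simp only [star_add, star_mul, star_star]
      module
    have hZn : ‖Z‖ ≤ r := by
      have : Z = ((star b * b + y : B) : Unitization ℂ B) := by
        simp [hZ, hY, inr_add, inr_mul, inr_star]
      rw [this, norm_inr]; exact h
    rw [e, norm_smul]
    have := norm_add_le Z (star Z)
    rw [norm_star] at this
    norm_num
    linarith
  have h1 : X ≤ algebraMap ℝ (Unitization ℂ B) r :=
    hXsa.le_algebraMap_norm_self.trans (by gcongr)
  set V : Unitization ℂ B := (2 * √ε)⁻¹ • Y + algebraMap ℝ (Unitization ℂ B) (√ε) with hV
  have h2 : 0 ≤ star V * V := star_mul_self_nonneg V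
  have h3 : star V * V = (4 * ε)⁻¹ • (star Y * Y) + (1 / 2 : ℝ) • (Y + star Y) +
      algebraMap ℝ (Unitization ℂ B) ε := by
    have hs : √ε ≠ 0 := (Real.sqrt_pos.2 hε).ne'
    have e1 : (2 * √ε)⁻¹ * (2 * √ε)⁻¹ = (4 * ε)⁻¹ := by
      rw [← mul_inv]; congr 1
      have := Real.mul_self_sqrt hε.le
      linear_combination 4 * this
    have e2 : (2 * √ε)⁻¹ * √ε = 1 / 2 := by field_simp
    have e3 : √ε * √ε = ε := Real.mul_self_sqrt hε.le
    rw [hV]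
    simp only [Algebra.algebraMap_eq_smul_one, star_add, star_smul, star_one, add_mul, mul_add,
      smul_mul_smul_comm, mul_one, one_mul, e1, e2, e3, star_trivial]
    rw [mul_comm (√ε), e2]
    module
  have h4 : (((4 * ε)⁻¹ • (star y * y) : B) : Unitization ℂ B) = (4 * ε)⁻¹ • (star Y * Y) := by
    simp [hY, inr_mul, inr_star]
  rw [h4, map_add]
  have h5 : algebraMap ℝ (Unitization ℂ B) r + algebraMap ℝ (Unitization ℂ B) ε +
      (4 * ε)⁻¹ • (star Y * Y) - star (b : Unitization ℂ B) * b =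
      (algebraMap ℝ (Unitization ℂ B) r - X) + star V * V := by
    rw [h3, hX]; abel
  rw [← sub_nonneg, h5]
  exact add_nonneg (sub_nonneg.2 h1) h2

/-- The quotient norm of a closed two-sided ideal satisfies `‖b‖² ≤ ‖b* b‖`. -/
theorem quotient_norm_sq_le (I : Submodule ℂ B)
    (hI : ∀ b : B, ∀ x ∈ I, b * x ∈ I ∧ x * b ∈ I) (b : B) :
    ‖I.mkQ b‖ ^ 2 ≤ ‖I.mkQ (star b * b)‖ := by
  refine le_of_forall_pos_le_add fun δ hδ => ?_
  -- A nearly optimal representative of the class of `b* b`; it differs from `b* b` by some `y ∈ I`.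
  -- The tolerance `δ` is spent in three equal parts: here, on the comparison with a positive `w ∈
  -- I`, and on the cut-off by `1 - u`.
  obtain ⟨z, hz, hzn⟩ := Submodule.Quotient.norm_mk_lt (I.mkQ (star b * b))
    (show 0 < δ / 3 by positivity)
  have hy : z - star b * b ∈ I := by
    rwa [Submodule.mkQ_apply, Submodule.Quotient.eq] at hz
  set y := z - star b * b with hyd
  have h1 := star_mul_self_le_of_norm_add_le b y (r := ‖I.mkQ (star b * b)‖ + δ / 3)
    (ε := δ / 3) (by rw [hyd, add_sub_cancel]; exact hzn.le) (by positivity)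
  set w := ((4 * (δ / 3))⁻¹ • (star y * y)) with hw
  have hwI : w ∈ I := by
    have : w = (((4 * (δ / 3))⁻¹ : ℝ) : ℂ) • (star y * y) := by rw [hw, Complex.coe_smul]
    rw [this]
    exact I.smul_mem _ (hI _ _ hy).1
  have hwpos : IsPos w := by
    refine ⟨(((√(4 * (δ / 3)))⁻¹ : ℝ) : ℂ) • y, ?_⟩
    rw [star_smul, smul_mul_smul_comm, hw, ← Complex.coe_smul]
    congr 1
    simp only [RCLike.star_def, Complex.conj_ofReal, ← Complex.ofReal_mul, ← mul_inv]
    rw [Real.mul_self_sqrt (by positivity)]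
  obtain ⟨u, n, hu, hun⟩ := exists_norm_sub_mul_sq_le w hwpos
    (s := ‖I.mkQ (star b * b)‖ + δ / 3 + δ / 3) (by positivity) (show 0 < δ / 3 by positivity)
  have huI : u ∈ I := by
    have : u = (n : ℂ) • w - (n : ℂ) • (w * u) := by simpa only [Complex.coe_smul] using hu
    rw [this]
    exact I.sub_mem (I.smul_mem _ hwI) (I.smul_mem _ (hI _ _ hwI).2)
  -- `u ∈ I`, so `b - b u` represents the class of `b`, and its norm has been bounded above.
  have h2 : I.mkQ b = I.mkQ (b - b * u) := by
    rw [eq_comm, ← sub_eq_zero, ← map_sub, Submodule.mkQ_apply, Submodule.Quotient.mk_eq_zero]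
    have : b - b * u - b = -(b * u) := by abel
    rw [this]
    exact I.neg_mem (hI _ _ huI).1
  have h3 : ‖I.mkQ b‖ ≤ ‖b - b * u‖ := by
    rw [h2]; exact Submodule.Quotient.norm_mk_le I _
  have h4 := hun b h1
  have : ‖I.mkQ b‖ ^ 2 ≤ ‖b - b * u‖ ^ 2 := by gcongr
  linarith

/-- The quotient of a C*-algebra by a closed two-sided ideal. -/
theorem exists_quotient_algebra (I : Submodule ℂ B) (hIc : IsClosed (I : Set B))
    (hI : ∀ b : B, ∀ x ∈ I, b * x ∈ I ∧ x * b ∈ I) :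
    ∃ (C : Type u) (_ : NonUnitalCStarAlgebra C) (q : B →⋆ₙₐ[ℂ] C),
      Function.Surjective q ∧ ∀ x, q x = 0 ↔ x ∈ I := by
  -- Closedness of `I` makes the quotient seminorm a norm, so that it vanishes exactly on `I`.
  have _ := hIc
  let p : Seminorm ℂ B := (normSeminorm ℂ (B ⧸ I)).comp I.mkQ
  have hp : ∀ x, p x = ‖I.mkQ x‖ := fun _ => rfl
  have hpm : ∀ x y, p (x * y) ≤ p x * p y := by
    intro x y
    have key : ∀ ε > 0, p (x * y) ≤ (p x + ε) * (p y + ε) := by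
      intro ε hε
      obtain ⟨x', hx', hxn⟩ := Submodule.Quotient.norm_mk_lt (I.mkQ x) hε
      obtain ⟨y', hy', hyn⟩ := Submodule.Quotient.norm_mk_lt (I.mkQ y) hε
      rw [Submodule.mkQ_apply, Submodule.Quotient.eq] at hx' hy'
      have e : I.mkQ (x * y) = I.mkQ (x' * y') := by
        rw [eq_comm, Submodule.mkQ_apply, Submodule.mkQ_apply, Submodule.Quotient.eq]
        have : x' * y' - x * y = (x' - x) * y' + x * (y' - y) := by
          rw [sub_mul, mul_sub]; abel
        rw [this]
        exact I.add_mem (hI _ _ hx').2 (hI _ _ hy').1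
      rw [hp, e]
      refine (Submodule.Quotient.norm_mk_le I _).trans ((norm_mul_le _ _).trans ?_)
      rw [hp, hp]
      gcongr
    have ht : Filter.Tendsto (fun ε : ℝ => (p x + ε) * (p y + ε)) (nhdsWithin 0 (Set.Ioi 0))
        (nhds ((p x + 0) * (p y + 0))) := by
      refine Filter.Tendsto.mono_left (Continuous.tendsto ?_ 0) nhdsWithin_le_nhds
      fun_prop
    rw [add_zero, add_zero] at ht
    exact ge_of_tendsto ht (Filter.eventually_of_mem self_mem_nhdsWithin key)
  have hsq : ∀ x, p x ^ 2 ≤ p (star x * x) := fun x => quotient_norm_sq_le I hI x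
  have hstar_le : ∀ x, p x ≤ p (star x) := by
    intro x
    have h := (hsq x).trans (hpm (star x) x)
    rcases (apply_nonneg p x).eq_or_lt with h0 | h0
    · rw [← h0]; exact apply_nonneg p _
    · nlinarith
  have hstar : ∀ x, p (star x) = p x := fun x =>
    le_antisymm (by simpa using hstar_le (star x)) (hstar_le x)
  obtain ⟨C, _, j, hjm, hjs, hjd, hjp⟩ := exists_cstar_completion (LinearMap.mul ℂ B)
    (starAddEquiv : B ≃+ B).toAddMonoidHom (fun x y z => mul_assoc x y z)
    (fun z x => star_smul z x) (fun x => star_star x) (fun x y => star_mul x y) p hpm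
    (fun x => le_antisymm ((hpm _ _).trans (by
      change p (star x) * p x ≤ _
      rw [hstar, sq])) (hsq x))
  let q : B →⋆ₙₐ[ℂ] C :=
    { toFun := j, map_smul' := fun z x => j.map_smul z x, map_zero' := j.map_zero
      map_add' := j.map_add, map_mul' := hjm, map_star' := hjs }
  have hker : ∀ x, j x = 0 ↔ x ∈ I := fun x => by
    rw [← norm_eq_zero, hjp, hp, norm_eq_zero, Submodule.mkQ_apply,
      Submodule.Quotient.mk_eq_zero]
  refine ⟨C, inferInstance, q, ?_, hker⟩
  -- `B ⧸ I` is complete already and embeds isometrically, so the dense image of `B` in the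
  -- completion is closed.
  let f : (B ⧸ I) →ₗ[ℂ] C := I.liftQ j fun x hx => (hker x).2 hx
  have hf : Isometry f := by
    refine AddMonoidHomClass.isometry_of_norm f fun x => ?_
    obtain ⟨x, rfl⟩ := I.mkQ_surjective x
    exact hjp x
  have hr : Set.range f = Set.range j := by
    ext c
    constructor
    · rintro ⟨x, rfl⟩
      obtain ⟨x, rfl⟩ := I.mkQ_surjective x
      exact ⟨x, rfl⟩
    · rintro ⟨x, rfl⟩
      exact ⟨I.mkQ x, rfl⟩
  have hcl : IsClosed (Set.range j) := by
    rw [← hr]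
    exact hf.isClosedEmbedding.isClosed_range
  have : Set.range j = Set.univ := by rw [← hcl.closure_eq, hjd.closure_range]
  exact Set.range_eq_univ.1 this

end Quotient

end

section

/-! ## Hilbert modules -/

section Form

variable {D : Type u} [NonUnitalCStarAlgebra D] {V : Type*} [AddCommGroup V] [Module ℂ V]

/-- The Cauchy–Schwarz inequality for positive semidefinite `D`-valued forms. -/
theorem norm_form_sq_le (f : V →ₗ⋆[ℂ] V →ₗ[ℂ] D) (hstar : ∀ x y, star (f x y) = f y x)
    (hpos : ∀ x, IsPos (f x x)) (act : V → D → V) (hact : ∀ x y d, f x (act y d) = f x y * d)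
    (x y : V) : ‖f x y‖ ^ 2 ≤ ‖f x x‖ * ‖f y y‖ := by
  let _ := CStarAlgebra.spectralOrder D
  have _ := CStarAlgebra.spectralOrderedRing D
  have hact' : ∀ x y d, f (act x d) y = star d * f x y := fun x y d => by
    rw [← hstar, hact, star_mul, hstar]
  set a := f x y with ha
  set N := ‖f x x‖ with hN
  -- Expand the positive element `⟨x a - t y, x a - t y⟩` with `t = N + ε`, and use `a* ⟨x, x⟩ a ≤ N
  -- a* a`. The `ε` allows division by `t` when `N = 0`.
  have key : ∀ ε > 0, ‖a‖ ^ 2 ≤ (N + ε) * ‖f y y‖ := by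
    intro ε hε
    set t : ℝ := N + ε with ht
    have ht0 : 0 < t := by positivity
    have h0 : 0 ≤ f (act x a - (t : ℂ) • y) (act x a - (t : ℂ) • y) :=
      isPos_iff_nonneg.1 (hpos _)
    have e : f (act x a - (t : ℂ) • y) (act x a - (t : ℂ) • y) =
        star a * f x x * a - t • (star a * a) - t • (star a * a) + (t * t) • f y y := by
      simp only [map_sub, LinearMap.sub_apply, map_smulₛₗ, LinearMap.smul_apply, hact', hact,
        RingHom.id_apply, Complex.conj_ofReal]
      rw [← hstar x y, ← ha, smul_sub, smul_smul, mul_assoc, ← Complex.ofReal_mul]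
      simp only [Complex.coe_smul]
      abel
    have h1 : star a * f x x * a ≤ t • (star a * a) := by
      refine (CStarAlgebra.star_left_conjugate_le_norm_smul (hpos x).isSelfAdjoint).trans ?_
      rw [← hN]
      exact smul_le_smul_of_nonneg_right (by linarith) (star_mul_self_nonneg a)
    have h2 : t • (star a * a) ≤ (t * t) • f y y := by
      rw [e] at h0
      have h3 : t • (star a * a) ≤ (star a * f x x * a - t • (star a * a) - t • (star a * a) +
          (t * t) • f y y) + t • (star a * a) := le_add_of_nonneg_left h0
      refine h3.trans ?_
      have : (star a * f x x * a - t • (star a * a) - t • (star a * a) +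
          (t * t) • f y y) + t • (star a * a) =
          (star a * f x x * a - t • (star a * a)) + (t * t) • f y y := by abel
      rw [this]
      exact add_le_of_nonpos_left (sub_nonpos.2 h1)
    have h3 : ‖t • (star a * a)‖ ≤ ‖(t * t) • f y y‖ :=
      CStarAlgebra.norm_le_norm_of_nonneg_of_le
        (smul_nonneg ht0.le (star_mul_self_nonneg a)) h2
    rw [norm_smul, norm_smul, CStarRing.norm_star_mul_self, Real.norm_of_nonneg ht0.le,
      Real.norm_of_nonneg (by positivity), mul_assoc] at h3
    rw [sq]
    exact le_of_mul_le_mul_left h3 ht0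
  have ht : Filter.Tendsto (fun ε : ℝ => (N + ε) * ‖f y y‖) (nhdsWithin 0 (Set.Ioi 0))
      (nhds ((N + 0) * ‖f y y‖)) := by
    refine Filter.Tendsto.mono_left (Continuous.tendsto ?_ 0) nhdsWithin_le_nhds
    fun_prop
  rw [add_zero] at ht
  exact ge_of_tendsto ht (Filter.eventually_of_mem self_mem_nhdsWithin key)

/-- *-representations of C*-algebras by linear maps that are adjointable for a positive
semidefinite form are contractive. -/
theorem norm_form_rep_le {B : Type u} [NonUnitalCStarAlgebra B] (f : V →ₗ⋆[ℂ] V →ₗ[ℂ] D)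
    (hpos : ∀ x, IsPos (f x x)) (L : B → V →ₗ[ℂ] V)
    (hadd : ∀ b c x, L (b + c) x = L b x + L c x) (hsmul : ∀ (z : ℂ) b x, L (z • b) x = z • L b x)
    (hmul : ∀ b c x, L (b * c) x = L b (L c x))
    (hadj : ∀ b x y, f (L b x) y = f x (L (star b) y)) (b : B) (x : V) :
    ‖f (L b x) (L b x)‖ ≤ ‖b‖ ^ 2 * ‖f x x‖ := by
  have key : ∀ b : B, ‖b‖ ≤ 1 → ‖f (L b x) (L b x)‖ ≤ ‖f x x‖ := by
    intro b hb
    obtain ⟨d, hd, hdb⟩ := exists_two_smul_sub_sq b hb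
    refine (hpos _).norm_le_norm ?_
    have hneg : L (-(d * d)) x = - L d (L d x) := by
      have := hsmul (-1) (d * d) x
      rw [neg_one_smul, neg_one_smul] at this
      rw [this, hmul]
    -- This is `1 - b* b = (1 - d)²` for self-adjoint `d`, evaluated in the form.
    have e : f x x - f (L b x) (L b x) = f (x - L d x) (x - L d x) := by
      rw [hadj, ← hmul, ← hdb, sub_eq_add_neg (d + d), hadd, hadd, hneg]
      simp only [map_sub, map_add, map_neg, LinearMap.sub_apply, hadj, hd]
      abel
    rw [e]
    exact hpos _
  rcases eq_or_ne b 0 with rfl | hb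
  · have : L 0 x = 0 := by simpa using hsmul 0 0 x
    simp [this]
  have hn : 0 < ‖b‖ := norm_pos_iff.2 hb
  have h1 := key (((‖b‖⁻¹ : ℝ) : ℂ) • b) (by rw [norm_smul]; simp [hn.ne'])
  rw [hsmul] at h1
  simp only [map_smulₛₗ, LinearMap.smul_apply, norm_smul, RingHom.id_apply, Complex.conj_ofReal,
    Complex.norm_real, norm_inv, norm_norm] at h1
  rw [← mul_assoc, ← mul_inv, inv_mul_le_iff₀ (by positivity)] at h1
  rwa [sq]

end Form

namespace HilbertModule

variable {D : Type u} [NonUnitalCStarAlgebra D] (E : HilbertModule D)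

theorem inner_add_left (x y z : E) : E.inner (x + y) z = E.inner x z + E.inner y z := by
  rw [← E.star_inner, E.inner_add_right, star_add, E.star_inner, E.star_inner]

theorem inner_smul_left (c : ℂ) (x y : E) : E.inner (c • x) y = star c • E.inner x y := by
  rw [← E.star_inner, E.inner_smul_right, star_smul, E.star_inner]

theorem inner_act_left (x y : E) (d : D) : E.inner (E.act x d) y = star d * E.inner x y := by
  rw [← E.star_inner, E.inner_act_right, star_mul, E.star_inner]

/-- The inner product as a sesquilinear map. -/
def innerₛₗ : E →ₗ⋆[ℂ] E →ₗ[ℂ] D :=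
  LinearMap.mk₂'ₛₗ (starRingEnd ℂ) (RingHom.id ℂ) E.inner E.inner_add_left
    (fun c x y => E.inner_smul_left c x y) E.inner_add_right (fun c x y => E.inner_smul_right c x y)

theorem innerₛₗ_apply (x y : E) : E.innerₛₗ x y = E.inner x y := rfl

theorem norm_inner_le (x y : E) : ‖E.inner x y‖ ≤ ‖x‖ * ‖y‖ := by
  have h := norm_form_sq_le E.innerₛₗ E.star_inner E.inner_self_pos E.act E.inner_act_right x y
  simp only [innerₛₗ_apply] at h
  rw [← E.norm_sq_eq, ← E.norm_sq_eq, ← mul_pow] at h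
  exact (pow_le_pow_iff_left₀ (norm_nonneg _) (by positivity) two_ne_zero).1 h

/-- The inner product as a continuous sesquilinear map. -/
def innerSL : E →L⋆[ℂ] E →L[ℂ] D :=
  LinearMap.mkContinuous₂ E.innerₛₗ 1 fun x y => by
    rw [one_mul]; exact E.norm_inner_le x y

theorem innerSL_apply (x y : E) : E.innerSL x y = E.inner x y := rfl

theorem continuous_inner {X : Type*} [TopologicalSpace X] {f g : X → E} (hf : Continuous f)
    (hg : Continuous g) : Continuous fun x => E.inner (f x) (g x) := by
  simp only [← innerSL_apply]
  fun_prop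

theorem tendsto_inner {X : Type*} {l : Filter X} {f g : X → E} {x y : E}
    (hf : Filter.Tendsto f l (nhds x)) (hg : Filter.Tendsto g l (nhds y)) :
    Filter.Tendsto (fun i => E.inner (f i) (g i)) l (nhds (E.inner x y)) := by
  have : Continuous fun p : E × E => E.inner p.1 p.2 :=
    E.continuous_inner continuous_fst continuous_snd
  exact (this.tendsto (x, y)).comp (hf.prodMk_nhds hg)

@[simp] theorem inner_zero_right (x : E) : E.inner x 0 = 0 := (E.innerₛₗ x).map_zero
@[simp] theorem inner_zero_left (x : E) : E.inner 0 x = 0 := by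
  rw [← E.star_inner, inner_zero_right, star_zero]
theorem inner_sub_right (x y z : E) : E.inner x (y - z) = E.inner x y - E.inner x z :=
  (E.innerₛₗ x).map_sub y z
theorem inner_sub_left (x y z : E) : E.inner (x - y) z = E.inner x z - E.inner y z := by
  rw [← E.star_inner, inner_sub_right, star_sub, E.star_inner, E.star_inner]
theorem inner_neg_right (x y : E) : E.inner x (-y) = -E.inner x y :=
  (E.innerₛₗ x).map_neg y

theorem inner_sum_right {ι : Type*} (s : Finset ι) (x : E) (f : ι → E) :
    E.inner x (∑ i ∈ s, f i) = ∑ i ∈ s, E.inner x (f i) :=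
  map_sum (E.innerₛₗ x) f s

theorem inner_sum_left {ι : Type*} (s : Finset ι) (x : E) (f : ι → E) :
    E.inner (∑ i ∈ s, f i) x = ∑ i ∈ s, E.inner (f i) x := by
  rw [← E.star_inner, inner_sum_right, star_sum]
  simp only [E.star_inner]

variable {E} in
/-- Vectors are equal if their inner products with a set that spans a dense subspace agree. -/
theorem ext_of_dense {S : Set E} (hS : Dense (Submodule.span ℂ S : Set E)) {x y : E}
    (h : ∀ z ∈ S, E.inner z x = E.inner z y) : x = y := by
  have h1 : ∀ z ∈ Submodule.span ℂ S, E.inner z x = E.inner z y := fun z hz => by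
    induction hz using Submodule.span_induction with
    | mem z hz => exact h z hz
    | zero => simp
    | add z w _ _ hz hw => rw [inner_add_left, inner_add_left, hz, hw]
    | smul c z _ hz => rw [inner_smul_left, inner_smul_left, hz]
  have h2 : ∀ z, E.inner z x = E.inner z y := fun z => by
    refine hS.induction (P := fun z => E.inner z x = E.inner z y) h1 ?_ z
    exact isClosed_eq (E.continuous_inner continuous_id continuous_const)
      (E.continuous_inner continuous_id continuous_const)
  rw [← sub_eq_zero]
  apply E.inner_self_eq_zero
  rw [inner_sub_right, h2, sub_self]

variable {E} in
theorem ext_inner {x y : E} (h : ∀ z, E.inner z x = E.inner z y) : x = y :=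
  ext_of_dense (S := Set.univ) (by simp) fun z _ => h z

variable {E} in
theorem ext_inner_left {x y : E} (h : ∀ z, E.inner x z = E.inner y z) : x = y :=
  ext_inner fun z => by rw [← E.star_inner, h, E.star_inner]

theorem norm_act_le (x : E) (d : D) : ‖E.act x d‖ ≤ ‖x‖ * ‖d‖ := by
  have h : ‖E.act x d‖ ^ 2 ≤ (‖x‖ * ‖d‖) ^ 2 := by
    rw [E.norm_sq_eq, E.inner_act_left, E.inner_act_right]
    calc _ ≤ ‖star d‖ * (‖E.inner x x‖ * ‖d‖) :=
          (norm_mul_le _ _).trans (by gcongr; exact norm_mul_le _ _)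
      _ = _ := by rw [norm_star, ← E.norm_sq_eq]; ring
  exact (pow_le_pow_iff_left₀ (norm_nonneg _) (by positivity) two_ne_zero).1 h

/-- The right action as a continuous bilinear map. -/
def actL : E →L[ℂ] D →L[ℂ] E :=
  LinearMap.mkContinuous₂ (LinearMap.mk₂ ℂ E.act E.add_act E.smul_act E.act_add E.act_smul) 1
    fun x d => by simpa using E.norm_act_le x d

theorem actL_apply (x : E) (d : D) : E.actL x d = E.act x d := rfl

@[simp] theorem zero_act (d : D) : E.act 0 d = 0 := by simp [← actL_apply]

/-- The norm of an adjointable operator. -/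
theorem norm_apply_sq_le_of_adjoint {S T : E →L[ℂ] E} (h : ∀ x y, E.inner (T x) y = E.inner x (S y))
    (x : E) : ‖T x‖ ^ 2 ≤ ‖S.comp T‖ * ‖x‖ ^ 2 := by
  rw [E.norm_sq_eq, h]
  refine (E.norm_inner_le _ _).trans ?_
  have := (S.comp T).le_opNorm x
  rw [ContinuousLinearMap.comp_apply] at this
  nlinarith [norm_nonneg x]

/-- The Cauchy–Schwarz inequality gives `‖T‖² ≤ ‖S T‖`, hence `‖T‖ ≤ ‖S‖`, and the roles of `S` and
`T` may be exchanged. This C*-identity turns a representation of the Fell bundle into a C*-seminorm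
on its sections. -/
theorem opNorm_sq_of_adjoint {S T : E →L[ℂ] E} (h : ∀ x y, E.inner (T x) y = E.inner x (S y)) :
    ‖S.comp T‖ = ‖T‖ ^ 2 := by
  have h1 : ∀ {S T : E →L[ℂ] E}, (∀ x y, E.inner (T x) y = E.inner x (S y)) →
      ‖T‖ ^ 2 ≤ ‖S.comp T‖ := by
    intro S T h
    have : ‖T‖ ≤ √‖S.comp T‖ := by
      refine T.opNorm_le_bound (by positivity) fun x => ?_
      have := E.norm_apply_sq_le_of_adjoint h x
      rw [← Real.sqrt_sq (norm_nonneg (T x)), ← Real.sqrt_sq (norm_nonneg x),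
        ← Real.sqrt_mul (norm_nonneg _)]
      exact Real.sqrt_le_sqrt this
    rwa [Real.le_sqrt (norm_nonneg _) (norm_nonneg _)] at this
  have h2 : ∀ {S T : E →L[ℂ] E}, (∀ x y, E.inner (T x) y = E.inner x (S y)) → ‖T‖ ≤ ‖S‖ := by
    intro S T h
    have h3 := (h1 h).trans (ContinuousLinearMap.opNorm_comp_le S T)
    rcases (norm_nonneg T).eq_or_lt with h0 | h0
    · rw [← h0]; exact norm_nonneg _
    · nlinarith
  have h4 : ‖S‖ ≤ ‖T‖ := h2 fun x y => by rw [← E.star_inner, ← h, E.star_inner]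
  refine le_antisymm ?_ (h1 h)
  refine (ContinuousLinearMap.opNorm_comp_le S T).trans ?_
  nlinarith [norm_nonneg T]

/-- A closed submodule of a Hilbert module. -/
@[reducible] def sub (S : Submodule ℂ E) (hS : IsClosed (S : Set E))
    (hact : ∀ x ∈ S, ∀ d, E.act x d ∈ S) : HilbertModule D where
  carrier := S
  complete := hS.completeSpace_coe
  act x d := ⟨E.act x d, hact x x.2 d⟩
  inner x y := E.inner x y
  add_act x y d := Subtype.ext (E.add_act x y d)
  act_add x d e := Subtype.ext (E.act_add x d e)
  act_mul x d e := Subtype.ext (E.act_mul x d e)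
  smul_act z x d := Subtype.ext (E.smul_act z x d)
  act_smul z x d := Subtype.ext (E.act_smul z x d)
  inner_add_right x y z := E.inner_add_right x y z
  inner_smul_right z x y := E.inner_smul_right z x y
  inner_act_right x y d := E.inner_act_right x y d
  star_inner x y := E.star_inner x y
  inner_self_pos x := E.inner_self_pos x
  inner_self_eq_zero x h := Subtype.ext (E.inner_self_eq_zero x h)
  norm_sq_eq x := E.norm_sq_eq x

end HilbertModule

namespace ModuleIsometry

variable {D : Type u} [NonUnitalCStarAlgebra D] {E₁ E₂ : HilbertModule D}

theorem norm_map (I : ModuleIsometry E₁ E₂) (x : E₁) : ‖I.toLin x‖ = ‖x‖ := by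
  have h : ‖I.toLin x‖ ^ 2 = ‖x‖ ^ 2 := by rw [E₂.norm_sq_eq, E₁.norm_sq_eq, I.map_inner]
  exact (pow_left_inj₀ (norm_nonneg _) (norm_nonneg _) two_ne_zero).1 h

/-- A module isometry as a linear isometry. -/
def toLinearIsometry (I : ModuleIsometry E₁ E₂) : E₁ →ₗᵢ[ℂ] E₂ := ⟨I.toLin, I.norm_map⟩

theorem continuous (I : ModuleIsometry E₁ E₂) : Continuous I.toLin := I.toLinearIsometry.continuous

theorem injective (I : ModuleIsometry E₁ E₂) : Function.Injective I.toLin :=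
  I.toLinearIsometry.injective

end ModuleIsometry

end

section

/-! ## Hilbert modules from positive definite kernels -/

section Kernel

variable {D : Type u} [NonUnitalCStarAlgebra D]

/-- The completion of a vector space with a positive semidefinite form. -/
theorem exists_hilbertModule_of_form {V : Type u} [AddCommGroup V] [Module ℂ V]
    (f : V →ₗ⋆[ℂ] V →ₗ[ℂ] D) (hstar : ∀ x y, star (f x y) = f y x)
    (hpos : ∀ x, IsPos (f x x)) (act : D → V →ₗ[ℂ] V)
    (hact : ∀ x y d, f x (act d y) = f x y * d) :
    ∃ (T : HilbertModule D) (j : V →ₗ[ℂ] T), DenseRange j ∧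
      (∀ x y, T.inner (j x) (j y) = f x y) ∧ ∀ x d, j (act d x) = T.act (j x) d := by
  have hcs := norm_form_sq_le f hstar hpos (fun x d => act d x) hact
  let p : Seminorm ℂ V := Seminorm.of (fun x => √‖f x x‖) (fun x y => by
    have h : ‖f (x + y) (x + y)‖ ≤ (√‖f x x‖ + √‖f y y‖) ^ 2 := by
      have hxy : ‖f x y‖ ≤ √‖f x x‖ * √‖f y y‖ := by
        rw [← Real.sqrt_mul (norm_nonneg _)]
        exact Real.le_sqrt_of_sq_le (hcs x y)
      have hyx : ‖f y x‖ ≤ √‖f x x‖ * √‖f y y‖ := by rw [← hstar, norm_star]; exact hxy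
      have e : f (x + y) (x + y) = f x x + f y x + f x y + f y y := by
        simp only [map_add, LinearMap.add_apply]; abel
      rw [e, add_sq, Real.sq_sqrt (norm_nonneg _), Real.sq_sqrt (norm_nonneg _)]
      have h1 := norm_add_le (f x x + f y x + f x y) (f y y)
      have h2 := norm_add₃_le (a := f x x) (b := f y x) (c := f x y)
      linarith
    exact (Real.sqrt_le_sqrt h).trans (Real.sqrt_sq (by positivity)).le) (fun z x => by
      simp only [map_smulₛₗ, LinearMap.smul_apply, norm_smul, RingHom.id_apply, RCLike.norm_conj]
      rw [← mul_assoc, Real.sqrt_mul (by positivity), Real.sqrt_mul_self (norm_nonneg _)])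
  have hp : ∀ x, p x = √‖f x x‖ := fun x => rfl
  obtain ⟨T, _, _, _, j, hj, hjp⟩ := exists_banach_completion p
  obtain ⟨F, hF, hFn⟩ := exists_extension₂ j hj f (fun x y => by
    rw [hjp, hjp, hp, hp, ← Real.sqrt_mul (norm_nonneg _)]
    exact Real.le_sqrt_of_sq_le (hcs x y))
  have hFnorm : ∀ t, ‖t‖ ^ 2 = ‖F t t‖ := fun t => by
    refine hj.induction_on t (isClosed_eq (by fun_prop) (by fun_prop)) fun x => ?_
    rw [hF, hjp, hp, Real.sq_sqrt (norm_nonneg _)]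
  have hFstar : ∀ s t, star (F s t) = F t s := fun s t => by
    refine hj.induction_on₂ (isClosed_eq (by fun_prop) (by fun_prop)) (fun x y => ?_) s t
    rw [hF, hF, hstar]
  have hFpos : ∀ t, IsPos (F t t) := fun t => by
    refine hj.induction_on t (isClosed_isPos.preimage (f := fun t => F t t) (by fun_prop))
      fun x => ?_
    rw [hF]; exact hpos x
  have hF0 : ∀ t, F t t = 0 → t = 0 := fun t h => by
    rw [← norm_eq_zero, ← sq_eq_zero_iff, hFnorm, h, norm_zero]
  -- The form separates points of the completion. So the axioms of a right module, which were not
  -- assumed for `act`, follow from the compatibility of `act` with the form.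
  have hFext : ∀ s t, (∀ r, F r s = F r t) → s = t := fun s t h => by
    rw [← sub_eq_zero]
    apply hF0
    rw [map_sub, h, sub_self]
  have hactn : ∀ d x, ‖(j ∘ₗ act d) x‖ ≤ ‖d‖ * ‖j x‖ := fun d x => by
    have hl : f (act d x) (act d x) = star d * (f x x * d) := by
      rw [hact, ← hstar, hact, star_mul, hstar, mul_assoc]
    have h : ‖j (act d x)‖ ^ 2 ≤ (‖d‖ * ‖j x‖) ^ 2 := by
      rw [hFnorm, hF, hl, mul_pow, hFnorm, hF]
      calc _ ≤ ‖star d‖ * (‖f x x‖ * ‖d‖) :=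
            (norm_mul_le _ _).trans (by gcongr; exact norm_mul_le _ _)
        _ = _ := by rw [norm_star]; ring
    exact (pow_le_pow_iff_left₀ (norm_nonneg _) (by positivity) two_ne_zero).1 h
  let R : D → T →L[ℂ] T := fun d => (j ∘ₗ act d).extendOfNorm j
  have hR : ∀ d x, R d (j x) = j (act d x) := fun d x =>
    LinearMap.extendOfNorm_eq hj ⟨_, hactn d⟩ x
  have hFR : ∀ s t d, F s (R d t) = F s t * d := fun s t d => by
    refine hj.induction_on₂ (isClosed_eq (by fun_prop) (by fun_prop)) (fun x y => ?_) s t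
    rw [hR, hF, hF, hact]
  refine ⟨{ carrier := T, act := fun t d => R d t, inner := fun s t => F s t
            add_act := fun x y d => (R d).map_add x y
            act_add := fun x d e => hFext _ _ fun r => by simp only [hFR, map_add, mul_add]
            act_mul := fun x d e => hFext _ _ fun r => by simp only [hFR, mul_assoc]
            smul_act := fun z x d => (R d).map_smul z x
            act_smul := fun z x d => hFext _ _ fun r => by
              simp only [hFR, map_smul, mul_smul_comm]
            inner_add_right := fun x y z => (F x).map_add y z
            inner_smul_right := fun z x y => (F x).map_smul z y
            inner_act_right := fun x y d => hFR x y d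
            star_inner := hFstar
            inner_self_pos := hFpos
            inner_self_eq_zero := hF0
            norm_sq_eq := hFnorm }, j, hj, hF, fun x d => (hR d x).symm⟩

/-- The Hilbert module of a positive definite kernel on a set. -/
theorem exists_hilbertModule_of_kernel {X : Type u} (k : X → X → D)
    (hstar : ∀ x y, star (k x y) = k y x)
    (hsmul : ∀ (z : ℂ) y, ∃ y', ∀ x, k x y' = z • k x y)
    (hpos : ∀ (n : ℕ) (x : Fin n → X), IsPos (∑ i, ∑ j, k (x i) (x j)))
    (act : X → D → X) (hact : ∀ x y d, k x (act y d) = k x y * d) :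
    ∃ (T : HilbertModule D) (i : X → T), (∀ x y, T.inner (i x) (i y) = k x y) ∧
      (∀ x d, i (act x d) = T.act (i x) d) ∧
      Dense (Submodule.span ℂ (Set.range i) : Set T) := by
  let g : X → (X →₀ ℂ) →ₗ[ℂ] D := fun x => Finsupp.linearCombination ℂ (k x)
  let f : (X →₀ ℂ) →ₗ⋆[ℂ] (X →₀ ℂ) →ₗ[ℂ] D :=
    { toFun := fun u => u.sum fun x c => star c • g x
      map_add' := fun u v => Finsupp.sum_add_index' (by simp) (by simp [add_smul])
      map_smul' := fun c u => by
        rw [Finsupp.sum_smul_index' (by simp), Finsupp.smul_sum]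
        simp [mul_smul] }
  have hfs : ∀ x y a b, f (Finsupp.single x a) (Finsupp.single y b) = (star a * b) • k x y := by
    intro x y a b
    change (Finsupp.sum (Finsupp.single x a) fun x c => star c • g x) (Finsupp.single y b) = _
    rw [Finsupp.sum_single_index (by simp)]
    simp [g, mul_smul]
  have hsymm : ∀ u v, star (f u v) = f v u := by
    intro u v
    induction u using Finsupp.induction_linear with
    | zero => simp
    | add u u' hu hu' => simp only [map_add, LinearMap.add_apply, star_add, hu, hu']
    | single x a =>
      induction v using Finsupp.induction_linear with
      | zero => simp
      | add v v' hv hv' => simp only [map_add, LinearMap.add_apply, star_add, hv, hv']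
      | single y b => rw [hfs, hfs, star_smul, hstar, star_mul, star_star]
  have hsum : ∀ u : X →₀ ℂ, f u u = ∑ x ∈ u.support, ∑ y ∈ u.support,
      (star (u x) * u y) • k x y := by
    intro u
    have e : u = ∑ x ∈ u.support, Finsupp.single x (u x) := u.sum_single.symm
    conv_lhs => rw [e]
    simp only [map_sum, LinearMap.sum_apply, hfs]
    rw [Finset.sum_comm]
  have hfpos : ∀ u, IsPos (f u u) := by
    intro u
    -- Coefficients of a linear combination are absorbed into the points, so positivity for plain
    -- sums of points suffices.
    choose sm hsm using hsmul
    have hsm' : ∀ z y x, k (sm z y) x = star z • k y x := fun z y x => by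
      rw [← hstar, hsm, star_smul, hstar]
    rw [hsum]
    let e := u.support.equivFin
    have h := hpos u.support.card fun i => sm (u (e.symm i)) (e.symm i)
    simp only [hsm, hsm', smul_smul] at h
    convert h using 1
    rw [← Finset.sum_coe_sort u.support, ← e.symm.sum_comp]
    refine Finset.sum_congr rfl fun i _ => ?_
    rw [← Finset.sum_coe_sort u.support, ← e.symm.sum_comp]
    refine Finset.sum_congr rfl fun i _ => ?_
    rw [mul_comm]
  obtain ⟨T, j, hj, hji, hja⟩ := exists_hilbertModule_of_form f hsymm hfpos
    (fun d => Finsupp.lmapDomain ℂ ℂ fun x => act x d) (fun u v d => by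
      induction u using Finsupp.induction_linear with
      | zero => simp
      | add u u' hu hu' => simp only [map_add, LinearMap.add_apply, hu, hu', add_mul]
      | single x a =>
        induction v using Finsupp.induction_linear with
        | zero => simp
        | add v v' hv hv' => simp only [map_add, hv, hv', add_mul]
        | single y b =>
          rw [Finsupp.lmapDomain_apply, Finsupp.mapDomain_single, hfs, hfs, hact, smul_mul_assoc])
  refine ⟨T, fun x => j (Finsupp.single x 1), fun x y => ?_, fun x d => ?_, ?_⟩
  · rw [hji, hfs]; simp
  · rw [← hja]; simp
  · refine hj.mono ?_
    rintro _ ⟨u, rfl⟩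
    induction u using Finsupp.induction_linear with
    | zero => simp
    | add u v hu hv => rw [map_add]; exact Submodule.add_mem _ hu hv
    | single x a =>
      have : Finsupp.single x a = a • Finsupp.single x (1 : ℂ) := by simp
      rw [this, map_smul]
      exact Submodule.smul_mem _ _ (Submodule.subset_span ⟨x, rfl⟩)

end Kernel

/-! ## Representations of C*-algebras -/

namespace CStarRep

variable {B : Type u} [NonUnitalCStarAlgebra B] {D : Type u} [NonUnitalCStarAlgebra D]
  {E : HilbertModule D}

theorem norm_apply_le (ρ : CStarRep B E) (b : B) (x : E) : ‖ρ.toFun b x‖ ≤ ‖b‖ * ‖x‖ := by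
  have h := norm_form_rep_le E.innerₛₗ E.inner_self_pos (fun b => (ρ.toFun b).toLinearMap)
    (by simp) (by simp) ρ.map_mul ρ.adjoint b x
  have h1 : ‖ρ.toFun b x‖ ^ 2 ≤ (‖b‖ * ‖x‖) ^ 2 := by
    rw [E.norm_sq_eq, mul_pow, E.norm_sq_eq]
    exact h
  exact (pow_le_pow_iff_left₀ (norm_nonneg _) (by positivity) two_ne_zero).1 h1

/-- A representation of a C*-algebra as a continuous linear map. -/
def toCLM (ρ : CStarRep B E) : B →L[ℂ] E →L[ℂ] E :=
  LinearMap.mkContinuous ρ.toFun 1 fun b => by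
    rw [one_mul]
    exact ContinuousLinearMap.opNorm_le_bound _ (norm_nonneg _) (ρ.norm_apply_le b)

theorem toCLM_apply (ρ : CStarRep B E) (b : B) : ρ.toCLM b = ρ.toFun b := rfl

theorem map_act (ρ : CStarRep B E) (b : B) (x : E) (d : D) :
    ρ.toFun b (E.act x d) = E.act (ρ.toFun b x) d := by
  refine HilbertModule.ext_inner_left fun z => ?_
  rw [ρ.adjoint, E.inner_act_left, E.inner_act_left, ρ.adjoint]

theorem inner_apply_apply (ρ : CStarRep B E) (b c : B) (x y : E) :
    E.inner (ρ.toFun b x) (ρ.toFun c y) = E.inner x (ρ.toFun (star b * c) y) := by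
  rw [ρ.adjoint, ρ.map_mul]

theorem ext_apply {ρ₁ ρ₂ : CStarRep B E} (h : ∀ b x, ρ₁.toFun b x = ρ₂.toFun b x) : ρ₁ = ρ₂ := by
  ext1
  ext b x
  exact h b x

/-- `ρ(S) E` spans a dense subspace for every dense set `S`. -/
theorem dense_span_of_dense (ρ : CStarRep B E) {S : Set B} (hS : Dense S) :
    Dense (Submodule.span ℂ {y : E | ∃ b ∈ S, ∃ x, y = ρ.toFun b x} : Set E) := by
  have h : ∀ b x, ρ.toFun b x ∈
      closure (Submodule.span ℂ {y : E | ∃ b ∈ S, ∃ x, y = ρ.toFun b x} : Set E) := fun b x => by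
    have hc : Continuous fun b => ρ.toFun b x := by
      simp only [← toCLM_apply]; fun_prop
    refine map_mem_closure (f := fun b => ρ.toFun b x) hc (hS b) fun c hc => Submodule.subset_span ⟨c, hc, x, rfl⟩
  have h1 : (Submodule.span ℂ {y : E | ∃ b x, y = ρ.toFun b x}) ≤
      (Submodule.span ℂ {y : E | ∃ b ∈ S, ∃ x, y = ρ.toFun b x}).topologicalClosure := by
    rw [Submodule.span_le]
    rintro _ ⟨b, x, rfl⟩
    exact h b x
  rw [← dense_closure]
  exact ρ.nondegenerate.mono h1

end CStarRep

/-! ## Interior tensor products -/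

section Tensor

variable {D₁ D₂ : Type u} [NonUnitalCStarAlgebra D₁] [NonUnitalCStarAlgebra D₂]
  {E : HilbertModule D₁} {F : HilbertModule D₂} {φ : CStarRep D₁ F} {T : HilbertModule D₂}
  {τ : E →ₗ[ℂ] F →ₗ[ℂ] T}

theorem IsInteriorTensor.norm_le (h : IsInteriorTensor E F φ T τ) (x : E) (y : F) :
    ‖τ x y‖ ≤ ‖x‖ * ‖y‖ := by
  have h1 : ‖τ x y‖ ^ 2 ≤ (‖x‖ * ‖y‖) ^ 2 := by
    rw [T.norm_sq_eq, h.inner_eq]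
    refine (F.norm_inner_le _ _).trans ?_
    have h2 := φ.norm_apply_le (E.inner x x) y
    rw [← E.norm_sq_eq] at h2
    nlinarith [norm_nonneg y]
  exact (pow_le_pow_iff_left₀ (norm_nonneg _) (by positivity) two_ne_zero).1 h1

theorem IsInteriorTensor.continuous_left (h : IsInteriorTensor E F φ T τ) (y : F) :
    Continuous fun x => τ x y := by
  refine ((τ.flip y).mkContinuous ‖y‖ fun x => ?_).continuous
  rw [mul_comm]
  exact h.norm_le x y

open scoped TensorProduct in
/-- The representation `ρ ⊗ 1` on an interior tensor product exists. -/
theorem IsInteriorTensor.exists_tensorRep (h : IsInteriorTensor E F φ T τ) {B : Type u}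
    [NonUnitalCStarAlgebra B] (ρ : CStarRep B E) : ∃ σ : CStarRep B T, ρ.IsTensor τ σ := by
  let e : E ⊗[ℂ] F →ₗ[ℂ] T := TensorProduct.lift τ
  have he : DenseRange e := by
    refine h.dense.mono ?_
    rw [← LinearMap.coe_range, SetLike.coe_subset_coe, Submodule.span_le]
    rintro _ ⟨x, y, rfl⟩
    exact ⟨x ⊗ₜ y, by simp [e]⟩
  let L : B → E ⊗[ℂ] F →ₗ[ℂ] E ⊗[ℂ] F := fun b => (ρ.toFun b).toLinearMap.rTensor F
  have hL : ∀ b x y, L b (x ⊗ₜ y) = ρ.toFun b x ⊗ₜ y := fun b x y => rfl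
  have hadj : ∀ b s t, T.inner (e (L b s)) (e t) = T.inner (e s) (e (L (star b) t)) := by
    intro b s t
    induction s with
    | zero => simp
    | add s s' hs hs' => simp only [map_add, T.inner_add_left, hs, hs']
    | tmul x y =>
      induction t with
      | zero => simp
      | add t t' ht ht' => simp only [map_add, T.inner_add_right, ht, ht']
      | tmul x' y' => simp only [hL, e, TensorProduct.lift.tmul, h.inner_eq, ρ.adjoint]
  have hmul : ∀ b c s, L (b * c) s = L b (L c s) := by
    intro b c s
    induction s with
    | zero => simp
    | add s s' hs hs' => simp only [map_add, hs, hs']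
    | tmul x y => simp only [hL, ρ.map_mul]
  have hadd : ∀ b c s, L (b + c) s = L b s + L c s := by
    intro b c s
    induction s with
    | zero => simp
    | add s s' hs hs' => simp only [map_add, hs, hs']; abel
    | tmul x y => simp [hL, TensorProduct.add_tmul]
  have hsmul : ∀ (z : ℂ) b s, L (z • b) s = z • L b s := by
    intro z b s
    induction s with
    | zero => simp
    | add s s' hs hs' => simp only [map_add, hs, hs', smul_add]
    | tmul x y => simp [hL, TensorProduct.smul_tmul']
  let f : E ⊗[ℂ] F →ₗ⋆[ℂ] E ⊗[ℂ] F →ₗ[ℂ] D₂ :=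
    LinearMap.mk₂'ₛₗ (starRingEnd ℂ) (RingHom.id ℂ) (fun s t => T.inner (e s) (e t))
      (fun s s' t => by simp only [map_add, T.inner_add_left])
      (fun c s t => by simp only [map_smul, T.inner_smul_left]; rfl)
      (fun s t t' => by simp only [map_add, T.inner_add_right])
      (fun c s t => by simp only [map_smul, T.inner_smul_right]; rfl)
  -- `norm_form_rep_le` applies to the algebraic tensor product, where the form is only
  -- semidefinite. The bound thus precedes the extension, and it shows that the operators descend to
  -- the image of `e`.
  have hn : ∀ b s, ‖(e ∘ₗ L b) s‖ ≤ ‖b‖ * ‖e s‖ := by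
    intro b s
    have h0 := norm_form_rep_le f (fun s => T.inner_self_pos (e s)) L hadd hsmul hmul hadj b s
    have h1 : ‖e (L b s)‖ ^ 2 ≤ (‖b‖ * ‖e s‖) ^ 2 := by
      rw [T.norm_sq_eq, mul_pow, T.norm_sq_eq]
      exact h0
    exact (pow_le_pow_iff_left₀ (norm_nonneg _) (by positivity) two_ne_zero).1 h1
  let σ : B → T →L[ℂ] T := fun b => (e ∘ₗ L b).extendOfNorm e
  have hσ : ∀ b s, σ b (e s) = e (L b s) := fun b s =>
    LinearMap.extendOfNorm_eq he ⟨_, hn b⟩ s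
  have hστ : ∀ b x y, σ b (τ x y) = τ (ρ.toFun b x) y := fun b x y => by
    have := hσ b (x ⊗ₜ y)
    simpa only [hL, e, TensorProduct.lift.tmul] using this
  have hext : ∀ {S S' : T →L[ℂ] T}, (∀ s, S (e s) = S' (e s)) → S = S' := fun {S S'} hS => by
    refine ContinuousLinearMap.ext fun t => ?_
    exact he.induction_on t (isClosed_eq (by fun_prop) (by fun_prop)) hS
  refine ⟨{ toFun := { toFun := σ, map_add' := fun b c => hext fun s => ?_,
                       map_smul' := fun z b => hext fun s => ?_ }
            map_mul := fun b c t => ?_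
            adjoint := fun b s t => ?_
            nondegenerate := ?_ }, hστ⟩
  · simp only [add_apply, hσ, hadd, map_add]
  · simp only [smul_apply, hσ, hsmul, map_smul, RingHom.id_apply]
  · have : σ (b * c) = (σ b).comp (σ c) := hext fun s => by
      simp only [ContinuousLinearMap.comp_apply, hσ, hmul]
    exact congrArg (fun S => S t) this
  · refine he.induction_on₂ (p := fun s t => T.inner (σ b s) t = T.inner s (σ (star b) t))
      (isClosed_eq (T.continuous_inner (by fun_prop) (by fun_prop))
        (T.continuous_inner (by fun_prop) (by fun_prop))) (fun s t => ?_) s t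
    rw [hσ, hσ, hadj]
  · rw [← dense_closure]
    refine h.dense.mono ?_
    suffices hle : Submodule.span ℂ {t : T | ∃ x y, t = τ x y} ≤
        (Submodule.span ℂ {y : T | ∃ b x, y = σ b x}).topologicalClosure from hle
    rw [Submodule.span_le]
    rintro _ ⟨x, y, rfl⟩
    refine map_mem_closure (f := fun x => τ x y) (h.continuous_left y) (ρ.nondegenerate x) fun x hx => ?_
    induction hx using Submodule.span_induction with
    | mem x hx =>
      obtain ⟨b, x, rfl⟩ := hx
      exact Submodule.subset_span ⟨b, τ x y, (hστ b x y).symm⟩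
    | zero => simp
    | add x x' _ _ hx hx' => simp only [map_add, LinearMap.add_apply]; exact add_mem hx hx'
    | smul c x _ hx =>
      simp only [map_smul, LinearMap.smul_apply]; exact Submodule.smul_mem _ _ hx

end Tensor

end

section

/-! ## Representations of *-algebras and their graph topology -/

section StarAlgebra

open Filter Topology

variable {A : Type u} [Ring A] [Algebra ℂ A] [StarRing A] [StarModule ℂ A]

namespace Rep

variable {D : Type u} [NonUnitalCStarAlgebra D] {E : HilbertModule D}

/-- The map `ξ ↦ (π(a) ξ)_a`, which induces the graph topology. -/
def graph (π : Rep A E) (ξ : π.dom) : A → E := fun a => (π.toFun a ξ : E)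

theorem graph_one (π : Rep A E) (ξ : π.dom) : π.graph ξ 1 = ξ := by
  simp [graph]

/-- The coordinate `a = 1` of the orbit map is `ξ` itself, so the pairs `(ξ, π(a)ξ)` carry no more
information than the family `(π(a)ξ)_a` in the product `A → E`. -/
theorem graphUniformSpace_eq (π : Rep A E) :
    π.graphUniformSpace = UniformSpace.comap π.graph inferInstance := by
  have h1 : (UniformSpace.comap π.graph inferInstance : UniformSpace π.dom) =
      ⨅ a, UniformSpace.comap (fun ξ => π.graph ξ a) inferInstance := by
    rw [Pi.uniformSpace_eq, UniformSpace.comap_iInf]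
    refine iInf_congr fun a => ?_
    rw [← UniformSpace.comap_comap]
    rfl
  have h2 : ∀ a, UniformSpace.comap (fun ξ : π.dom => ((ξ : E), (π.toFun a ξ : E)))
      inferInstance = UniformSpace.comap (fun ξ => π.graph ξ 1) inferInstance ⊓
        UniformSpace.comap (fun ξ => π.graph ξ a) inferInstance := fun a => by
    rw [show (inferInstance : UniformSpace (E × E)) =
      UniformSpace.comap Prod.fst inferInstance ⊓ UniformSpace.comap Prod.snd inferInstance from rfl,
      UniformSpace.comap_inf, ← UniformSpace.comap_comap, ← UniformSpace.comap_comap]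
    simp only [graph_one]
    rfl
  rw [h1, graphUniformSpace]
  simp only [h2]
  refine le_antisymm (iInf_mono fun a => inf_le_right) (le_iInf fun a => le_inf ?_ ?_)
  · exact iInf_le _ 1
  · exact iInf_le _ a

theorem isUniformInducing_graph (π : Rep A E) :
    @IsUniformInducing _ _ π.graphUniformSpace _ π.graph := by
  let _ := π.graphUniformSpace
  exact isUniformInducing_iff_uniformSpace.2 π.graphUniformSpace_eq.symm

/-- The product `A → E` is complete, so for subsets of it completeness and closedness agree. -/
theorem isClosed_iff (π : Rep A E) : π.IsClosed ↔ _root_.IsClosed (Set.range π.graph) := by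
  let _ := π.graphUniformSpace
  rw [IsClosed, completeSpace_iff_isComplete_range π.isUniformInducing_graph]
  exact ⟨fun h => h.isClosed, fun h => h.isComplete⟩

/-- Density in the graph topology. -/
def GraphDense (π : Rep A E) (S : Set E) : Prop :=
  ∀ ξ : π.dom, π.graph ξ ∈ closure (π.graph '' {z | (z : E) ∈ S})

theorem graphDense_iff (π : Rep A E) (S : Set E) : π.GraphDense S ↔
    @Dense π.dom π.graphUniformSpace.toTopologicalSpace {z | (z : E) ∈ S} := by
  exact (@Topology.IsInducing.dense_iff _ _ _ _ π.graphUniformSpace.toTopologicalSpace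
    (@IsUniformInducing.isInducing _ _ π.graphUniformSpace _ _ π.isUniformInducing_graph) _).symm

theorem GraphDense.mono {π : Rep A E} {S S' : Set E} (h : π.GraphDense S) (hS : S ⊆ S') :
    π.GraphDense S' := fun ξ => by
  refine closure_mono (Set.image_mono ?_) (h ξ)
  exact fun z hz => hS hz

theorem IsCore.graphDense {π : Rep A E} {X : Submodule ℂ E} (h : π.IsCore X) :
    π.GraphDense X := (π.graphDense_iff X).2 h.dense

/-- Approximation uses filters because the graph topology need not be metrizable. -/
theorem GraphDense.exists_tendsto {π : Rep A E} {S : Set E} (h : π.GraphDense S) (ξ : π.dom) :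
    ∃ l : Filter π.dom, l.NeBot ∧ (∀ᶠ z : π.dom in l, (z : E) ∈ S) ∧
      ∀ a, Tendsto (fun z : π.dom => (π.toFun a z : E)) l (𝓝 (π.toFun a ξ : E)) := by
  refine ⟨comap π.graph (𝓝 (π.graph ξ)) ⊓ 𝓟 {z | (z : E) ∈ S}, ?_, ?_, fun a => ?_⟩
  · have h1 := mem_closure_iff_comap_neBot.1 (h ξ)
    rw [inf_neBot_iff]
    rintro s ⟨t, ht, hts⟩ s' hs'
    obtain ⟨_, hx, z, hz, rfl⟩ := mem_closure_iff_nhds.1 (h ξ) t ht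
    exact ⟨z, hts hx, hs' hz⟩
  · exact mem_inf_of_right (mem_principal_self _)
  · have h2 : Tendsto π.graph (comap π.graph (𝓝 (π.graph ξ)) ⊓ 𝓟 {z | (z : E) ∈ S})
        (𝓝 (π.graph ξ)) := tendsto_comap.mono_left inf_le_left
    exact (tendsto_pi_nhds.1 h2) a

theorem graphDense_of_tendsto {π : Rep A E} {S : Set E}
    (h : ∀ ξ : π.dom, ∃ (l : Filter π.dom), l.NeBot ∧ (∀ᶠ z : π.dom in l, (z : E) ∈ S) ∧
      ∀ a, Tendsto (fun z : π.dom => (π.toFun a z : E)) l (𝓝 (π.toFun a ξ : E))) : π.GraphDense S := by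
  intro ξ
  obtain ⟨l, _, hS, ha⟩ := h ξ
  refine mem_closure_of_tendsto (f := π.graph) (b := l) (tendsto_pi_nhds.2 ha) ?_
  filter_upwards [hS] with z hz
  exact ⟨z, hz, rfl⟩

/-- Density in the graph topology is transitive. -/
theorem GraphDense.trans {π : Rep A E} {S S' : Set E} (h : π.GraphDense S)
    (hS : ∀ z : π.dom, (z : E) ∈ S → π.graph z ∈ closure (π.graph '' {z | (z : E) ∈ S'})) :
    π.GraphDense S' := fun ξ => by
  refine closure_minimal ?_ isClosed_closure (h ξ)
  rintro _ ⟨z, hz, rfl⟩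
  exact hS z hz

/-- The domain of a closed representation contains limits for the graph topology. -/
theorem IsClosed.exists_of_tendsto {π : Rep A E} (h : π.IsClosed) {ι : Type*} {l : Filter ι}
    [l.NeBot] {z : ι → π.dom} {f : A → E}
    (hf : ∀ a, Tendsto (fun i => (π.toFun a (z i) : E)) l (𝓝 (f a))) :
    ∃ hd : f 1 ∈ π.dom, ∀ a, (π.toFun a ⟨f 1, hd⟩ : E) = f a := by
  have hmem : f ∈ Set.range π.graph := by
    rw [← (π.isClosed_iff.1 h).closure_eq]
    exact mem_closure_of_tendsto (f := fun i => π.graph (z i)) (tendsto_pi_nhds.2 hf)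
      (Eventually.of_forall fun i => ⟨_, rfl⟩)
  obtain ⟨ξ, rfl⟩ := hmem
  have e : ξ = ⟨π.graph ξ 1, by rw [graph_one]; exact ξ.2⟩ := Subtype.ext (π.graph_one ξ).symm
  refine ⟨by rw [graph_one]; exact ξ.2, fun a => ?_⟩
  rw [← e]
  rfl

/-- A continuous map that intertwines two representations on a subset that is dense in the graph
topology intertwines them if the target is closed. -/
theorem IsClosed.intertwines_of_dense {D' : Type u} [NonUnitalCStarAlgebra D']
    {E' : HilbertModule D'} {π : Rep A E} {π' : Rep A E'} (h : π'.IsClosed) {S : Set E}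
    (hS : π.GraphDense S) (I : E → E') (hI : Continuous I)
    (h_int : ∀ x : π.dom, (x : E) ∈ S → ∃ hd : I x ∈ π'.dom, ∀ a,
      I (π.toFun a x) = π'.toFun a ⟨I x, hd⟩) (x : π.dom) :
    ∃ hd : I x ∈ π'.dom, ∀ a, I (π.toFun a x) = π'.toFun a ⟨I x, hd⟩ := by
  obtain ⟨l, _, hlS, hl⟩ := hS.exists_tendsto x
  let z : π.dom → π'.dom := fun y =>
    open Classical in if hy : I y ∈ π'.dom then ⟨I y, hy⟩ else 0
  have hz : ∀ᶠ y in l, ∀ a, I (π.toFun a y) = π'.toFun a (z y) := by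
    filter_upwards [hlS] with y hy a
    obtain ⟨hd, ha⟩ := h_int y hy
    simp only [z, hd, ↓reduceDIte, ha]
  have ht : ∀ a, Tendsto (fun y => (π'.toFun a (z y) : E')) l (𝓝 (I (π.toFun a x))) := fun a => by
    refine ((hI.tendsto _).comp (hl a)).congr' ?_
    filter_upwards [hz] with y hy
    exact hy a
  obtain ⟨hd, ha⟩ := h.exists_of_tendsto ht
  have e : I (π.toFun 1 x) = I x := by simp
  simp only [e] at hd ha
  exact ⟨hd, fun a => (ha a).symm⟩

/-- The orbit maps `a ↦ π(a) ξ` of vectors in the domain. -/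
def orbit (π : Rep A E) : Submodule ℂ (A → E) :=
  LinearMap.range ({ toFun := π.graph, map_add' := fun x y => funext fun a => by simp [graph],
                     map_smul' := fun z x => funext fun a => by simp [graph] } :
    π.dom →ₗ[ℂ] (A → E))

theorem graph_mem_orbit (π : Rep A E) (x : π.dom) : π.graph x ∈ π.orbit := ⟨x, rfl⟩

/-- Membership of a function in `orbit` encodes both that `f 1` is in the domain and how `A` acts on
it. This removes domain proofs from the terms, and the condition is linear, and closed under
pointwise limits if `π` is closed. -/
theorem mem_orbit_iff {π : Rep A E} {f : A → E} :
    f ∈ π.orbit ↔ ∃ h : f 1 ∈ π.dom, ∀ a, (π.toFun a ⟨f 1, h⟩ : E) = f a := by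
  constructor
  · rintro ⟨ξ, rfl⟩
    have e : ξ = ⟨π.graph ξ 1, by rw [graph_one]; exact ξ.2⟩ := Subtype.ext (π.graph_one ξ).symm
    refine ⟨by change π.graph ξ 1 ∈ _; rw [graph_one]; exact ξ.2, fun a => ?_⟩
    change (π.toFun a ⟨π.graph ξ 1, _⟩ : E) = _
    rw [← e]
    rfl
  · rintro ⟨h, ha⟩
    exact ⟨⟨f 1, h⟩, funext ha⟩

theorem mem_orbit_iff_of_eq {π : Rep A E} {f : A → E} {y : E} (hy : f 1 = y) :
    f ∈ π.orbit ↔ ∃ h : y ∈ π.dom, ∀ a, (π.toFun a ⟨y, h⟩ : E) = f a := by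
  subst hy
  exact mem_orbit_iff

theorem IsClosed.mem_orbit_of_tendsto {π : Rep A E} (h : π.IsClosed) {ι : Type*} {l : Filter ι}
    [l.NeBot] {z : ι → A → E} {f : A → E} (hz : ∀ᶠ i in l, z i ∈ π.orbit)
    (hf : ∀ a, Tendsto (fun i => z i a) l (𝓝 (f a))) : f ∈ π.orbit := by
  have hc : _root_.IsClosed (π.orbit : Set (A → E)) := π.isClosed_iff.1 h
  exact hc.mem_of_tendsto (tendsto_pi_nhds.2 hf) hz

/-- A linear relation between orbit maps extends from a set of vectors to its span. -/
theorem map_graph_mem_orbit_of_span {D' : Type u} [NonUnitalCStarAlgebra D']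
    {E' : HilbertModule D'} {π : Rep A E} {π' : Rep A E'} {S : Set E} (hS : S ⊆ π.dom)
    (I : E →ₗ[ℂ] E')
    (h_int : ∀ x (hx : x ∈ S), (fun a => I (π.toFun a ⟨x, hS hx⟩)) ∈ π'.orbit)
    (x : π.dom) (hx : (x : E) ∈ Submodule.span ℂ S) :
    (fun a => I (π.toFun a x)) ∈ π'.orbit := by
  let L : π.dom →ₗ[ℂ] (A → E') :=
    { toFun := fun x a => I (π.toFun a x), map_add' := fun x y => funext fun a => by simp
      map_smul' := fun z x => funext fun a => by simp }
  have hle : Submodule.span ℂ S ≤ (π'.orbit.comap L).map π.dom.subtype := by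
    rw [Submodule.span_le]
    intro x hx
    exact ⟨⟨x, hS hx⟩, h_int x hx, rfl⟩
  obtain ⟨y, hy, hyx⟩ := hle hx
  have : y = x := Subtype.ext hyx
  subst this
  exact hy

/-- A continuous linear map that intertwines two representations on a set whose span is dense in
the graph topology intertwines them if the target is closed. -/
theorem IsClosed.intertwines_of_span {D' : Type u} [NonUnitalCStarAlgebra D']
    {E' : HilbertModule D'} {π : Rep A E} {π' : Rep A E'} (h : π'.IsClosed) {S : Set E}
    (hS : π.GraphDense (Submodule.span ℂ S)) (hSd : S ⊆ π.dom) (I : E →ₗ[ℂ] E')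
    (hI : Continuous I)
    (h_int : ∀ x (hx : x ∈ S), (fun a => I (π.toFun a ⟨x, hSd hx⟩)) ∈ π'.orbit) (x : π.dom) :
    ∃ hd : I x ∈ π'.dom, ∀ a, I (π.toFun a x) = π'.toFun a ⟨I x, hd⟩ := by
  refine h.intertwines_of_dense hS I hI (fun x hx => ?_) x
  obtain ⟨hd, ha⟩ := (mem_orbit_iff_of_eq (y := I x) (by simp)).1
    (map_graph_mem_orbit_of_span hSd I h_int x hx)
  exact ⟨hd, fun a => (ha a).symm⟩

theorem ext_of_apply {π₁ π₂ : Rep A E} (hd : π₁.dom = π₂.dom)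
    (h : ∀ a x (h₁ : x ∈ π₁.dom) (h₂ : x ∈ π₂.dom),
      (π₁.toFun a ⟨x, h₁⟩ : E) = π₂.toFun a ⟨x, h₂⟩) : π₁ = π₂ := by
  obtain ⟨d, _, _, f, _, _⟩ := π₁
  obtain ⟨d', _, _, f', _, _⟩ := π₂
  simp only at hd
  subst hd
  have : f = f' := by
    ext a x
    exact h a x x.2 x.2
  subst this
  rfl

/-- Closed representations that agree on a common subset that is dense in the graph topologies
are equal. -/
theorem eq_of_common_dense {π₁ π₂ : Rep A E} (h₁ : π₁.IsClosed) (h₂ : π₂.IsClosed) {S : Set E}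
    (hS₁ : π₁.GraphDense S) (hS₂ : π₂.GraphDense S) (hd₁ : ∀ x ∈ S, x ∈ π₁.dom)
    (hd₂ : ∀ x ∈ S, x ∈ π₂.dom)
    (h : ∀ a x (hx : x ∈ S), (π₁.toFun a ⟨x, hd₁ x hx⟩ : E) = π₂.toFun a ⟨x, hd₂ x hx⟩) :
    π₁ = π₂ := by
  have h12 := h₂.intertwines_of_dense hS₁ id continuous_id
    fun x hx => ⟨hd₂ x hx, fun a => h a x hx⟩
  have h21 := h₁.intertwines_of_dense hS₂ id continuous_id
    fun x hx => ⟨hd₁ x hx, fun a => (h a x hx).symm⟩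
  refine ext_of_apply (le_antisymm (fun x hx => (h12 ⟨x, hx⟩).1) fun x hx => (h21 ⟨x, hx⟩).1) ?_
  intro a x hx₁ hx₂
  exact (h12 ⟨x, hx₁⟩).2 a

theorem inner_apply_apply (π : Rep A E) (a b : A) (x y : π.dom) :
    E.inner (π.toFun a x) (π.toFun b y) = E.inner x (π.toFun (star a * b) y) := by
  rw [π.adjoint, map_mul]
  rfl

end Rep

/-- The closure of a representation, which is given by the orbit maps of a family of vectors. -/
theorem exists_closed_rep {D : Type u} [NonUnitalCStarAlgebra D] {E : HilbertModule D}
    {X : Type*} (e : A → X → E) (hadd : ∀ a b x, e (a + b) x = e a x + e b x)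
    (hsmul : ∀ (z : ℂ) a x, e (z • a) x = z • e a x)
    (hadj : ∀ a b x y, E.inner (e a x) (e b y) = E.inner (e 1 x) (e (star a * b) y))
    (htrans : ∀ a x, ∃ x', ∀ c, e c x' = e (c * a) x)
    (hact : ∀ x d, ∃ x', ∀ a, e a x' = E.act (e a x) d)
    (hdense : Dense (Submodule.span ℂ (Set.range (e 1)) : Set E)) :
    ∃ π : Rep A E, π.IsClosed ∧ π.IsCore (Submodule.span ℂ (Set.range (e 1))) ∧
      ∀ x, ∃ h : e 1 x ∈ π.dom, ∀ a, (π.toFun a ⟨e 1 x, h⟩ : E) = e a x := by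
  -- The closure `Γ` of `Γ₀` is to be the set of orbit maps. The domain is its image under
  -- evaluation at 1, and `a` acts by the right translation `f ↦ f(· a)`.
  let Γ₀ : Submodule ℂ (A → E) := Submodule.span ℂ (Set.range fun x a => e a x)
  let Γ : Submodule ℂ (A → E) := Γ₀.topologicalClosure
  have hΓ₀ : Γ₀ ≤ Γ := Γ₀.le_topologicalClosure
  have hΓc : IsClosed (Γ : Set (A → E)) := Γ₀.isClosed_topologicalClosure
  have hind : ∀ {P : (A → E) → Prop}, IsClosed {f | P f} → (∀ f ∈ Γ₀, P f) → ∀ f ∈ Γ, P f :=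
    fun hP h f hf => closure_minimal (s := (Γ₀ : Set (A → E))) h hP hf
  have hΓadd : ∀ f ∈ Γ, ∀ a b, f (a + b) = f a + f b := fun f hf a b => by
    refine hind (P := fun f => f (a + b) = f a + f b)
      (isClosed_eq (by fun_prop) (by fun_prop)) (fun f hf => ?_) f hf
    induction hf using Submodule.span_induction with
    | mem f hf => obtain ⟨x, rfl⟩ := hf; exact hadd a b x
    | zero => simp
    | add f g _ _ hf hg => simp only [Pi.add_apply, hf, hg]; abel
    | smul c f _ hf => simp only [Pi.smul_apply, hf, smul_add]
  have hΓsmul : ∀ f ∈ Γ, ∀ (z : ℂ) a, f (z • a) = z • f a := fun f hf z a => by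
    refine hind (P := fun f => f (z • a) = z • f a)
      (isClosed_eq (by fun_prop) (by fun_prop)) (fun f hf => ?_) f hf
    induction hf using Submodule.span_induction with
    | mem f hf => obtain ⟨x, rfl⟩ := hf; exact hsmul z a x
    | zero => simp
    | add f g _ _ hf hg => simp only [Pi.add_apply, hf, hg, smul_add]
    | smul c f _ hf => simp only [Pi.smul_apply, hf, smul_comm c z]
  have hΓadj : ∀ f ∈ Γ, ∀ g ∈ Γ, ∀ a, E.inner (f a) (g 1) = E.inner (f 1) (g (star a)) := by
    intro f hf g hg a
    refine hind (P := fun f => E.inner (f a) (g 1) = E.inner (f 1) (g (star a)))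
      (isClosed_eq (E.continuous_inner (by fun_prop) (by fun_prop))
        (E.continuous_inner (by fun_prop) (by fun_prop))) (fun f hf => ?_) f hf
    refine hind (P := fun g => E.inner (f a) (g 1) = E.inner (f 1) (g (star a)))
      (isClosed_eq (E.continuous_inner (by fun_prop) (by fun_prop))
        (E.continuous_inner (by fun_prop) (by fun_prop))) (fun g hg => ?_) g hg
    induction hf using Submodule.span_induction with
    | zero => simp
    | add f f' _ _ hf hf' => simp only [Pi.add_apply, E.inner_add_left, hf, hf']
    | smul c f _ hf => simp only [Pi.smul_apply, E.inner_smul_left, hf]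
    | mem f hf =>
      obtain ⟨x, rfl⟩ := hf
      induction hg using Submodule.span_induction with
      | zero => simp
      | add g g' _ _ hg hg' => simp only [Pi.add_apply, E.inner_add_right, hg, hg']
      | smul c g _ hg => simp only [Pi.smul_apply, E.inner_smul_right, hg]
      | mem g hg =>
        obtain ⟨y, rfl⟩ := hg
        change E.inner (e a x) (e 1 y) = E.inner (e 1 x) (e (star a) y)
        rw [hadj, mul_one]
  have hmap : ∀ (L : (A → E) →ₗ[ℂ] (A → E)), Continuous L →
      (∀ x, L (fun a => e a x) ∈ Γ₀) → ∀ f ∈ Γ, L f ∈ Γ := by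
    intro L hL h f hf
    refine map_mem_closure hL hf fun f hf => ?_
    have : Γ₀ ≤ Γ₀.comap L := by
      rw [Submodule.span_le]
      rintro _ ⟨x, rfl⟩
      exact h x
    exact this hf
  let tr : A → (A → E) →ₗ[ℂ] (A → E) := fun a =>
    { toFun := fun f c => f (c * a), map_add' := fun f g => rfl, map_smul' := fun c f => rfl }
  have htr : ∀ a, ∀ f ∈ Γ, tr a f ∈ Γ := fun a => by
    refine hmap (tr a) (continuous_pi fun c => by
      simp only [tr, LinearMap.coe_mk, AddHom.coe_mk]; fun_prop) fun x => ?_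
    obtain ⟨x', hx'⟩ := htrans a x
    exact Submodule.subset_span ⟨x', funext fun c => hx' c⟩
  let ac : D → (A → E) →ₗ[ℂ] (A → E) := fun d =>
    { toFun := fun f c => E.act (f c) d, map_add' := fun f g => funext fun c => E.add_act _ _ _
      map_smul' := fun c f => funext fun b => E.smul_act _ _ _ }
  have hac : ∀ d, ∀ f ∈ Γ, ac d f ∈ Γ := fun d => by
    refine hmap (ac d) (continuous_pi fun c => ?_) fun x => ?_
    · simp only [ac, LinearMap.coe_mk, AddHom.coe_mk, ← HilbertModule.actL_apply]
      fun_prop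
    · obtain ⟨x', hx'⟩ := hact x d
      exact Submodule.subset_span ⟨x', funext fun c => hx' c⟩
  let ev : Γ →ₗ[ℂ] E := (LinearMap.proj (R := ℂ) (φ := fun _ : A => E) (1 : A)) ∘ₗ Γ.subtype
  have hev : ∀ f : Γ, ev f = f.1 1 := fun _ => rfl
  have heΓ₀ : ∀ x, (fun a => e a x) ∈ Γ₀ := fun x => Submodule.subset_span ⟨x, rfl⟩
  have heΓ : ∀ x, (fun a => e a x) ∈ Γ := fun x => hΓ₀ (heΓ₀ x)
  -- Closability: if `f 1 = 0`, then `f a` is orthogonal to the total set of vectors `e 1 x`, by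
  -- moving `a` to the other side.
  have hinj : Function.Injective ev := by
    rw [injective_iff_map_eq_zero]
    rintro ⟨f, hf⟩ hf1
    refine Subtype.ext (funext fun a => ?_)
    change f a = 0
    refine HilbertModule.ext_of_dense hdense ?_
    rintro _ ⟨x, rfl⟩
    have := hΓadj f hf _ (heΓ x) a
    have h1 : f 1 = 0 := hf1
    rw [h1, E.inner_zero_left] at this
    rw [E.inner_zero_right, ← E.star_inner, this, star_zero]
  let eq : Γ ≃ₗ[ℂ] LinearMap.range ev := LinearEquiv.ofInjective ev hinj
  have heq : ∀ f : Γ, (eq f : E) = f.1 1 := fun f => rfl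
  let op : A → Γ →ₗ[ℂ] Γ := fun a => (tr a).restrict (htr a)
  have hop : ∀ a f c, (op a f).1 c = f.1 (c * a) := fun _ _ _ => rfl
  let F : A →ₗ[ℂ] Module.End ℂ (LinearMap.range ev) :=
    { toFun := fun a => eq.toLinearMap ∘ₗ op a ∘ₗ eq.symm.toLinearMap
      map_add' := fun a b => by
        ext x
        obtain ⟨f, rfl⟩ := eq.surjective x
        simp only [LinearMap.comp_apply, LinearEquiv.coe_coe, LinearEquiv.symm_apply_apply, heq,
          hop, LinearMap.add_apply, Submodule.coe_add, one_mul]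
        exact hΓadd _ f.2 a b
      map_smul' := fun z a => by
        ext x
        obtain ⟨f, rfl⟩ := eq.surjective x
        simp only [LinearMap.comp_apply, LinearEquiv.coe_coe, LinearEquiv.symm_apply_apply, heq,
          hop, LinearMap.smul_apply, Submodule.coe_smul, one_mul, RingHom.id_apply]
        exact hΓsmul _ f.2 z a }
  have hF : ∀ a f, F a (eq f) = eq (op a f) := fun a f => by
    simp only [F, LinearMap.coe_mk, AddHom.coe_mk, LinearMap.comp_apply, LinearEquiv.coe_coe,
      LinearEquiv.symm_apply_apply]
  have hFE : ∀ a f, (F a (eq f) : E) = f.1 a := fun a f => by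
    rw [hF, heq, hop, one_mul]
  have hr : ∀ x : LinearMap.range ev, ∃ f, eq f = x := eq.surjective
  let FA : A →ₐ[ℂ] Module.End ℂ (LinearMap.range ev) := AlgHom.ofLinearMap F
    (by
      ext x
      obtain ⟨f, rfl⟩ := hr x
      rw [hFE]
      rfl)
    (fun a b => by
      ext x
      obtain ⟨f, rfl⟩ := hr x
      rw [Module.End.mul_apply, hF b, hFE, hFE, hop])
  have hFA : ∀ a f, (FA a (eq f) : E) = f.1 a := hFE
  let π : Rep A E :=
    { dom := LinearMap.range ev
      dense := hdense.mono (by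
        rw [SetLike.coe_subset_coe, Submodule.span_le]
        rintro _ ⟨x, rfl⟩
        exact ⟨⟨_, heΓ x⟩, rfl⟩)
      act_mem := by
        rintro _ ⟨f, rfl⟩ d
        exact ⟨⟨ac d f, hac d f f.2⟩, rfl⟩
      toFun := FA
      map_act := fun a x d => by
        obtain ⟨f, rfl⟩ := hr x
        rw [hFA]
        exact hFA a ⟨ac d f, hac d f f.2⟩
      adjoint := fun a x y => by
        obtain ⟨f, rfl⟩ := hr x
        obtain ⟨g, rfl⟩ := hr y
        rw [hFA, hFA]
        exact hΓadj _ f.2 _ g.2 a }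
  have hgr : ∀ f, π.graph (eq f) = f.1 := fun f => funext fun a => hFA a f
  have hrange : Set.range π.graph = Γ := by
    ext g
    constructor
    · rintro ⟨x, rfl⟩
      obtain ⟨f, rfl⟩ := hr x
      rw [hgr]
      exact f.2
    · intro hg
      exact ⟨eq ⟨g, hg⟩, hgr _⟩
  -- By `htrans` every value of an orbit map is itself an initial vector; so the core is invariant.
  have hspan : ∀ f ∈ Γ₀, ∀ a, f a ∈ Submodule.span ℂ (Set.range (e 1)) := fun f hf a => by
    induction hf using Submodule.span_induction with
    | mem f hf =>
      obtain ⟨x, rfl⟩ := hf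
      obtain ⟨x', hx'⟩ := htrans a x
      exact Submodule.subset_span ⟨x', by simpa using hx' 1⟩
    | zero => simp
    | add f g _ _ hf hg => exact add_mem hf hg
    | smul c f _ hf => exact Submodule.smul_mem _ c hf
  have hspan' : ∀ y ∈ Submodule.span ℂ (Set.range (e 1)), ∃ f ∈ Γ₀, f 1 = y := fun y hy => by
    induction hy using Submodule.span_induction with
    | mem y hy =>
      obtain ⟨x, rfl⟩ := hy
      exact ⟨_, heΓ₀ x, rfl⟩
    | zero => exact ⟨0, zero_mem _, rfl⟩
    | add y z _ _ hy hz =>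
      obtain ⟨f, hf, rfl⟩ := hy
      obtain ⟨g, hg, rfl⟩ := hz
      exact ⟨f + g, add_mem hf hg, rfl⟩
    | smul c y _ hy =>
      obtain ⟨f, hf, rfl⟩ := hy
      exact ⟨c • f, Submodule.smul_mem _ c hf, rfl⟩
  refine ⟨π, ?_, ?_, fun x => ⟨⟨⟨_, heΓ x⟩, rfl⟩, fun a => hFA a ⟨_, heΓ x⟩⟩⟩
  · rw [Rep.isClosed_iff, hrange]
    exact hΓc
  · refine ⟨fun y hy => ?_, fun a x hx => ?_, fun y hy d => ?_, ?_⟩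
    · obtain ⟨f, hf, rfl⟩ := hspan' y hy
      exact ⟨⟨f, hΓ₀ hf⟩, rfl⟩
    · obtain ⟨f, hf, hfx⟩ := hspan' x hx
      have : x = eq ⟨f, hΓ₀ hf⟩ := Subtype.ext hfx.symm
      rw [this]
      change (FA a (eq ⟨f, hΓ₀ hf⟩) : E) ∈ _
      rw [hFA]
      exact hspan f hf a
    · induction hy using Submodule.span_induction with
      | mem y hy =>
        obtain ⟨x, rfl⟩ := hy
        obtain ⟨x', hx'⟩ := hact x d
        exact Submodule.subset_span ⟨x', hx' 1⟩
      | zero => simp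
      | add y z _ _ hy hz => rw [E.add_act]; exact add_mem hy hz
      | smul c y _ hy => rw [E.smul_act]; exact Submodule.smul_mem _ c hy
    · refine (π.graphDense_iff (Submodule.span ℂ (Set.range (e 1)))).1 fun x => ?_
      obtain ⟨f, rfl⟩ := hr x
      rw [hgr]
      refine closure_mono ?_ f.2
      intro g hg
      exact ⟨eq ⟨g, hΓ₀ hg⟩, hspan g hg 1, hgr _⟩

end StarAlgebra

end

section

open Filter Topology

/-! ## Gradings -/

section Graded

variable {G : Type u} [Group G] {A : Type u} [Ring A] [Algebra ℂ A] [StarRing A] [StarModule ℂ A]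

namespace StarGrading

variable (𝒜 : StarGrading G A)

open scoped Classical in
theorem isInternal : DirectSum.IsInternal 𝒜.fibre :=
  DirectSum.isInternal_submodule_of_iSupIndep_of_iSup_eq_top 𝒜.independent 𝒜.iSup_eq_top

open scoped Classical in
/-- The decomposition of an element into homogeneous components. -/
def decompose : A ≃ₗ[ℂ] ⨁ g, 𝒜.fibre g :=
  (LinearEquiv.ofBijective (DirectSum.coeLinearMap 𝒜.fibre) 𝒜.isInternal).symm

/-- The homogeneous component of degree `g`. -/
def proj (g : G) : A →ₗ[ℂ] 𝒜.fibre g :=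
  DirectSum.component ℂ G (fun g => 𝒜.fibre g) g ∘ₗ 𝒜.decompose.toLinearMap

open scoped Classical in
theorem decompose_coe {g : G} (a : 𝒜.fibre g) :
    𝒜.decompose a = DirectSum.lof ℂ G (fun g => 𝒜.fibre g) g a := by
  have h : DirectSum.coeLinearMap 𝒜.fibre (DirectSum.lof ℂ G (fun g => 𝒜.fibre g) g a) = a :=
    DirectSum.coeLinearMap_lof 𝒜.fibre g a
  refine (LinearEquiv.symm_apply_eq _).2 ?_
  exact h.symm

@[simp] theorem proj_coe {g : G} (a : 𝒜.fibre g) : 𝒜.proj g a = a := by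
  classical
  simp only [proj, LinearMap.comp_apply, LinearEquiv.coe_coe, decompose_coe]
  exact DirectSum.component.lof_self ℂ (M := fun g => 𝒜.fibre g) g a

theorem proj_coe_of_ne {g h : G} (hgh : g ≠ h) (a : 𝒜.fibre g) : 𝒜.proj h a = 0 := by
  classical
  simp only [proj, LinearMap.comp_apply, LinearEquiv.coe_coe, decompose_coe]
  rw [DirectSum.component.of, dif_neg hgh]

theorem proj_of_mem_of_ne {g h : G} (hgh : g ≠ h) {a : A} (ha : a ∈ 𝒜.fibre g) :
    𝒜.proj h a = 0 := 𝒜.proj_coe_of_ne hgh ⟨a, ha⟩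

theorem proj_of_mem {g : G} {a : A} (ha : a ∈ 𝒜.fibre g) : 𝒜.proj g a = ⟨a, ha⟩ :=
  𝒜.proj_coe ⟨a, ha⟩

variable {𝒜} in
/-- Induction over homogeneous elements. -/
theorem induction {P : A → Prop} (h : ∀ (g : G) (a : 𝒜.fibre g), P a)
    (hadd : ∀ a b, P a → P b → P (a + b)) (a : A) : P a := by
  have ha : a ∈ iSup 𝒜.fibre := by rw [𝒜.iSup_eq_top]; trivial
  refine Submodule.iSup_induction 𝒜.fibre (motive := P) ha (fun g a ha => h g ⟨a, ha⟩) ?_ hadd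
  exact h 1 0

theorem exists_support (a : A) : ∃ s : Finset G, (∀ g ∉ s, 𝒜.proj g a = 0) ∧
    ∀ t, s ⊆ t → ∑ g ∈ t, (𝒜.proj g a : A) = a := by
  classical
  induction a using StarGrading.induction (𝒜 := 𝒜) with
  | h g a =>
    refine ⟨{g}, fun h hh => 𝒜.proj_coe_of_ne (by simpa [eq_comm] using hh) a, fun t ht => ?_⟩
    rw [Finset.sum_eq_single g (fun h _ hh => by rw [𝒜.proj_coe_of_ne hh.symm a]; rfl)
      (fun hg => absurd (ht (by simp)) hg), proj_coe]
  | hadd a b ha hb =>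
    obtain ⟨s, hs, hs'⟩ := ha
    obtain ⟨t, ht, ht'⟩ := hb
    refine ⟨s ∪ t, fun g hg => ?_, fun r hr => ?_⟩
    · rw [Finset.mem_union, not_or] at hg
      rw [map_add, hs g hg.1, ht g hg.2, add_zero]
    · simp only [map_add, Submodule.coe_add, Finset.sum_add_distrib]
      rw [hs' r (Finset.union_subset_left hr), ht' r (Finset.union_subset_right hr)]

/-- The product of homogeneous elements. -/
def mul {g h : G} (a : 𝒜.fibre g) (b : 𝒜.fibre h) : 𝒜.fibre (g * h) :=
  ⟨a * b, 𝒜.mul_mem a.2 b.2⟩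

/-- The projection onto the unit fibre. -/
def unitProj : A →ₗ[ℂ] 𝒜.unitFibre where
  toFun a := ⟨𝒜.proj 1 a, (𝒜.proj 1 a).2⟩
  map_add' a b := Subtype.ext (by simp)
  map_smul' z a := Subtype.ext (by simp)

theorem unitProj_coe (a : A) : (𝒜.unitProj a : A) = 𝒜.proj 1 a := rfl

theorem unitProj_star_mul {g : G} (a b : 𝒜.fibre g) :
    𝒜.unitProj (star (a : A) * b) = 𝒜.starMul a b := by
  apply Subtype.ext
  exact congrArg Subtype.val (𝒜.proj_of_mem (𝒜.starMul a b).2)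

theorem unitProj_star_mul_of_ne {g h : G} (hgh : g ≠ h) (a : 𝒜.fibre g) (b : 𝒜.fibre h) :
    𝒜.unitProj (star (a : A) * b) = 0 := by
  apply Subtype.ext
  rw [unitProj_coe, 𝒜.proj_of_mem_of_ne _ (𝒜.mul_mem (𝒜.star_mem a.2) b.2)]
  · rfl
  · rwa [Ne, inv_mul_eq_one]

theorem proj_star (a : A) (g : G) : (𝒜.proj g (star a) : A) = star (𝒜.proj g⁻¹ a : A) := by
  induction a using StarGrading.induction (𝒜 := 𝒜) with
  | h h a =>
    by_cases hg : h⁻¹ = g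
    · subst hg
      rw [𝒜.proj_of_mem (𝒜.star_mem a.2), inv_inv, proj_coe]
    · rw [𝒜.proj_of_mem_of_ne hg (𝒜.star_mem a.2),
        𝒜.proj_coe_of_ne (fun h' => hg (by rw [h', inv_inv]))]
      simp
  | hadd a b ha hb => simp only [star_add, map_add, Submodule.coe_add, ha, hb]

theorem unitProj_star (a : A) : 𝒜.unitProj (star a) = star (𝒜.unitProj a) := by
  apply Subtype.ext
  rw [unitProj_coe, proj_star, inv_one]
  rfl

theorem unitProj_mul_right (a : A) (b : 𝒜.unitFibre) :
    𝒜.unitProj (a * b) = 𝒜.unitProj a * b := by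
  induction a using StarGrading.induction (𝒜 := 𝒜) with
  | h g a =>
    apply Subtype.ext
    by_cases hg : g = 1
    · subst hg
      have : (a : A) * b ∈ 𝒜.fibre 1 := by simpa using 𝒜.mul_mem a.2 b.2
      rw [unitProj_coe, 𝒜.proj_of_mem this]
      change (a : A) * b = (𝒜.proj 1 (a : A) : A) * b
      rw [proj_coe]
    · have : (a : A) * b ∈ 𝒜.fibre g := by simpa using 𝒜.mul_mem a.2 b.2
      rw [unitProj_coe, 𝒜.proj_of_mem_of_ne hg this]
      change (0 : A) = (𝒜.proj 1 (a : A) : A) * b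
      rw [𝒜.proj_coe_of_ne hg]
      simp
  | hadd a c ha hc => simp only [add_mul, map_add, ha, hc]

theorem starMul_star {g : G} (a b : 𝒜.fibre g) : star (𝒜.starMul a b) = 𝒜.starMul b a := by
  apply Subtype.ext
  change star (star (a : A) * b) = star (b : A) * a
  simp

end StarGrading

namespace Rep

variable {D : Type u} [NonUnitalCStarAlgebra D] {E : HilbertModule D}
  (𝒜 : StarGrading G A)

/-- Convergence to zero for the unit fibre implies convergence to zero for the whole algebra. -/
theorem tendsto_zero_of_unitFibre (π : Rep A E) {ι : Type*} {l : Filter ι} {z : ι → π.dom}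
    (h : ∀ a ∈ 𝒜.fibre 1, Tendsto (fun i => (π.toFun a (z i) : E)) l (𝓝 0)) (a : A) :
    Tendsto (fun i => (π.toFun a (z i) : E)) l (𝓝 0) := by
  induction a using StarGrading.induction (𝒜 := 𝒜) with
  | hadd a b ha hb =>
    have := ha.add hb
    rw [add_zero] at this
    refine this.congr fun i => ?_
    rw [map_add]
    rfl
  | h g a =>
    -- `‖π(a)z‖² = ‖⟨z, π(a* a)z⟩‖`, and `a* a` lies in the unit fibre for homogeneous `a`.
    have h1 : Tendsto (fun i => ‖E.inner (z i) (π.toFun (star (a : A) * a) (z i))‖) l (𝓝 0) := by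
      have h2 := h 1 𝒜.one_mem
      have h3 := h _ (𝒜.starMul a a).2
      have h4 := (E.tendsto_inner h2 h3).norm
      simp only [E.inner_zero_left, norm_zero, map_one] at h4
      exact h4
    rw [tendsto_zero_iff_norm_tendsto_zero]
    have h5 : ∀ i, ‖(π.toFun a (z i) : E)‖ =
        √‖E.inner (z i) (π.toFun (star (a : A) * a) (z i))‖ := fun i => by
      rw [← π.inner_apply_apply, ← E.norm_sq_eq, Real.sqrt_sq (norm_nonneg _)]
    simp only [h5]
    have := (Real.continuous_sqrt.tendsto 0).comp h1
    rwa [Real.sqrt_zero] at this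

theorem tendsto_of_unitFibre (π : Rep A E) {ι : Type*} {l : Filter ι} {z : ι → π.dom}
    {ξ : π.dom}
    (h : ∀ a ∈ 𝒜.fibre 1, Tendsto (fun i => (π.toFun a (z i) : E)) l (𝓝 (π.toFun a ξ : E)))
    (a : A) : Tendsto (fun i => (π.toFun a (z i) : E)) l (𝓝 (π.toFun a ξ : E)) := by
  have h1 := π.tendsto_zero_of_unitFibre 𝒜 (z := fun i => z i - ξ) (l := l) (fun b hb => by
    have := (h b hb).sub_const (π.toFun b ξ : E)
    rw [sub_self] at this
    exact this.congr fun i => by rw [map_sub]; rfl) a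
  have h2 := h1.add_const (π.toFun a ξ : E)
  rw [zero_add] at h2
  refine h2.congr fun i => ?_
  rw [map_sub, Submodule.coe_sub, sub_add_cancel]

/-- The convergence result is applied to the differences `z i - z j`; this gives the Cauchy
property, and `E` is complete. -/
theorem exists_tendsto_of_unitFibre (π : Rep A E) {ι : Type*} {l : Filter ι} [l.NeBot]
    {z : ι → π.dom}
    (h : ∀ a ∈ 𝒜.fibre 1, ∃ y, Tendsto (fun i => (π.toFun a (z i) : E)) l (𝓝 y))
    (a : A) : ∃ y, Tendsto (fun i => (π.toFun a (z i) : E)) l (𝓝 y) := by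
  have h1 := π.tendsto_zero_of_unitFibre 𝒜 (z := fun i : ι × ι => z i.2 - z i.1)
    (l := l ×ˢ l) (fun b hb => by
      obtain ⟨y, hy⟩ := h b hb
      have := (hy.comp tendsto_snd).sub (hy.comp tendsto_fst)
      rw [sub_self] at this
      exact this.congr fun i => by rw [map_sub]; rfl) a
  refine cauchy_map_iff_exists_tendsto.1 (cauchy_map_iff.2 ⟨inferInstance, ?_⟩)
  rw [uniformity_eq_comap_nhds_zero, tendsto_comap_iff]
  refine h1.congr fun i => ?_
  rw [map_sub]
  rfl

/-- The restriction of a closed representation to the unit fibre is closed. -/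
theorem IsClosed.restrict {π : Rep A E} (h : π.IsClosed) : (π.restrict 𝒜.unitFibre).IsClosed := by
  rw [isClosed_iff, ← closure_subset_iff_isClosed]
  intro f hf
  -- `f` prescribes limits for `A_e` only. Convergence for the rest of `A` is automatic, so
  -- closedness of `π` applies to the extended family `F`.
  let l : Filter π.dom := comap (π.restrict 𝒜.unitFibre).graph (𝓝 f)
  have _ : l.NeBot := by
    refine comap_neBot_iff.2 fun t ht => ?_
    obtain ⟨_, hx, z, rfl⟩ := mem_closure_iff_nhds.1 hf t ht
    exact ⟨z, hx⟩
  have hl : ∀ a : 𝒜.unitFibre, Tendsto (fun z => (π.toFun a z : E)) l (𝓝 (f a)) :=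
    tendsto_pi_nhds.1 tendsto_comap
  choose F hF using π.exists_tendsto_of_unitFibre 𝒜 (l := l) (z := id)
    (fun a ha => ⟨_, hl ⟨a, ha⟩⟩)
  obtain ⟨hd, hdF⟩ := h.exists_of_tendsto hF
  refine ⟨⟨F 1, hd⟩, funext fun a => ?_⟩
  change (π.toFun a ⟨F 1, hd⟩ : E) = f a
  rw [hdF]
  exact tendsto_nhds_unique (hF a) (hl a)

end Rep

end Graded

/-! ## C*-hulls -/

section Hull

variable {A : Type u} [Ring A] [Algebra ℂ A] [StarRing A] [StarModule ℂ A] {𝓘 : RepClass A}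
  {B : Type u} [NonUnitalCStarAlgebra B] (H : CStarHull 𝓘 B)

namespace CStarHull

variable {D : Type u} [NonUnitalCStarAlgebra D] {E : HilbertModule D}

theorem mem_Φ (ρ : CStarRep B E) : 𝓘.Mem (H.Φ ρ) := (H.bijOn E).1 (Set.mem_univ ρ)

theorem isClosed_Φ (ρ : CStarRep B E) : (H.Φ ρ).IsClosed := 𝓘.closed _ (H.mem_Φ ρ)

theorem injective_Φ {ρ₁ ρ₂ : CStarRep B E} (h : H.Φ ρ₁ = H.Φ ρ₂) : ρ₁ = ρ₂ :=
  (H.bijOn E).2.1 (Set.mem_univ _) (Set.mem_univ _) h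

theorem exists_Φ_eq {π : Rep A E} (h : 𝓘.Mem π) : ∃ ρ : CStarRep B E, H.Φ ρ = π := by
  obtain ⟨ρ, _, hρ⟩ := (H.bijOn E).2.2 h
  exact ⟨ρ, hρ⟩

/-- `Φ(ρ)` is the closure of `μ ⊗ 1`, where `μ` is the universal representation. -/
theorem isTensor_Φ (ρ : CStarRep B E) :
    H.univ.IsTensor (E := HilbertModule.self B) (F := E) (T := E)
      (LinearMap.mk₂ ℂ (fun (b : B) (x : E) => ρ.toFun b x) (by simp) (by simp) (by simp)
        (by simp)) (H.Φ ρ) := by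
  -- `E` is the interior tensor product `B ⊗_B E` through `b ⊗ x ↦ ρ(b)x`, and `ρ` is the identity
  -- representation tensored with 1.
  refine H.tensor (E := HilbertModule.self B) (φ := ρ) ?_ _ ρ ?_
  · refine ⟨fun b x d => ρ.map_act b x d, fun b x c y => ρ.inner_apply_apply b c x y, ?_⟩
    exact ρ.nondegenerate
  · intro b c x
    exact (ρ.map_mul b c x).symm

theorem apply_mem_dom (ρ : CStarRep B E) (b : H.univ.dom) (x : E) :
    ρ.toFun (H.val b) x ∈ (H.Φ ρ).dom :=
  (H.isTensor_Φ ρ).core.le_dom (Submodule.subset_span ⟨b, x, rfl⟩)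

theorem Φ_apply (ρ : CStarRep B E) (a : A) (b : H.univ.dom) (x : E)
    (h : ρ.toFun (H.val b) x ∈ (H.Φ ρ).dom) :
    ((H.Φ ρ).toFun a ⟨ρ.toFun (H.val b) x, h⟩ : E) = ρ.toFun (H.val (H.univ.toFun a b)) x :=
  (H.isTensor_Φ ρ).map_tensor a b x h

theorem graphDense_Φ (ρ : CStarRep B E) :
    (H.Φ ρ).GraphDense (Submodule.span ℂ {y | ∃ (b : H.univ.dom) (x : E),
      y = ρ.toFun (H.val b) x}) :=
  (H.isTensor_Φ ρ).core.graphDense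

theorem val_add (b c : H.univ.dom) : H.val (b + c) = H.val b + H.val c := rfl
theorem val_smul (z : ℂ) (b : H.univ.dom) : H.val (z • b) = z • H.val b := rfl

/-- Right multiplication on the domain of the universal representation. -/
def domMul (b : H.univ.dom) (c : B) : H.univ.dom := ⟨H.val b * c, H.univ.act_mem b b.2 c⟩

theorem val_domMul (b : H.univ.dom) (c : B) : H.val (H.domMul b c) = H.val b * c := rfl

theorem univ_domMul (a : A) (b : H.univ.dom) (c : B) :
    H.val (H.univ.toFun a (H.domMul b c)) = H.val (H.univ.toFun a b) * c :=
  H.univ.map_act a b c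

theorem univ_adjoint (a : A) (b c : H.univ.dom) :
    star (H.val (H.univ.toFun a b)) * H.val c = star (H.val b) * H.val (H.univ.toFun (star a) c) :=
  H.univ.adjoint a b c

theorem dense_dom : Dense (H.univ.dom : Set B) := H.univ.dense

/-- The transfer of intertwining relations along a creation-type map `σ`, between
representations of `B` and the corresponding representations of `A`. -/
theorem transfer {D₁ D₂ : Type u} [NonUnitalCStarAlgebra D₁] [NonUnitalCStarAlgebra D₂]
    {E₁ : HilbertModule D₁} {F : HilbertModule D₂} (φ : CStarRep D₁ F)
    (σ : E₁ →ₗ[ℂ] (F →L[ℂ] F))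
    (hact : ∀ x y d, σ x (F.act y d) = F.act (σ x y) d)
    (hσ : ∀ x y ξ η, F.inner (σ x ξ) (σ y η) = F.inner ξ (φ.toFun (E₁.inner x y) η))
    (ρ₁ : CStarRep B E₁) (ρ : CStarRep B F) :
    (∀ b x y, ρ.toFun b (σ x y) = σ (ρ₁.toFun b x) y) ↔
      ∀ (x : (H.Φ ρ₁).dom) (y : F), ∃ h : σ x y ∈ (H.Φ ρ).dom, ∀ a,
        ((H.Φ ρ).toFun a ⟨σ x y, h⟩ : F) = σ ((H.Φ ρ₁).toFun a x) y := by
  -- By `hσ` the closed span of the vectors `σ x y` is the interior tensor product of `E₁` and `F`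
  -- over `D₁`. The claim then follows from the axioms of the hull for tensor products and for the
  -- isometric inclusion `J` of this closed span.
  let S₀ : Submodule ℂ F := Submodule.span ℂ {t | ∃ x y, t = σ x y}
  let S : Submodule ℂ F := S₀.topologicalClosure
  have hSσ : ∀ x y, σ x y ∈ S := fun x y =>
    S₀.le_topologicalClosure (Submodule.subset_span ⟨x, y, rfl⟩)
  have hSact : ∀ t ∈ S, ∀ d, F.act t d ∈ S := fun t ht d => by
    have hc : Continuous fun t => F.act t d := by
      simp only [← HilbertModule.actL_apply]; fun_prop
    refine map_mem_closure (f := fun t => F.act t d) hc ht fun t ht => ?_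
    induction ht using Submodule.span_induction with
    | mem t ht =>
      obtain ⟨x, y, rfl⟩ := ht
      exact Submodule.subset_span ⟨x, F.act y d, (hact x y d).symm⟩
    | zero => simp
    | add s t _ _ hs ht => simp only [F.add_act]; exact add_mem hs ht
    | smul c t _ ht => simp only [F.smul_act]; exact Submodule.smul_mem _ _ ht
  let T : HilbertModule D₂ := F.sub S S₀.isClosed_topologicalClosure hSact
  let τ : E₁ →ₗ[ℂ] F →ₗ[ℂ] T := LinearMap.mk₂ ℂ (fun x y => (⟨σ x y, hSσ x y⟩ : S))
    (fun x x' y => Subtype.ext (by simp; rfl)) (fun c x y => Subtype.ext (by simp; rfl))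
    (fun x y y' => Subtype.ext (by simp; rfl)) (fun c x y => Subtype.ext (by simp; rfl))
  let J : ModuleIsometry T F := ⟨S.subtype, fun _ _ => rfl, fun _ _ => rfl⟩
  have hJτ : ∀ x y, J.toLin (τ x y) = σ x y := fun _ _ => rfl
  have hT : IsInteriorTensor E₁ F φ T τ := by
    refine ⟨fun x y d => Subtype.ext (hact x y d), fun x y x' y' => hσ x x' y y', ?_⟩
    rw [dense_iff_closure_eq, Set.eq_univ_iff_forall]
    rintro ⟨t, ht⟩
    rw [closure_subtype]
    refine closure_mono ?_ ht
    intro s hs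
    refine ⟨⟨s, S₀.le_topologicalClosure hs⟩, ?_, rfl⟩
    have hle : S₀ ≤ (Submodule.span ℂ {t : T | ∃ x y, t = τ x y}).map S.subtype := by
      rw [Submodule.span_le]
      rintro _ ⟨x, y, rfl⟩
      exact ⟨τ x y, Submodule.subset_span ⟨x, y, rfl⟩, rfl⟩
    obtain ⟨t, ht, rfl⟩ := hle hs
    exact ht
  obtain ⟨ς, hς⟩ := hT.exists_tensorRep ρ₁
  have hΦ := H.tensor hT ρ₁ ς hς
  have hiso := H.isometric ς ρ J
  have hdom : ∀ (x : (H.Φ ρ₁).dom) (y : F), τ x y ∈ (H.Φ ς).dom := fun x y =>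
    hΦ.core.le_dom (Submodule.subset_span ⟨x, y, rfl⟩)
  constructor
  · intro h
    have h_int : ς.Intertwines ρ J := by
      intro b t
      refine hT.dense.induction (P := fun t => J.toLin (ς.toFun b t) = ρ.toFun b (J.toLin t)) ?_
        (isClosed_eq (J.continuous.comp (ς.toFun b).continuous)
          ((ρ.toFun b).continuous.comp J.continuous)) t
      intro t ht
      induction ht using Submodule.span_induction with
      | mem t ht =>
        obtain ⟨x, y, rfl⟩ := ht
        rw [hς, hJτ, hJτ, h]
      | zero => simp
      | add s t _ _ hs ht => simp only [map_add, hs, ht]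
      | smul c t _ ht => simp only [map_smul, ht]
    intro x y
    obtain ⟨hd, ha⟩ := hiso.1 h_int ⟨τ x y, hdom x y⟩
    refine ⟨hd, fun a => ?_⟩
    refine (ha a).symm.trans ?_
    rw [hΦ.map_tensor a x y (hdom x y), hJτ]
  · intro h
    have h_int : (H.Φ ς).Intertwines (H.Φ ρ) J := by
      refine (H.isClosed_Φ ρ).intertwines_of_span hΦ.core.graphDense
        (fun t ht => hΦ.core.le_dom (Submodule.subset_span ht)) J.toLin J.continuous ?_
      rintro _ ⟨x, y, rfl⟩
      refine (Rep.mem_orbit_iff_of_eq (y := σ x y) (by simp [hJτ])).2 ?_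
      obtain ⟨hd, ha⟩ := h x y
      refine ⟨hd, fun a => ?_⟩
      rw [hΦ.map_tensor a x y, hJτ]
      exact ha a
    intro b x y
    have := hiso.2 h_int b (τ x y)
    rw [hς, hJτ, hJτ] at this
    exact this.symm

end CStarHull

end Hull

end

section

/-! ## Isometries and creation operators defined on a total set -/

section Extension

variable {D : Type u} [NonUnitalCStarAlgebra D]

/-- A map that preserves inner products on a total set extends to an isometry. -/
theorem exists_moduleIsometry {E₁ E₂ : HilbertModule D} {X : Type*} (i : X → E₁)
    (hi : Dense (Submodule.span ℂ (Set.range i) : Set E₁)) (f : X → E₂)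
    (hf : ∀ x y, E₂.inner (f x) (f y) = E₁.inner (i x) (i y)) :
    ∃ I : ModuleIsometry E₁ E₂, ∀ x, I.toLin (i x) = f x := by
  let j : (X →₀ ℂ) →ₗ[ℂ] E₁ := Finsupp.linearCombination ℂ i
  let k : (X →₀ ℂ) →ₗ[ℂ] E₂ := Finsupp.linearCombination ℂ f
  have hj : DenseRange j := by
    rw [← Finsupp.range_linearCombination] at hi
    exact hi
  have hin : ∀ u v, E₂.inner (k u) (k v) = E₁.inner (j u) (j v) := fun u v => by
    simp only [j, k, Finsupp.linearCombination_apply, Finsupp.sum, E₂.inner_sum_left,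
      E₁.inner_sum_left, E₂.inner_sum_right, E₁.inner_sum_right, E₁.inner_smul_left,
      E₂.inner_smul_left, E₁.inner_smul_right, E₂.inner_smul_right, hf]
  have hn : ∀ u, ‖k u‖ ≤ 1 * ‖j u‖ := fun u => by
    rw [one_mul]
    refine le_of_eq ((sq_eq_sq₀ (norm_nonneg _) (norm_nonneg _)).1 ?_)
    rw [E₂.norm_sq_eq, E₁.norm_sq_eq, hin]
  let I := k.extendOfNorm j
  have hI : ∀ u, I (j u) = k u := LinearMap.extendOfNorm_eq hj ⟨1, hn⟩
  have hII : ∀ x y, E₂.inner (I x) (I y) = E₁.inner x y := fun x y => by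
    refine hj.induction_on₂ (p := fun x y => E₂.inner (I x) (I y) = E₁.inner x y) ?_
      (fun u v => by rw [hI, hI, hin]) x y
    exact isClosed_eq (E₂.continuous_inner (by fun_prop) (by fun_prop))
      (E₁.continuous_inner (by fun_prop) (by fun_prop))
  refine ⟨⟨I.toLinearMap, fun x d => ?_, hII⟩, fun x => ?_⟩
  -- Linearity over `D` is automatic: the inner square of `I(x d) - I(x) d` involves only inner
  -- products that `I` preserves, and it cancels.
  · rw [← sub_eq_zero]
    apply E₂.inner_self_eq_zero
    simp only [E₂.inner_sub_left, E₂.inner_sub_right, E₂.inner_act_right, E₂.inner_act_left]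
    change (E₂.inner (I _) (I _) - E₂.inner (I _) (I _) * _) -
      (_ * E₂.inner (I _) (I _) - _ * E₂.inner (I _) (I _) * _) = 0
    simp only [hII, E₁.inner_act_left, E₁.inner_act_right]
    simp
  · have := hI (Finsupp.single x 1)
    simpa [j, k] using this

/-- Creation operators extend from a total set. -/
theorem exists_creation {C : Type u} [NonUnitalCStarAlgebra C] {F : HilbertModule C}
    {E : HilbertModule D} (ρ : CStarRep C E) {X : Type*} (i : X → F)
    (hi : Dense (Submodule.span ℂ (Set.range i) : Set F)) (f : X → E →ₗ[ℂ] E)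
    (hf : ∀ x y ξ η, E.inner (f x ξ) (f y η) = E.inner ξ (ρ.toFun (F.inner (i x) (i y)) η)) :
    ∃ σ : F →L[ℂ] E →L[ℂ] E, (∀ x ξ, σ (i x) ξ = f x ξ) ∧
      ∀ x y ξ η, E.inner (σ x ξ) (σ y η) = E.inner ξ (ρ.toFun (F.inner x y) η) := by
  have hbd : ∀ (T : E → E) (x : F), (∀ ξ, E.inner (T ξ) (T ξ) =
      E.inner ξ (ρ.toFun (F.inner x x) ξ)) → ∀ ξ, ‖T ξ‖ ≤ ‖x‖ * ‖ξ‖ := fun T x h ξ => by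
    refine (sq_le_sq₀ (norm_nonneg _) (by positivity)).1 ?_
    rw [E.norm_sq_eq, h, mul_pow, F.norm_sq_eq]
    calc _ ≤ ‖ξ‖ * (‖F.inner x x‖ * ‖ξ‖) := (E.norm_inner_le _ _).trans (by
            gcongr; exact ρ.norm_apply_le _ _)
      _ = _ := by ring
  let fL : X → E →L[ℂ] E := fun x => (f x).mkContinuous ‖i x‖ (hbd (f x) (i x) fun ξ => hf x x ξ ξ)
  let j : (X →₀ ℂ) →ₗ[ℂ] F := Finsupp.linearCombination ℂ i
  let k : (X →₀ ℂ) →ₗ[ℂ] E →L[ℂ] E := Finsupp.linearCombination ℂ fL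
  have hj : DenseRange j := by
    rw [← Finsupp.range_linearCombination] at hi
    exact hi
  have hin : ∀ u v ξ η, E.inner (k u ξ) (k v η) = E.inner ξ (ρ.toFun (F.inner (j u) (j v)) η) :=
    fun u v ξ η => by
    simp only [j, k, Finsupp.linearCombination_apply, Finsupp.sum, F.inner_sum_left,
      F.inner_sum_right, F.inner_smul_left, F.inner_smul_right, map_sum, map_smul,
      sum_apply, smul_apply, E.inner_sum_left,
      E.inner_sum_right, E.inner_smul_left, E.inner_smul_right]
    simp only [fL, LinearMap.mkContinuous_apply, hf]
  have hn : ∀ u, ‖k u‖ ≤ 1 * ‖j u‖ := fun u => by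
    rw [one_mul]
    exact ContinuousLinearMap.opNorm_le_bound _ (norm_nonneg _)
      (hbd (k u) (j u) fun ξ => hin u u ξ ξ)
  let σ := k.extendOfNorm j
  have hσ : ∀ u, σ (j u) = k u := LinearMap.extendOfNorm_eq hj ⟨1, hn⟩
  refine ⟨σ, fun x ξ => ?_, fun x y ξ η => ?_⟩
  · have := congrArg (fun T => T ξ) (hσ (Finsupp.single x 1))
    simpa [j, k, fL] using this
  · refine hj.induction_on₂ (p := fun x y => E.inner (σ x ξ) (σ y η) =
      E.inner ξ (ρ.toFun (F.inner x y) η)) ?_ (fun u v => by rw [hσ, hσ, hin]) x y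
    refine isClosed_eq (E.continuous_inner (by fun_prop) (by fun_prop))
      (E.continuous_inner (by fun_prop) ?_)
    have : Continuous fun p : F × F => ρ.toCLM (F.inner p.1 p.2) η := by
      have := F.continuous_inner (f := fun p : F × F => p.1) (g := fun p => p.2)
        (by fun_prop) (by fun_prop)
      fun_prop
    exact this

/-- A representation that vanishes on the kernel of a surjection descends. -/
theorem CStarRep.exists_factor {B C : Type u} [NonUnitalCStarAlgebra B] [NonUnitalCStarAlgebra C]
    {E : HilbertModule D} (q : B →⋆ₙₐ[ℂ] C) (hq : Function.Surjective q) (ρ : CStarRep B E)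
    (hρ : ∀ b, q b = 0 → ρ.toFun b = 0) :
    ∃ ρ' : CStarRep C E, ∀ b, ρ'.toFun (q b) = ρ.toFun b := by
  have hkey : ∀ b c, q b = q c → ρ.toFun b = ρ.toFun c := fun b c h => by
    rw [← sub_eq_zero, ← map_sub]
    exact hρ _ (by rw [map_sub, h, sub_self])
  let f : C → E →L[ℂ] E := fun c => ρ.toFun (Function.surjInv hq c)
  have hf : ∀ b, f (q b) = ρ.toFun b := fun b => hkey _ _ (Function.surjInv_eq hq _)
  refine ⟨⟨⟨⟨f, fun c d => ?_⟩, fun z c => ?_⟩, fun c d x => ?_, fun c x y => ?_, ?_⟩, hf⟩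
  · obtain ⟨c, rfl⟩ := hq c
    obtain ⟨d, rfl⟩ := hq d
    rw [← map_add, hf, hf, hf, map_add]
  · obtain ⟨c, rfl⟩ := hq c
    change f (z • q c) = z • f (q c)
    rw [← map_smul, hf, hf, map_smul]
  · obtain ⟨c, rfl⟩ := hq c
    obtain ⟨d, rfl⟩ := hq d
    change f (q c * q d) x = f (q c) (f (q d) x)
    rw [← _root_.map_mul, hf, hf, hf, ρ.map_mul]
  · obtain ⟨c, rfl⟩ := hq c
    change E.inner (f (q c) x) y = E.inner x (f (star (q c)) y)
    rw [← map_star, hf, hf, ρ.adjoint]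
  · refine ρ.nondegenerate.mono (Submodule.span_mono ?_)
    rintro _ ⟨b, x, rfl⟩
    exact ⟨q b, x, by rw [← hf]; rfl⟩

/-- The composition of a representation with a surjective homomorphism. -/
def CStarRep.comp {B C : Type u} [NonUnitalCStarAlgebra B] [NonUnitalCStarAlgebra C]
    {E : HilbertModule D} (ρ : CStarRep C E) (q : B →⋆ₙₐ[ℂ] C) (hq : Function.Surjective q) :
    CStarRep B E where
  toFun :=
    { toFun := fun b => ρ.toFun (q b)
      map_add' := fun b c => by rw [map_add, map_add]
      map_smul' := fun z b => by rw [map_smul, map_smul]; rfl }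
  map_mul b c x := by
    change ρ.toFun (q (b * c)) x = ρ.toFun (q b) (ρ.toFun (q c) x)
    rw [_root_.map_mul, ρ.map_mul]
  adjoint b x y := by
    change E.inner (ρ.toFun (q b) x) y = E.inner x (ρ.toFun (q (star b)) y)
    rw [map_star, ρ.adjoint]
  nondegenerate := by
    refine ρ.nondegenerate.mono (Submodule.span_mono ?_)
    rintro _ ⟨c, x, rfl⟩
    obtain ⟨b, rfl⟩ := hq c
    exact ⟨b, x, rfl⟩

theorem IsPos.eq_zero_of_neg {d : D} (h : IsPos d) (h' : IsPos (-d)) : d = 0 := by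
  have := h.norm_le_norm (d := 0) (by rwa [zero_sub])
  rw [norm_zero] at this
  exact norm_le_zero_iff.1 this

theorem isPos_posPart (s : D) : IsPos s⁺ := by
  let _ := CStarAlgebra.spectralOrder D
  have _ := CStarAlgebra.spectralOrderedRing D
  exact isPos_iff_nonneg.2 (CFC.posPart_nonneg s)

theorem isPos_negPart (s : D) : IsPos s⁻ := by
  let _ := CStarAlgebra.spectralOrder D
  have _ := CStarAlgebra.spectralOrderedRing D
  exact isPos_iff_nonneg.2 (CFC.negPart_nonneg s)

/-- A representation kills the negative part of an element that it maps to a positive operator. -/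
theorem CStarRep.apply_negPart_eq_zero {B : Type u} [NonUnitalCStarAlgebra B]
    {E : HilbertModule D} (ρ : CStarRep B E) {s : B} (hs : IsSelfAdjoint s)
    (h : ∀ x, IsPos (E.inner x (ρ.toFun s x))) : ρ.toFun s⁻ = 0 := by
  obtain ⟨d, hd⟩ := isPos_negPart s
  have hsa : star (s⁻) = s⁻ := (isPos_negPart s).isSelfAdjoint
  have hmul : s * s⁻ = -(s⁻ * s⁻) := by
    nth_rw 1 [← CFC.posPart_sub_negPart s hs]
    rw [sub_mul, CFC.posPart_mul_negPart, zero_sub]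
  -- Let `s⁻ = d* d`. Positivity of `ρ(s)` on the vector `ρ(s⁻)y`, with `s s⁻ = -(s⁻)²`, says that
  -- `-⟨y, ρ((s⁻)³)y⟩` is positive; but `(s⁻)³ = (d s⁻)* (d s⁻)`. It follows that `ρ((s⁻)²) = ρ(d*)
  -- ρ(d s⁻) = 0`.
  have h0 : ∀ y, ρ.toFun (d * s⁻) y = 0 := fun y => by
    apply E.inner_self_eq_zero
    refine IsPos.eq_zero_of_neg (E.inner_self_pos _) ?_
    have := h (ρ.toFun s⁻ y)
    rw [← ρ.map_mul, hmul, map_neg, neg_apply, E.inner_neg_right, ρ.inner_apply_apply,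
      hsa] at this
    rw [ρ.inner_apply_apply, star_mul, hsa, mul_assoc, ← mul_assoc (star d), ← hd]
    exact this
  ext y
  apply E.inner_self_eq_zero
  rw [ρ.inner_apply_apply, hsa]
  nth_rw 1 [hd]
  rw [mul_assoc, ρ.map_mul, h0, map_zero, E.inner_zero_right]

end Extension

/-! ### Closed ideals and the representations that annihilate them. -/

section ClosedIdeal

variable {B : Type u} [NonUnitalCStarAlgebra B] (S : Set B)

theorem isClosed_closedIdeal : IsClosed (closedIdeal S : Set B) := by
  rw [closedIdeal, Submodule.coe_sInf]
  exact isClosed_biInter fun I hI => hI.1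

theorem closedIdeal_mul_mem (b : B) (x : B) (hx : x ∈ closedIdeal S) :
    b * x ∈ closedIdeal S ∧ x * b ∈ closedIdeal S := by
  have hx := Submodule.mem_sInf.1 hx
  exact ⟨Submodule.mem_sInf.2 fun I hI => (hI.2.1 b x (hx I hI)).1,
    Submodule.mem_sInf.2 fun I hI => (hI.2.1 b x (hx I hI)).2⟩

theorem subset_closedIdeal : S ⊆ closedIdeal S := fun _ hx =>
  Submodule.mem_sInf.2 fun _ hI => hI.2.2 hx

variable {S} in
/-- A representation that kills `S` kills the closed ideal generated by `S`. -/
theorem CStarRep.apply_eq_zero_of_mem_closedIdeal {D : Type u} [NonUnitalCStarAlgebra D]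
    {E : HilbertModule D} (ρ : CStarRep B E) (hS : ∀ x ∈ S, ρ.toFun x = 0) {x : B}
    (hx : x ∈ closedIdeal S) : ρ.toFun x = 0 := by
  refine Submodule.mem_sInf.1 hx (LinearMap.ker ρ.toFun) ⟨?_, fun b x hx => ?_, hS⟩
  · have : (LinearMap.ker ρ.toFun : Set B) = ρ.toCLM ⁻¹' {0} := by
      ext b; simp [CStarRep.toCLM_apply]
    rw [this]
    exact isClosed_singleton.preimage ρ.toCLM.continuous
  · rw [LinearMap.mem_ker] at hx
    constructor <;> rw [LinearMap.mem_ker] <;> ext y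
    · rw [ρ.map_mul, hx]; simp
    · rw [ρ.map_mul, hx]; simp

end ClosedIdeal

/-! ## Existence of the fibres -/

section Fibres

variable {G : Type u} [Group G] {A : Type u} [Ring A] [Algebra ℂ A] [StarRing A] [StarModule ℂ A]
  {𝒜 : StarGrading G A} {𝓘 : RepClass 𝒜.unitFibre} {Be : Type u} [NonUnitalCStarAlgebra Be]

namespace CStarHull

variable (H : CStarHull 𝓘 Be)

/-- The sum `∑ b_k* μ(a_k* a_l) b_l`. -/
def gram {g : G} {n : ℕ} (a : Fin n → 𝒜.fibre g) (b : Fin n → H.univ.dom) : Be :=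
  ∑ k, ∑ l, star (H.val (b k)) * H.val (H.univ.toFun (𝒜.starMul (a k) (a l)) (b l))

theorem star_kernel {g : G} (a a' : 𝒜.fibre g) (b b' : H.univ.dom) :
    star (star (H.val b) * H.val (H.univ.toFun (𝒜.starMul a a') b')) =
      star (H.val b') * H.val (H.univ.toFun (𝒜.starMul a' a) b) := by
  rw [star_mul, star_star, H.univ_adjoint, 𝒜.starMul_star]

theorem isSelfAdjoint_gram {g : G} {n : ℕ} (a : Fin n → 𝒜.fibre g) (b : Fin n → H.univ.dom) :
    IsSelfAdjoint (H.gram a b) := by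
  rw [IsSelfAdjoint, gram]
  simp only [star_sum, H.star_kernel]
  exact Finset.sum_comm

theorem negPart_gram_mem {g : G} {n : ℕ} (a : Fin n → 𝒜.fibre g) (b : Fin n → H.univ.dom) :
    (H.gram a b)⁻ ∈ closedIdeal (negativeParts H) :=
  subset_closedIdeal _ ⟨g, n, a, b, rfl⟩

/-- Once the negative part is killed, only the image of the positive part remains. This is what the
ideal is made for. -/
theorem isPos_map_gram {C : Type u} [NonUnitalCStarAlgebra C] (q : Be →⋆ₙₐ[ℂ] C)
    (hq : ∀ x ∈ closedIdeal (negativeParts H), q x = 0) {g : G} {n : ℕ}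
    (a : Fin n → 𝒜.fibre g) (b : Fin n → H.univ.dom) : IsPos (q (H.gram a b)) := by
  rw [← CFC.posPart_sub_negPart _ (H.isSelfAdjoint_gram a b), map_sub,
    hq _ (H.negPart_gram_mem a b), sub_zero]
  exact (isPos_posPart _).map q

end CStarHull

/-- The prescribed inner product is a positive definite kernel on pairs `(a, b)` by
`isPos_map_gram`. Bilinearity in the pair then holds because inner products with the generators
separate points. -/
theorem exists_fibre (H : CStarHull 𝓘 Be) {C : Type u} [NonUnitalCStarAlgebra C]
    (q : Be →⋆ₙₐ[ℂ] C) (hqs : Function.Surjective q)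
    (hq : ∀ x ∈ closedIdeal (negativeParts H), q x = 0) (g : G) :
    ∃ (F : HilbertModule C) (ι : 𝒜.fibre g →ₗ[ℂ] H.univ.dom →ₗ[ℂ] F),
      (∀ (a : 𝒜.fibre g) (b : H.univ.dom) (c : Be),
        ι a ⟨H.val b * c, H.univ.act_mem b b.2 c⟩ = F.act (ι a b) (q c)) ∧
      (∀ (a₁ a₂ : 𝒜.fibre g) (b₁ b₂ : H.univ.dom), F.inner (ι a₁ b₁) (ι a₂ b₂) =
        q (star (H.val b₁) * H.val (H.univ.toFun (𝒜.starMul a₁ a₂) b₂))) ∧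
      Dense (Submodule.span ℂ {x : F | ∃ a b, x = ι a b} : Set F) := by
  let k : 𝒜.fibre g × H.univ.dom → 𝒜.fibre g × H.univ.dom → C := fun x y =>
    q (star (H.val x.2) * H.val (H.univ.toFun (𝒜.starMul x.1 y.1) y.2))
  have hk : ∀ x y, k x y = q (star (H.val x.2) *
    H.val (H.univ.toFun (𝒜.starMul x.1 y.1) y.2)) := fun _ _ => rfl
  have hkact : ∀ x y c, k x (y.1, H.domMul y.2 c) = k x y * q c := fun x y c => by
    rw [hk, hk, H.univ_domMul, ← mul_assoc, map_mul]
  obtain ⟨F, i, hi, hia, hid⟩ := exists_hilbertModule_of_kernel k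
    (fun x y => by rw [hk, hk, ← map_star, H.star_kernel])
    (fun z y => ⟨(y.1, z • y.2), fun x => by
      rw [hk, hk, map_smul, H.val_smul, mul_smul_comm, map_smul]⟩)
    (fun n x => by
      have := H.isPos_map_gram q hq (fun i => (x i).1) (fun i => (x i).2)
      rw [CStarHull.gram, map_sum] at this
      simp only [map_sum] at this
      exact this)
    -- Any preimage of `d` will do, as the kernel depends only on its image under `q`.
    (fun x d => (x.1, H.domMul x.2 (Function.surjInv hqs d)))
    (fun x y d => by rw [hkact, Function.surjInv_eq hqs])
  have hext : ∀ {x y : F}, (∀ z, F.inner (i z) x = F.inner (i z) y) → x = y := fun h => by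
    refine HilbertModule.ext_of_dense hid ?_
    rintro _ ⟨z, rfl⟩
    exact h z
  have hadd : ∀ a a₁ a₂ : 𝒜.fibre g,
      𝒜.starMul a (a₁ + a₂) = 𝒜.starMul a a₁ + 𝒜.starMul a a₂ := fun a a₁ a₂ =>
    Subtype.ext (mul_add _ _ _)
  have hsm : ∀ (z : ℂ) (a a₁ : 𝒜.fibre g), 𝒜.starMul a (z • a₁) = z • 𝒜.starMul a a₁ :=
    fun z a a₁ => Subtype.ext (mul_smul_comm _ _ _)
  let ι : 𝒜.fibre g →ₗ[ℂ] H.univ.dom →ₗ[ℂ] F := LinearMap.mk₂ ℂ (fun a b => i (a, b))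
    (fun a₁ a₂ b => hext fun z => by
      rw [F.inner_add_right, hi, hi, hi, hk, hk, hk, hadd, map_add, LinearMap.add_apply,
        H.val_add, mul_add, map_add])
    (fun c a b => hext fun z => by
      rw [F.inner_smul_right, hi, hi, hk, hk, hsm, map_smul, LinearMap.smul_apply, H.val_smul,
        mul_smul_comm, map_smul])
    (fun a b₁ b₂ => hext fun z => by
      rw [F.inner_add_right, hi, hi, hi, hk, hk, hk, map_add, H.val_add, mul_add, map_add])
    (fun c a b => hext fun z => by
      rw [F.inner_smul_right, hi, hi, hk, hk, map_smul, H.val_smul, mul_smul_comm, map_smul])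
  refine ⟨F, ι, fun a b c => hext fun z => ?_, fun a₁ a₂ b₁ b₂ => hi _ _, ?_⟩
  · rw [F.inner_act_right]
    exact (hi _ _).trans ((hkact z (a, b) c).trans (by rw [← hi]; rfl))
  · refine hid.mono (Submodule.span_mono ?_)
    rintro _ ⟨⟨a, b⟩, rfl⟩
    exact ⟨a, b, rfl⟩

theorem nonempty_plusFibres (H : CStarHull 𝓘 Be) : Nonempty (PlusFibres H) := by
  obtain ⟨C, _, q, hqs, hq⟩ := exists_quotient_algebra (closedIdeal (negativeParts H))
    (isClosed_closedIdeal _) (closedIdeal_mul_mem _)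
  choose F ι h1 h2 h3 using exists_fibre H q hqs (fun x hx => (hq x).2 hx)
  exact ⟨⟨C, q, hqs, hq, F, ι, h1, h2, h3⟩⟩

/-! ## Operators induced by integrable representations -/

/-- The operators on the fibres `B_g⁺` that are induced by an integrable representation of `A`. -/
structure FibreRep {H : CStarHull 𝓘 Be} (𝓑 : PlusFibres H) {D : Type u} [NonUnitalCStarAlgebra D]
    {E : HilbertModule D} (π : Rep A E) where
  /-- the representation of `B_e` that corresponds to the restriction of `π` -/
  rep : CStarRep Be E
  Φ_rep : H.Φ rep = π.restrict 𝒜.unitFibre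
  /-- the induced representation of `B_e⁺` -/
  plus : CStarRep 𝓑.unit E
  plus_q : ∀ b, plus.toFun (𝓑.q b) = rep.toFun b
  /-- the operators induced by elements of `B_g⁺` -/
  op : ∀ g, 𝓑.fibre g →L[ℂ] (E →L[ℂ] E)
  mem_dom : ∀ (b : H.univ.dom) x, rep.toFun (H.val b) x ∈ π.dom
  op_ι : ∀ g (a : 𝒜.fibre g) (b : H.univ.dom) x,
    op g (𝓑.ι g a b) x = π.toFun a ⟨rep.toFun (H.val b) x, mem_dom b x⟩
  inner_op : ∀ g (x y : 𝓑.fibre g) ξ η,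
    E.inner (op g x ξ) (op g y η) = E.inner ξ (plus.toFun ((𝓑.fibre g).inner x y) η)

variable {H : CStarHull 𝓘 Be} {D : Type u} [NonUnitalCStarAlgebra D] {E : HilbertModule D}

theorem apply_unitFibre_rep {π : Rep A E} {ρ : CStarRep Be E}
    (h : H.Φ ρ = π.restrict 𝒜.unitFibre) (b : H.univ.dom) (x : E) :
    ∃ hd : ρ.toFun (H.val b) x ∈ π.dom, ∀ a : 𝒜.unitFibre,
      (π.toFun a ⟨ρ.toFun (H.val b) x, hd⟩ : E) = ρ.toFun (H.val (H.univ.toFun a b)) x := by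
  -- The restriction is replaced by a variable, so that the equation can be substituted despite the
  -- dependence on the domain.
  have h1 : ∀ π' : Rep 𝒜.unitFibre E, H.Φ ρ = π' → ∃ hd : ρ.toFun (H.val b) x ∈ π'.dom,
      ∀ a : 𝒜.unitFibre,
      (π'.toFun a ⟨ρ.toFun (H.val b) x, hd⟩ : E) = ρ.toFun (H.val (H.univ.toFun a b)) x := by
    rintro _ rfl
    exact ⟨H.apply_mem_dom ρ b x, fun a => H.Φ_apply ρ a b x _⟩
  exact h1 _ h

/-- After moving `π(a)` to the other side only `a* a' ∈ A_e` acts, and its action on `ρ(b')x'` is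
known from the hull. -/
theorem inner_apply_rep {π : Rep A E} {ρ : CStarRep Be E}
    (h : H.Φ ρ = π.restrict 𝒜.unitFibre) {g : G} (a a' : 𝒜.fibre g) (b b' : H.univ.dom) (x x' : E)
    (hd : ρ.toFun (H.val b) x ∈ π.dom) (hd' : ρ.toFun (H.val b') x' ∈ π.dom) :
    E.inner (π.toFun a ⟨_, hd⟩) (π.toFun a' ⟨_, hd'⟩) =
      E.inner x (ρ.toFun (star (H.val b) * H.val (H.univ.toFun (𝒜.starMul a a') b')) x') := by
  rw [π.inner_apply_apply]
  obtain ⟨_, ha⟩ := apply_unitFibre_rep h b' x'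
  rw [← ρ.inner_apply_apply, ← ha (𝒜.starMul a a')]
  rfl

/-- `⟨x, ρ(∑ b_k* μ_e(a_k* a_l) b_l)x⟩` is the inner square of `∑ π(a_k)ρ(b_k)x`. Hence `ρ`
annihilates the negative parts and factors through `B_e⁺`. The same formula says that `a ⊗ b ↦
π(a)ρ(b)` respects inner products, so it extends as a creation operator. -/
theorem exists_fibreRep (𝓑 : PlusFibres H) {π : Rep A E} (hπ : (𝓘.extend 𝒜).Mem π) :
    Nonempty (FibreRep 𝓑 π) := by
  obtain ⟨ρ, hρ⟩ := H.exists_Φ_eq hπ.2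
  have hmem : ∀ (b : H.univ.dom) x, ρ.toFun (H.val b) x ∈ π.dom := fun b x =>
    (apply_unitFibre_rep hρ b x).1
  have hkill : ∀ s ∈ negativeParts H, ρ.toFun s = 0 := by
    rintro _ ⟨g, n, a, b, rfl⟩
    refine ρ.apply_negPart_eq_zero (H.isSelfAdjoint_gram a b) fun x => ?_
    have : E.inner x (ρ.toFun (H.gram a b) x) =
        E.inner (∑ k, π.toFun (a k) ⟨_, hmem (b k) x⟩ : E)
          (∑ k, π.toFun (a k) ⟨_, hmem (b k) x⟩ : E) := by
      simp only [CStarHull.gram, map_sum, sum_apply, E.inner_sum_right, E.inner_sum_left,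
        inner_apply_rep hρ]
      exact Finset.sum_comm
    exact this ▸ E.inner_self_pos _
  obtain ⟨ρ', hρ'⟩ := ρ.exists_factor 𝓑.q 𝓑.q_surjective fun b hb =>
    ρ.apply_eq_zero_of_mem_closedIdeal hkill ((𝓑.q_eq_zero_iff b).1 hb)
  have key : ∀ g, ∃ σ : 𝓑.fibre g →L[ℂ] E →L[ℂ] E,
      (∀ (p : 𝒜.fibre g × H.univ.dom) ξ, σ (𝓑.ι g p.1 p.2) ξ = π.toFun p.1 ⟨_, hmem p.2 ξ⟩) ∧
      ∀ x y ξ η, E.inner (σ x ξ) (σ y η) =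
        E.inner ξ (ρ'.toFun ((𝓑.fibre g).inner x y) η) := fun g =>
    exists_creation ρ' (fun p : 𝒜.fibre g × H.univ.dom => 𝓑.ι g p.1 p.2)
      ((𝓑.ι_dense g).mono (Submodule.span_mono (by
        rintro _ ⟨a, b, rfl⟩
        exact ⟨(a, b), rfl⟩)))
      (fun p =>
        { toFun := fun ξ => π.toFun p.1 ⟨_, hmem p.2 ξ⟩
          map_add' := fun ξ η => by
            rw [← Submodule.coe_add, ← map_add]
            congr 3
            exact map_add _ _ _
          map_smul' := fun z ξ => by
            rw [RingHom.id_apply, ← Submodule.coe_smul, ← map_smul]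
            congr 3
            exact map_smul _ _ _ })
      (fun p p' ξ η => by
        rw [𝓑.ι_inner, hρ']
        exact inner_apply_rep hρ _ _ _ _ _ _ _ _)
  choose σ h1 h2 using key
  exact ⟨⟨ρ, hρ, ρ', hρ', σ, hmem, fun g a b x => h1 g (a, b) x, h2⟩⟩

end Fibres

end

section

open Filter Topology

/-! ## Induced representations -/

section GraphDense

variable {A : Type u} [Ring A] [Algebra ℂ A] [StarRing A] [StarModule ℂ A]
  {D : Type u} [NonUnitalCStarAlgebra D] {E : HilbertModule D}

/-- To check that a subspace is dense in the graph topology, it suffices to approximate vectors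
in a set whose span is dense. -/
theorem Rep.GraphDense.trans_span {π : Rep A E} {S : Set E}
    (h : π.GraphDense (Submodule.span ℂ S)) (hS : S ⊆ π.dom) (X : Submodule ℂ E)
    (hX : ∀ x (hx : x ∈ S), ∃ (l : Filter π.dom), l.NeBot ∧ (∀ᶠ z : π.dom in l, (z : E) ∈ X) ∧
      ∀ a, Tendsto (fun z : π.dom => (π.toFun a z : E)) l (𝓝 (π.toFun a ⟨x, hS hx⟩ : E))) :
    π.GraphDense X := by
  let L : π.dom →ₗ[ℂ] (A → E) :=
    { toFun := π.graph, map_add' := fun x y => funext fun a => by simp [graph]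
      map_smul' := fun z x => funext fun a => by simp [graph] }
  let C : Submodule ℂ (A → E) := ((X.comap π.dom.subtype).map L).topologicalClosure
  have hC : (C : Set (A → E)) = closure (π.graph '' {z | (z : E) ∈ X}) := rfl
  have hle : Submodule.span ℂ S ≤ (C.comap L).map π.dom.subtype := by
    rw [Submodule.span_le]
    intro x hx
    refine ⟨⟨x, hS hx⟩, ?_, rfl⟩
    obtain ⟨l, _, h1, h2⟩ := hX x hx
    change π.graph _ ∈ (C : Set (A → E))
    rw [hC]
    refine mem_closure_of_tendsto (f := π.graph) (b := l) (tendsto_pi_nhds.2 h2) ?_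
    filter_upwards [h1] with z hz
    exact ⟨z, hz, rfl⟩
  refine h.trans fun z hz => ?_
  obtain ⟨y, hy, hyz⟩ := hle hz
  have : y = z := Subtype.ext hyz
  subst this
  exact hy

end GraphDense

section Graded

variable {G : Type u} [Group G] {A : Type u} [Ring A] [Algebra ℂ A] [StarRing A] [StarModule ℂ A]
  {𝒜 : StarGrading G A} {D : Type u} [NonUnitalCStarAlgebra D]

/-- Products `a_g* b_h` with `g ≠ h` have no component in degree 1. -/
theorem StarGrading.unitProj_star_mul_eq_sum {s : Finset G} {a b : A}
    (ha : ∑ g ∈ s, (𝒜.proj g a : A) = a) (hb : ∑ g ∈ s, (𝒜.proj g b : A) = b) :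
    𝒜.unitProj (star a * b) = ∑ g ∈ s, 𝒜.starMul (𝒜.proj g a) (𝒜.proj g b) := by
  nth_rw 1 [← ha, ← hb]
  rw [star_sum, Finset.sum_mul_sum, map_sum]
  refine Finset.sum_congr rfl fun g hg => ?_
  rw [map_sum, Finset.sum_eq_single g (fun h _ hh => 𝒜.unitProj_star_mul_of_ne hh.symm _ _)
    (fun h => absurd hg h), unitProj_star_mul]

theorem StarGrading.exists_common_support {n : ℕ} (a : Fin n → A) :
    ∃ s : Finset G, ∀ i, ∑ g ∈ s, (𝒜.proj g (a i) : A) = a i := by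
  classical
  choose s hs using fun i => 𝒜.exists_support (a i)
  exact ⟨Finset.univ.biUnion s, fun i => (hs i).2 _ (Finset.subset_biUnion_of_mem s (by simp))⟩

/-- The Gram sum of arbitrary elements splits into Gram sums of homogeneous components, one for each
degree, and inducibility covers each of these. -/
theorem IsInducible.isPos {F : HilbertModule D} {φ : Rep 𝒜.unitFibre F} (h : IsInducible 𝒜 φ)
    {n : ℕ} (a : Fin n → A) (ξ : Fin n → φ.dom) :
    IsPos (∑ k, ∑ l, F.inner (ξ k) (φ.toFun (𝒜.unitProj (star (a k) * a l)) (ξ l))) := by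
  obtain ⟨s, hs⟩ := StarGrading.exists_common_support (𝒜 := 𝒜) a
  have : ∑ k, ∑ l, F.inner (ξ k) (φ.toFun (𝒜.unitProj (star (a k) * a l)) (ξ l)) =
      ∑ g ∈ s, ∑ k, ∑ l, F.inner (ξ k)
        (φ.toFun (𝒜.starMul (𝒜.proj g (a k)) (𝒜.proj g (a l))) (ξ l)) := by
    have e : ∀ k l, F.inner (ξ k) (φ.toFun (𝒜.unitProj (star (a k) * a l)) (ξ l)) =
        ∑ g ∈ s, F.inner (ξ k)
          (φ.toFun (𝒜.starMul (𝒜.proj g (a k)) (𝒜.proj g (a l))) (ξ l)) := fun k l => by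
      rw [StarGrading.unitProj_star_mul_eq_sum (hs k) (hs l), map_sum, LinearMap.sum_apply,
        Submodule.coe_sum, F.inner_sum_right]
    simp only [e]
    exact (Finset.sum_congr rfl fun k _ => Finset.sum_comm).trans Finset.sum_comm
  rw [this]
  exact IsPos.sum _ fun g _ => h g n _ ξ

/-- Inducible representations can be induced. -/
theorem IsInducible.exists_isInduced {F : HilbertModule D} {φ : Rep 𝒜.unitFibre F}
    (h : IsInducible 𝒜 φ) :
    ∃ (T : HilbertModule D) (ι : A →ₗ[ℂ] φ.dom →ₗ[ℂ] T) (π : Rep A T), IsInduced 𝒜 φ T ι π ∧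
      ∀ a b ξ η, T.inner (ι a ξ) (ι b η) = F.inner ξ (φ.toFun (𝒜.unitProj (star a * b)) η) := by
  -- The projection of `a* b` to `A_e` encodes both the inner product inside a fibre and the
  -- orthogonality of different fibres.
  let k : A × φ.dom → A × φ.dom → D := fun x y =>
    F.inner x.2 (φ.toFun (𝒜.unitProj (star x.1 * y.1)) y.2)
  have hk : ∀ x y, k x y = F.inner x.2 (φ.toFun (𝒜.unitProj (star x.1 * y.1)) y.2) :=
    fun _ _ => rfl
  obtain ⟨T, i, hi, hia, hid⟩ := exists_hilbertModule_of_kernel k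
    (fun x y => by
      rw [hk, hk, F.star_inner, φ.adjoint, ← 𝒜.unitProj_star, star_mul, star_star])
    (fun z y => ⟨(y.1, z • y.2), fun x => by
      rw [hk, hk, map_smul, Submodule.coe_smul, F.inner_smul_right]⟩)
    (fun n x => h.isPos (fun i => (x i).1) (fun i => (x i).2))
    (fun x d => (x.1, ⟨F.act x.2 d, φ.act_mem _ x.2.2 d⟩))
    (fun x y d => by rw [hk, hk, φ.map_act, F.inner_act_right])
  have hext : ∀ {x y : T}, (∀ z, T.inner (i z) x = T.inner (i z) y) → x = y := fun h => by
    refine HilbertModule.ext_of_dense hid ?_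
    rintro _ ⟨z, rfl⟩
    exact h z
  let ι : A →ₗ[ℂ] φ.dom →ₗ[ℂ] T := LinearMap.mk₂ ℂ (fun a b => i (a, b))
    (fun a₁ a₂ b => hext fun z => by
      rw [T.inner_add_right, hi, hi, hi, hk, hk, hk, mul_add, map_add, map_add,
        LinearMap.add_apply, Submodule.coe_add, F.inner_add_right])
    (fun c a b => hext fun z => by
      rw [T.inner_smul_right, hi, hi, hk, hk, mul_smul_comm, map_smul, map_smul,
        LinearMap.smul_apply, Submodule.coe_smul, F.inner_smul_right])
    (fun a b₁ b₂ => hext fun z => by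
      rw [T.inner_add_right, hi, hi, hi, hk, hk, hk, map_add, Submodule.coe_add,
        F.inner_add_right])
    (fun c a b => hext fun z => by
      rw [T.inner_smul_right, hi, hi, hk, hk, map_smul, Submodule.coe_smul, F.inner_smul_right])
  have hι : ∀ a ξ, i (a, ξ) = ι a ξ := fun _ _ => rfl
  have hin : ∀ a b ξ η, T.inner (ι a ξ) (ι b η) =
      F.inner ξ (φ.toFun (𝒜.unitProj (star a * b)) η) := fun a b ξ η => hi _ _
  have hact : ∀ a (ξ : φ.dom) d, ι a ⟨F.act ξ d, φ.act_mem ξ ξ.2 d⟩ = T.act (ι a ξ) d :=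
    fun a ξ d => hia (a, ξ) d
  have hS : {t : T | ∃ a ξ, t = ι a ξ} = Set.range fun p : A × φ.dom => ι (1 * p.1) p.2 := by
    ext t
    constructor
    · rintro ⟨a, ξ, rfl⟩
      exact ⟨(a, ξ), by simp only [one_mul]⟩
    · rintro ⟨p, rfl⟩
      exact ⟨_, _, rfl⟩
  have hdense : Dense (Submodule.span ℂ {t : T | ∃ a ξ, t = ι a ξ} : Set T) := by
    refine hid.mono (Submodule.span_mono ?_)
    rintro _ ⟨p, rfl⟩
    exact ⟨p.1, p.2, rfl⟩
  obtain ⟨π, hcl, hcore, hπ⟩ := exists_closed_rep (fun a (p : A × φ.dom) => ι (a * p.1) p.2)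
    (fun a b p => by rw [add_mul, map_add, LinearMap.add_apply])
    (fun z a p => by rw [smul_mul_assoc, map_smul, LinearMap.smul_apply])
    (fun a b p p' => by rw [hin, hin, star_mul, one_mul, mul_assoc, mul_assoc])
    (fun a p => ⟨(a * p.1, p.2), fun c => by rw [mul_assoc]⟩)
    (fun p d => ⟨(p.1, ⟨F.act p.2 d, φ.act_mem _ p.2.2 d⟩), fun a => hact _ _ _⟩)
    (by rw [← hS]; exact hdense)
  refine ⟨T, ι, π, ⟨hact, fun g a b ξ η => ?_, fun g h hgh a b ξ η => ?_, hdense, hcl, ?_, ?_⟩, hin⟩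
  · rw [hin, 𝒜.unitProj_star_mul]
  · rw [hin, 𝒜.unitProj_star_mul_of_ne hgh, map_zero, LinearMap.zero_apply, Submodule.coe_zero,
      F.inner_zero_right]
  · rw [hS]
    exact hcore
  · intro a b ξ hd
    obtain ⟨hd', ha⟩ := hπ (b, ξ)
    rw [← ha a]
    congr 3
    simp only [one_mul]

end Graded

/-! ### The representation of `A_e` on `B_e⁺` and the regular representation induced from it. -/

section Fibres

variable {G : Type u} [Group G] {A : Type u} [Ring A] [Algebra ℂ A] [StarRing A] [StarModule ℂ A]
  {𝒜 : StarGrading G A} {𝓘 : RepClass 𝒜.unitFibre} {Be : Type u} [NonUnitalCStarAlgebra Be]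
  {H : CStarHull 𝓘 Be}

theorem tendsto_mul_approximateUnit (B : Type u) [NonUnitalCStarAlgebra B] :
    ∃ l : Filter B, l.NeBot ∧ ∀ b : B, Tendsto (fun e => b * e) l (𝓝 b) := by
  let _ := CStarAlgebra.spectralOrder B
  have _ := CStarAlgebra.spectralOrderedRing B
  have h := CStarAlgebra.increasingApproximateUnit B
  exact ⟨_, h.neBot, fun b => h.tendsto_mul_left b⟩

namespace PlusFibres

variable (𝓑 : PlusFibres H)

/-- The representation of `B_e` on `B_e⁺` through the quotient map. -/
def quotRep : CStarRep Be (HilbertModule.self 𝓑.unit) :=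
  (CStarRep.idRep 𝓑.unit).comp 𝓑.q 𝓑.q_surjective

/-- The class of an element in the domain of the universal representation. -/
def qDom : H.univ.dom →ₗ[ℂ] 𝓑.unit where
  toFun b := 𝓑.q (H.val b)
  map_add' b c := by rw [H.val_add, map_add]
  map_smul' z b := by rw [H.val_smul, map_smul]; rfl

theorem qDom_apply (b : H.univ.dom) : 𝓑.qDom b = 𝓑.q (H.val b) := rfl

/-- The hull places the vectors `q(b)q(e)` in the domain. Along an approximate unit they converge to
`q(b)` in the graph topology, and the representation is closed. -/
theorem qDom_mem_orbit (b : H.univ.dom) :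
    (fun a => 𝓑.qDom (H.univ.toFun a b)) ∈ (H.Φ 𝓑.quotRep).orbit := by
  obtain ⟨l, _, hl⟩ := tendsto_mul_approximateUnit Be
  have hq : Continuous 𝓑.q := 
    (AddMonoidHomClass.continuous_of_bound 𝓑.q 1 fun x => by
      rw [one_mul]; exact NonUnitalStarAlgHom.norm_apply_le 𝓑.q x)
  refine (H.isClosed_Φ 𝓑.quotRep).mem_orbit_of_tendsto (l := l)
    (z := fun e a => 𝓑.qDom (H.univ.toFun a b) * 𝓑.q e) (Eventually.of_forall fun e => ?_)
    fun a => ?_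
  · refine (Rep.mem_orbit_iff_of_eq (y := 𝓑.quotRep.toFun (H.val b) (𝓑.q e)) ?_).2
      ⟨H.apply_mem_dom _ _ _, fun a => H.Φ_apply _ _ _ _ _⟩
    simp only [map_one, Module.End.one_apply]
    rfl
  · refine ((hq.tendsto _).comp (hl (H.val (H.univ.toFun a b)))).congr fun e => ?_
    exact map_mul 𝓑.q _ _

theorem qDom_mem_dom (b : H.univ.dom) : 𝓑.qDom b ∈ (H.Φ 𝓑.quotRep).dom := by
  obtain ⟨h, -⟩ := (Rep.mem_orbit_iff_of_eq (y := 𝓑.qDom b) (by simp)).1 (𝓑.qDom_mem_orbit b)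
  exact h

theorem Φ_quotRep_apply (a : 𝒜.unitFibre) (b : H.univ.dom) :
    ((H.Φ 𝓑.quotRep).toFun a ⟨𝓑.qDom b, 𝓑.qDom_mem_dom b⟩ : 𝓑.unit) =
      𝓑.qDom (H.univ.toFun a b) := by
  obtain ⟨h, ha⟩ := (Rep.mem_orbit_iff_of_eq (y := 𝓑.qDom b) (by simp)).1 (𝓑.qDom_mem_orbit b)
  exact ha a

/-- The vectors `q(b)x` span a core; as `q` is surjective, each is of the form `q(b c)`, and `b c`
is again in the domain of `μ_e`. -/
theorem graphDense_qDom :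
    (H.Φ 𝓑.quotRep).GraphDense (LinearMap.range 𝓑.qDom : Submodule ℂ 𝓑.unit) := by
  refine (H.graphDense_Φ 𝓑.quotRep).mono ?_
  rw [SetLike.coe_subset_coe, Submodule.span_le]
  rintro _ ⟨b, x, rfl⟩
  obtain ⟨c, rfl⟩ := 𝓑.q_surjective x
  exact ⟨H.domMul b c, by rw [qDom_apply, H.val_domMul, map_mul]; rfl⟩

/-- On vectors `q(b)` this is positivity of the Gram sums in `B_e⁺`. It extends to the whole domain
by approximation in the graph topology, because the positive cone is closed. -/
theorem isInducible_quotRep : IsInducible 𝒜 (H.Φ 𝓑.quotRep) := by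
  intro g n a ξ
  choose l hl hlS hlt using fun k => 𝓑.graphDense_qDom.exists_tendsto (ξ k)
  change _ ∈ {d : 𝓑.unit | IsPos d}
  refine isClosed_isPos.mem_of_tendsto (α := Fin n → (H.Φ 𝓑.quotRep).dom) (b := Filter.pi l)
    (f := fun z => ∑ k, ∑ l, (HilbertModule.self 𝓑.unit).inner (z k)
      ((H.Φ 𝓑.quotRep).toFun (𝒜.starMul (a k) (a l)) (z l))) ?_ ?_
  · refine tendsto_finsetSum _ fun k _ => tendsto_finsetSum _ fun m _ => ?_
    refine HilbertModule.tendsto_inner _ ?_ ?_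
    · have := hlt k 1
      simp only [map_one, Module.End.one_apply] at this
      exact this.comp (tendsto_eval_pi l k)
    · exact (hlt m _).comp (tendsto_eval_pi l m)
  · have : ∀ᶠ z in Filter.pi l, ∀ k, (z k : 𝓑.unit) ∈ LinearMap.range 𝓑.qDom :=
      eventually_all.2 fun k => (tendsto_eval_pi l k).eventually (hlS k)
    filter_upwards [this] with z hz
    choose b hb using hz
    have hpos := H.isPos_map_gram 𝓑.q (fun x hx => (𝓑.q_eq_zero_iff x).2 hx) a b
    have hzb : ∀ k, z k = ⟨𝓑.qDom (b k), 𝓑.qDom_mem_dom (b k)⟩ := fun k =>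
      Subtype.ext (hb k).symm
    simp only [CStarHull.gram, map_sum, map_mul, map_star] at hpos
    refine Eq.mpr (congrArg IsPos ?_) hpos
    refine Finset.sum_congr rfl fun k _ => Finset.sum_congr rfl fun m _ => ?_
    rw [hzb k, hzb m]
    exact congrArg (fun x => star (𝓑.qDom (b k)) * x) (𝓑.Φ_quotRep_apply _ _)

end PlusFibres

/-- The regular representation of `A`, which is induced from the representation of `A_e` on
`B_e⁺`. Here `ι a b` is the class of `a ⊗ q b`. -/
structure RegularRep (𝓑 : PlusFibres H) where
  T : HilbertModule 𝓑.unit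
  ι : A →ₗ[ℂ] H.univ.dom →ₗ[ℂ] T
  π : Rep A T
  mem : (𝓘.extend 𝒜).Mem π
  inner_ι : ∀ a a' b b', T.inner (ι a b) (ι a' b') =
    𝓑.q (star (H.val b) * H.val (H.univ.toFun (𝒜.unitProj (star a * a')) b'))
  mem_dom : ∀ a b, ι a b ∈ π.dom
  π_ι : ∀ a c b, (π.toFun a ⟨ι c b, mem_dom c b⟩ : T) = ι (a * c) b
  graphDense : π.GraphDense (Submodule.span ℂ {t | ∃ a b, t = ι a b})

/-- Compatibility with induction enters here: it makes the representation induced from `B_e⁺`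
integrable. The vectors `a ⊗ q(b)` still span a core, although the induced representation is built
from the possibly larger domain of the closed representation on `B_e⁺`. -/
theorem nonempty_regularRep (hind : CompatibleWithInduction 𝒜 𝓘) (𝓑 : PlusFibres H) :
    Nonempty (RegularRep 𝓑) := by
  obtain ⟨T, ι, π, hT, hin⟩ := 𝓑.isInducible_quotRep.exists_isInduced
  have hdom : ∀ a ξ, ι a ξ ∈ π.dom := fun a ξ =>
    hT.core.le_dom (Submodule.subset_span ⟨a, ξ, rfl⟩)
  let qd : H.univ.dom →ₗ[ℂ] (H.Φ 𝓑.quotRep).dom :=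
    𝓑.qDom.codRestrict (H.Φ 𝓑.quotRep).dom 𝓑.qDom_mem_dom
  refine ⟨T, LinearMap.mk₂ ℂ (fun a b => ι a (qd b)) (by simp) (by simp) (by simp) (by simp), π,
    ⟨hT.closed, hind _ (H.mem_Φ _) 𝓑.isInducible_quotRep T ι π hT⟩, fun a a' b b' => ?_,
    fun a b => hdom _ _, fun a c b => hT.map_mul _ _ _ _, ?_⟩
  · rw [LinearMap.mk₂_apply, LinearMap.mk₂_apply, hin, map_mul 𝓑.q, map_star 𝓑.q]
    have := 𝓑.Φ_quotRep_apply (𝒜.unitProj (star a * a')) b'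
    exact congrArg (fun x => star (𝓑.q (H.val b)) * x) this
  · refine hT.core.graphDense.trans_span (fun t ht => hT.core.le_dom (Submodule.subset_span ht)) _ ?_
    rintro _ ⟨a, ξ, rfl⟩
    obtain ⟨l, hl, hlS, hlt⟩ := 𝓑.graphDense_qDom.exists_tendsto ξ
    refine ⟨l.map fun z => ⟨ι a z, hdom a z⟩, hl.map _, ?_, fun c => ?_⟩
    · rw [eventually_map]
      filter_upwards [hlS] with z hz
      obtain ⟨b, hb⟩ := hz
      refine Submodule.subset_span ⟨a, b, ?_⟩
      have : z = qd b := Subtype.ext hb.symm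
      rw [this]
      rfl
    · rw [tendsto_map'_iff]
      have h0 : ∀ z, (π.toFun c ⟨ι a z, hdom a z⟩ : T) = ι (c * a) z := fun z => hT.map_mul _ _ _ _
      simp only [Function.comp_def, h0]
      rw [tendsto_iff_norm_sub_tendsto_zero]
      -- The norm of `c a ⊗ (z - ξ)` involves only the action of one element of `A_e` on `z - ξ`,
      -- which the graph topology on `B_e⁺` controls.
      have h1 : ∀ z, ‖ι (c * a) z - ι (c * a) ξ‖ = √‖(HilbertModule.self 𝓑.unit).inner
          ((z : 𝓑.unit) - ξ) (((H.Φ 𝓑.quotRep).toFun (𝒜.unitProj (star (c * a) * (c * a))) z :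
            𝓑.unit) - (H.Φ 𝓑.quotRep).toFun (𝒜.unitProj (star (c * a) * (c * a))) ξ)‖ := fun z => by
        rw [← map_sub]
        symm
        rw [Real.sqrt_eq_iff_mul_self_eq (norm_nonneg _) (norm_nonneg _), ← sq, T.norm_sq_eq, hin,
          map_sub]
        rfl
      simp only [h1]
      have h2 := hlt 1
      simp only [map_one, Module.End.one_apply] at h2
      have h3 := (HilbertModule.tendsto_inner _ (h2.sub_const (ξ : 𝓑.unit))
        ((hlt (𝒜.unitProj (star (c * a) * (c * a)))).sub_const
          ((H.Φ 𝓑.quotRep).toFun (𝒜.unitProj (star (c * a) * (c * a))) ξ : 𝓑.unit))).norm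
      simp only [sub_self, mul_zero, norm_zero] at h3
      have := (Real.continuous_sqrt.tendsto 0).comp h3
      rwa [Real.sqrt_zero] at this

end Fibres

end

section

open Filter Topology

/-! ## The regular representation -/

section Preliminaries

variable {A : Type u} [Ring A] [Algebra ℂ A] [StarRing A] [StarModule ℂ A]
  {D : Type u} [NonUnitalCStarAlgebra D] {E : HilbertModule D}

theorem Rep.GraphDense.restrict {π : Rep A E} {S : Set E} (h : π.GraphDense S)
    (A₀ : StarSubalgebra ℂ A) : (π.restrict A₀).GraphDense S := by
  refine Rep.graphDense_of_tendsto fun ξ => ?_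
  obtain ⟨l, hl, hS, ha⟩ := h.exists_tendsto ξ
  exact ⟨l, hl, hS, fun a => ha a⟩

theorem Rep.GraphDense.dense {π : Rep A E} {S : Set E} (h : π.GraphDense S) : Dense S := by
  refine (π.dense.mono fun x hx => ?_).of_closure
  obtain ⟨l, _, hS, ha⟩ := h.exists_tendsto ⟨x, hx⟩
  have := ha 1
  simp only [map_one, Module.End.one_apply] at this
  exact mem_closure_of_tendsto this hS

/-- Bounded operators that intertwine representations of a C*-hull intertwine the corresponding
representations. -/
theorem CStarHull.Φ_intertwines {𝓘 : RepClass A} {B : Type u} [NonUnitalCStarAlgebra B]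
    (H : CStarHull 𝓘 B) {D' : Type u} [NonUnitalCStarAlgebra D'] {E' : HilbertModule D'}
    {ρ : CStarRep B E} {ρ' : CStarRep B E'} (S : E →L[ℂ] E')
    (hS : ∀ b x, S (ρ.toFun b x) = ρ'.toFun b (S x)) (x : (H.Φ ρ).dom) :
    ∃ hd : S x ∈ (H.Φ ρ').dom, ∀ a, S ((H.Φ ρ).toFun a x) = (H.Φ ρ').toFun a ⟨S x, hd⟩ := by
  refine (H.isClosed_Φ ρ').intertwines_of_span (H.graphDense_Φ ρ) ?_ S.toLinearMap S.continuous
    ?_ x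
  · rintro _ ⟨b, x, rfl⟩
    exact H.apply_mem_dom ρ b x
  · rintro _ ⟨b, x, rfl⟩
    refine (Rep.mem_orbit_iff_of_eq (y := ρ'.toFun (H.val b) (S x)) ?_).2
      ⟨H.apply_mem_dom ρ' b (S x), fun a => ?_⟩
    · simp [hS]
    · rw [H.Φ_apply, H.Φ_apply]
      exact (hS _ _).symm

end Preliminaries

section Graded

variable {G : Type u} [Group G] {A : Type u} [Ring A] [Algebra ℂ A] [StarRing A] [StarModule ℂ A]
  (𝒜 : StarGrading G A)

namespace StarGrading

theorem unitProj_star_proj_mul (g : G) (a : 𝒜.fibre g) (b : A) :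
    𝒜.unitProj (star (a : A) * b) = 𝒜.starMul a (𝒜.proj g b) := by
  induction b using StarGrading.induction (𝒜 := 𝒜) with
  | h h b =>
    by_cases hg : g = h
    · subst hg
      rw [unitProj_star_mul, proj_coe]
    · rw [𝒜.unitProj_star_mul_of_ne hg, 𝒜.proj_coe_of_ne (Ne.symm hg)]
      exact Subtype.ext (mul_zero _).symm
  | hadd b c hb hc =>
    rw [mul_add, map_add, hb, hc, map_add]
    exact Subtype.ext (mul_add _ _ _).symm

theorem proj_unitFibre_mul (g : G) (a : 𝒜.unitFibre) (b : A) :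
    (𝒜.proj g ((a : A) * b) : A) = a * 𝒜.proj g b := by
  induction b using StarGrading.induction (𝒜 := 𝒜) with
  | h h b =>
    have hm : (a : A) * b ∈ 𝒜.fibre h := by
      have := 𝒜.mul_mem a.2 b.2
      rwa [one_mul] at this
    by_cases hg : h = g
    · subst hg
      rw [𝒜.proj_of_mem hm, proj_coe]
    · rw [𝒜.proj_of_mem_of_ne hg hm, 𝒜.proj_coe_of_ne hg]
      simp
  | hadd b c hb hc => simp only [mul_add, map_add, Submodule.coe_add, hb, hc]

/-- The product of an element of the unit fibre with a homogeneous element. -/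
def unitMul {g : G} (a : 𝒜.unitFibre) (b : 𝒜.fibre g) : 𝒜.fibre g :=
  ⟨a * b, by
    have := 𝒜.mul_mem a.2 b.2
    rwa [one_mul] at this⟩

end StarGrading

end Graded

section Fibres

variable {G : Type u} [Group G] {A : Type u} [Ring A] [Algebra ℂ A] [StarRing A] [StarModule ℂ A]
  {𝒜 : StarGrading G A} {𝓘 : RepClass 𝒜.unitFibre} {Be : Type u} [NonUnitalCStarAlgebra Be]
  {H : CStarHull 𝓘 Be} {𝓑 : PlusFibres H}

namespace PlusFibres

theorem dense_range_ι (𝓑 : PlusFibres H) (g : G) :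
    Dense (Submodule.span ℂ (Set.range fun p : 𝒜.fibre g × H.univ.dom => 𝓑.ι g p.1 p.2) :
      Set (𝓑.fibre g)) :=
  (𝓑.ι_dense g).mono (Submodule.span_mono (by
    rintro _ ⟨a, b, rfl⟩
    exact ⟨(a, b), rfl⟩))

variable (𝓑) in
/-- Continuous linear maps on a fibre that agree on the elements `a ⊗ b` are equal. -/
theorem clm_ext {g : G} {M : Type*} [NormedAddCommGroup M] [NormedSpace ℂ M]
    {S T : 𝓑.fibre g →L[ℂ] M} (h : ∀ a b, S (𝓑.ι g a b) = T (𝓑.ι g a b)) : S = T := by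
  refine ContinuousLinearMap.ext_on (𝓑.ι_dense g) ?_
  rintro _ ⟨a, b, rfl⟩
  exact h a b

theorem continuous_q (𝓑 : PlusFibres H) : Continuous 𝓑.q :=
  AddMonoidHomClass.continuous_of_bound 𝓑.q 1 fun x => by
    rw [one_mul]; exact NonUnitalStarAlgHom.norm_apply_le 𝓑.q x

theorem denseRange_qDom (𝓑 : PlusFibres H) : DenseRange 𝓑.qDom := by
  have h := 𝓑.q_surjective.denseRange.dense_image 𝓑.continuous_q H.dense_dom
  refine h.mono ?_
  rintro _ ⟨b, hb, rfl⟩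
  exact ⟨⟨b, hb⟩, rfl⟩

end PlusFibres

namespace FibreRep

variable {D : Type u} [NonUnitalCStarAlgebra D] {E : HilbertModule D} {π : Rep A E}
  (F : FibreRep 𝓑 π)

theorem op_act (g : G) (x : 𝓑.fibre g) (y : E) (d : D) :
    F.op g x (E.act y d) = E.act (F.op g x y) d := by
  rw [← sub_eq_zero]
  apply E.inner_self_eq_zero
  simp only [E.inner_sub_left, E.inner_sub_right, E.inner_act_right, E.inner_act_left, F.inner_op,
    F.plus.map_act]
  simp [mul_assoc]

theorem norm_op_apply_le (g : G) (x : 𝓑.fibre g) (ξ : E) : ‖F.op g x ξ‖ ≤ ‖x‖ * ‖ξ‖ := by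
  refine (sq_le_sq₀ (norm_nonneg _) (by positivity)).1 ?_
  rw [E.norm_sq_eq, F.inner_op, mul_pow, (𝓑.fibre g).norm_sq_eq]
  calc _ ≤ ‖ξ‖ * (‖(𝓑.fibre g).inner x x‖ * ‖ξ‖) := (E.norm_inner_le _ _).trans (by
          gcongr; exact F.plus.norm_apply_le _ _)
    _ = _ := by ring

theorem norm_op_le (g : G) (x : 𝓑.fibre g) : ‖F.op g x‖ ≤ ‖x‖ :=
  ContinuousLinearMap.opNorm_le_bound _ (norm_nonneg _) (F.norm_op_apply_le g x)

theorem isFibreRep : 𝓑.IsFibreRep π F.op :=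
  ⟨F.rep, F.Φ_rep, fun g a b x => ⟨F.mem_dom b x, F.op_ι g a b x⟩⟩

/-- The operators on the fibres are determined by the representation. -/
theorem op_eq {σ : ∀ g, 𝓑.fibre g →L[ℂ] (E →L[ℂ] E)} (h : 𝓑.IsFibreRep π σ) : σ = F.op := by
  obtain ⟨ρ, hρ, hσ⟩ := h
  have e : ρ = F.rep := H.injective_Φ (hρ.trans F.Φ_rep.symm)
  subst e
  funext g
  refine 𝓑.clm_ext fun a b => ?_
  ext x
  obtain ⟨hd, h⟩ := hσ g a b x
  rw [h, F.op_ι]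

end FibreRep

namespace RegularRep

variable (R : RegularRep 𝓑)

theorem dense_ι : Dense (Submodule.span ℂ {t | ∃ a b, t = R.ι a b} : Set R.T) := R.graphDense.dense

theorem dense_range_ι : Dense (Submodule.span ℂ
    (Set.range fun p : A × H.univ.dom => R.ι p.1 p.2) : Set R.T) :=
  R.dense_ι.mono (Submodule.span_mono (by
    rintro _ ⟨a, b, rfl⟩
    exact ⟨(a, b), rfl⟩))

theorem clm_ext {M : Type*} [NormedAddCommGroup M] [NormedSpace ℂ M]
    {S S' : R.T →L[ℂ] M} (h : ∀ a b, S (R.ι a b) = S' (R.ι a b)) : S = S' := by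
  refine ContinuousLinearMap.ext_on R.dense_ι ?_
  rintro _ ⟨a, b, rfl⟩
  exact h a b

theorem inner_ι_proj (g : G) (a a' : A) (b b' : H.univ.dom) :
    R.T.inner (R.ι (𝒜.proj g a) b) (R.ι a' b') =
      R.T.inner (R.ι (𝒜.proj g a) b) (R.ι (𝒜.proj g a') b') := by
  rw [R.inner_ι, R.inner_ι, 𝒜.unitProj_star_proj_mul, 𝒜.unitProj_star_mul]

theorem inner_ι_proj' (g : G) (a a' : A) (b b' : H.univ.dom) :
    R.T.inner (R.ι a b) (R.ι (𝒜.proj g a') b') =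
      R.T.inner (R.ι (𝒜.proj g a) b) (R.ι (𝒜.proj g a') b') := by
  rw [← R.T.star_inner, R.inner_ι_proj, R.T.star_inner]

/-- The inner product is balanced over `A_e` because the projection to `A_e` is right `A_e`-linear.
-/
theorem ι_unit (a : 𝒜.unitFibre) (b : H.univ.dom) : R.ι a b = R.ι 1 (H.univ.toFun a b) := by
  refine HilbertModule.ext_of_dense R.dense_ι ?_
  rintro _ ⟨c, b', rfl⟩
  rw [R.inner_ι, R.inner_ι, 𝒜.unitProj_mul_right, mul_one, map_mul H.univ.toFun]
  rfl

theorem exists_incl (g : G) : ∃ I : ModuleIsometry (𝓑.fibre g) R.T,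
    ∀ p : 𝒜.fibre g × H.univ.dom, I.toLin (𝓑.ι g p.1 p.2) = R.ι p.1 p.2 :=
  exists_moduleIsometry (fun p : 𝒜.fibre g × H.univ.dom => 𝓑.ι g p.1 p.2) (𝓑.dense_range_ι g)
    (fun p => R.ι p.1 p.2) fun p p' => by rw [R.inner_ι, 𝓑.ι_inner, 𝒜.unitProj_star_mul]

/-- The inclusion of the fibre `B_g⁺` in the regular representation. -/
def incl (g : G) : ModuleIsometry (𝓑.fibre g) R.T := (R.exists_incl g).choose

theorem incl_ι (g : G) (a : 𝒜.fibre g) (b : H.univ.dom) :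
    (R.incl g).toLin (𝓑.ι g a b) = R.ι a b := (R.exists_incl g).choose_spec (a, b)

/-- The operators on the fibres induced by the regular representation. -/
def fib : FibreRep 𝓑 R.π := (exists_fibreRep 𝓑 R.mem).some

/-- The representation of `B_e` on the regular representation. -/
abbrev rep : CStarRep Be R.T := R.fib.rep

/-- The axioms of a hull speak about isometries, not about projections. So the projection `P` to
degree `g` is replaced by the reflection `2P - 1`, which is isometric as the degrees are orthogonal.
-/
theorem exists_reflection (g : G) : ∃ U : ModuleIsometry R.T R.T,
    ∀ a b, U.toLin (R.ι a b) = (2 : ℂ) • R.ι (𝒜.proj g a) b - R.ι a b := by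
  obtain ⟨U, hU⟩ := exists_moduleIsometry (fun p : A × H.univ.dom => R.ι p.1 p.2) R.dense_range_ι
    (fun p => (2 : ℂ) • R.ι (𝒜.proj g p.1) p.2 - R.ι p.1 p.2) fun p p' => by
      simp only [R.T.inner_sub_left, R.T.inner_sub_right, R.T.inner_smul_left,
        R.T.inner_smul_right, R.inner_ι_proj g p.1 p'.1, R.inner_ι_proj' g p.1 p'.1]
      have : star (2 : ℂ) = 2 := by simp
      rw [this]
      module
  exact ⟨U, fun a b => hU (a, b)⟩

/-- The component of degree `g`, as an operator on the regular representation that commutes with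
the representation of `B_e`. -/
theorem exists_compr (g : G) : ∃ Q : R.T →L[ℂ] 𝓑.fibre g,
    (∀ a b, Q (R.ι a b) = 𝓑.ι g (𝒜.proj g a) b) ∧ (∀ x, Q ((R.incl g).toLin x) = x) ∧
    (∀ b t, (R.incl g).toLin (Q (R.rep.toFun b t)) = R.rep.toFun b ((R.incl g).toLin (Q t))) ∧
    ∀ t, ‖Q t‖ ≤ ‖t‖ := by
  obtain ⟨U, hU⟩ := R.exists_reflection g
  -- Left multiplication by `A_e` preserves degrees, so `U` commutes with it on the core; by the
  -- hull, `U` and hence `P` commute with `B_e`.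
  have h_int : (R.π.restrict 𝒜.unitFibre).Intertwines (R.π.restrict 𝒜.unitFibre) U := by
    have hcl := R.mem.1.restrict 𝒜
    refine hcl.intertwines_of_span (R.graphDense.restrict _) ?_ U.toLin U.continuous ?_
    · rintro _ ⟨a, b, rfl⟩
      exact R.mem_dom a b
    · rintro _ ⟨a, b, rfl⟩
      have h1 : ∀ c : 𝒜.unitFibre, (((R.π.restrict 𝒜.unitFibre).toFun c ⟨R.ι a b, R.mem_dom a b⟩ :
        (R.π.restrict 𝒜.unitFibre).dom) : R.T) = R.ι (c * a) b := fun c => R.π_ι c a b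
      have e : (fun c : 𝒜.unitFibre => U.toLin (((R.π.restrict 𝒜.unitFibre).toFun c
          ⟨R.ι a b, R.mem_dom a b⟩ : (R.π.restrict 𝒜.unitFibre).dom) : R.T)) =
          (2 : ℂ) • (R.π.restrict 𝒜.unitFibre).graph
            ⟨R.ι (𝒜.proj g a) b, R.mem_dom _ _⟩ -
          (R.π.restrict 𝒜.unitFibre).graph ⟨R.ι a b, R.mem_dom _ _⟩ := by
        funext c
        rw [h1, hU, 𝒜.proj_unitFibre_mul, Pi.sub_apply, Pi.smul_apply]
        change _ = (2 : ℂ) • (R.π.toFun c ⟨_, _⟩ : R.T) - (R.π.toFun c ⟨_, _⟩ : R.T)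
        rw [R.π_ι, R.π_ι]
      rw [e]
      exact sub_mem (Submodule.smul_mem _ _ (Rep.graph_mem_orbit _ _)) (Rep.graph_mem_orbit _ _)
  rw [← R.fib.Φ_rep] at h_int
  have hcomm := (H.isometric _ _ U).2 h_int
  let UL : R.T →L[ℂ] R.T := U.toLinearIsometry.toContinuousLinearMap
  have hUL : ∀ t, UL t = U.toLin t := fun _ => rfl
  let P : R.T →L[ℂ] R.T := (2⁻¹ : ℂ) • (ContinuousLinearMap.id ℂ R.T + UL)
  have hP : ∀ t, P t = (2⁻¹ : ℂ) • (t + U.toLin t) := fun _ => rfl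
  have hPι : ∀ a b, P (R.ι a b) = R.ι (𝒜.proj g a) b := fun a b => by
    rw [hP, hU, add_sub_cancel, smul_smul, inv_mul_cancel₀ two_ne_zero, one_smul]
  have hPr : ∀ b t, P (R.rep.toFun b t) = R.rep.toFun b (P t) := fun b t => by
    rw [hP, hP, hcomm, map_smul, map_add]
  have hPI : ∀ x, P ((R.incl g).toLin x) = (R.incl g).toLin x := fun x => by
    have : P.comp (R.incl g).toLinearIsometry.toContinuousLinearMap =
        (R.incl g).toLinearIsometry.toContinuousLinearMap := 𝓑.clm_ext fun a b => by
      change P ((R.incl g).toLin _) = (R.incl g).toLin _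
      rw [R.incl_ι, hPι, 𝒜.proj_coe]
    exact congrArg (fun S => S x) this
  have hrange : ∀ t, P t ∈ LinearMap.range (R.incl g).toLin := fun t => by
    have hc : IsClosed (LinearMap.range (R.incl g).toLin : Set R.T) :=
      (R.incl g).toLinearIsometry.isometry.isClosedEmbedding.isClosed_range
    refine R.dense_ι.induction (P := fun t => P t ∈ LinearMap.range (R.incl g).toLin) ?_
      (hc.preimage P.continuous) t
    intro t ht
    have : Submodule.span ℂ {t | ∃ a b, t = R.ι a b} ≤
        (LinearMap.range (R.incl g).toLin).comap P.toLinearMap := by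
      rw [Submodule.span_le]
      rintro _ ⟨a, b, rfl⟩
      exact ⟨𝓑.ι g (𝒜.proj g a) b, by rw [R.incl_ι]; exact (hPι a b).symm⟩
    exact this ht
  let Q₀ : R.T →ₗ[ℂ] 𝓑.fibre g :=
    (LinearEquiv.ofInjective (R.incl g).toLin (R.incl g).injective).symm.toLinearMap ∘ₗ
      P.toLinearMap.codRestrict _ hrange
  have hQ₀ : ∀ t, (R.incl g).toLin (Q₀ t) = P t := fun t =>
    congrArg Subtype.val ((LinearEquiv.ofInjective (R.incl g).toLin
      (R.incl g).injective).apply_symm_apply ⟨P t, hrange t⟩)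
  have hQn : ∀ t, ‖Q₀ t‖ ≤ ‖t‖ := fun t => by
    rw [← (R.incl g).norm_map, hQ₀, hP, norm_smul]
    have := norm_add_le t (U.toLin t)
    rw [U.norm_map] at this
    have h2 : ‖(2⁻¹ : ℂ)‖ = 2⁻¹ := by simp
    rw [h2]
    linarith
  refine ⟨Q₀.mkContinuous 1 (by simpa using hQn), fun a b => (R.incl g).injective ?_,
    fun x => (R.incl g).injective ?_, fun b t => ?_, hQn⟩
  · rw [R.incl_ι]
    exact (hQ₀ _).trans (hPι a b)
  · exact (hQ₀ _).trans (hPI x)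
  · exact (hQ₀ _).trans ((hPr b t).trans (congrArg _ (hQ₀ t).symm))

/-- The projection of the regular representation to the fibre `B_g⁺`. -/
def compr (g : G) : R.T →L[ℂ] 𝓑.fibre g := (R.exists_compr g).choose

theorem compr_ι (g : G) (a : A) (b : H.univ.dom) : R.compr g (R.ι a b) = 𝓑.ι g (𝒜.proj g a) b :=
  (R.exists_compr g).choose_spec.1 a b

theorem compr_incl (g : G) (x : 𝓑.fibre g) : R.compr g ((R.incl g).toLin x) = x :=
  (R.exists_compr g).choose_spec.2.1 x

theorem incl_compr_rep (g : G) (b : Be) (t : R.T) :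
    (R.incl g).toLin (R.compr g (R.rep.toFun b t)) =
      R.rep.toFun b ((R.incl g).toLin (R.compr g t)) :=
  (R.exists_compr g).choose_spec.2.2.1 b t

theorem norm_compr_le (g : G) (t : R.T) : ‖R.compr g t‖ ≤ ‖t‖ :=
  (R.exists_compr g).choose_spec.2.2.2 t

/-- The inclusion of a fibre as a continuous linear map. -/
def inclL (g : G) : 𝓑.fibre g →L[ℂ] R.T := (R.incl g).toLinearIsometry.toContinuousLinearMap

theorem inclL_apply (g : G) (x : 𝓑.fibre g) : R.inclL g x = (R.incl g).toLin x := rfl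

theorem incl_compr_rep_incl (g : G) (b : Be) (x : 𝓑.fibre g) :
    R.inclL g (R.compr g (R.rep.toFun b (R.inclL g x))) = R.rep.toFun b (R.inclL g x) := by
  rw [inclL_apply, incl_compr_rep, inclL_apply, compr_incl]

/-- The left action of `B_e` on the fibre `B_g⁺`. -/
def left (g : G) : CStarRep Be (𝓑.fibre g) where
  toFun :=
    { toFun := fun b => (R.compr g).comp ((R.rep.toFun b).comp (R.inclL g))
      map_add' := fun b c => by ext x; simp
      map_smul' := fun z b => by ext x; simp }
  map_mul b c x := by
    change R.compr g (R.rep.toFun (b * c) (R.inclL g x)) = R.compr g (R.rep.toFun b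
      (R.inclL g (R.compr g (R.rep.toFun c (R.inclL g x)))))
    rw [incl_compr_rep_incl, R.rep.map_mul]
  adjoint b x y := by
    change (𝓑.fibre g).inner (R.compr g (R.rep.toFun b (R.inclL g x))) y =
      (𝓑.fibre g).inner x (R.compr g (R.rep.toFun (star b) (R.inclL g y)))
    rw [← (R.incl g).map_inner, ← (R.incl g).map_inner, ← inclL_apply, ← inclL_apply,
      ← inclL_apply, ← inclL_apply, incl_compr_rep_incl, incl_compr_rep_incl, R.rep.adjoint]
  nondegenerate := by
    have hs : Function.Surjective (R.compr g) := fun x => ⟨_, R.compr_incl g x⟩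
    have h := hs.denseRange.dense_image (R.compr g).continuous R.rep.nondegenerate
    refine h.mono ?_
    rintro _ ⟨t, ht, rfl⟩
    have : Submodule.span ℂ {y | ∃ b x, y = R.rep.toFun b x} ≤
        (Submodule.span ℂ {y | ∃ b x, y = ((R.compr g).comp ((R.rep.toFun b).comp (R.inclL g))) x}
          ).comap (R.compr g).toLinearMap := by
      rw [Submodule.span_le]
      rintro _ ⟨b, x, rfl⟩
      refine Submodule.subset_span ⟨b, R.compr g x, ?_⟩
      change R.compr g (R.rep.toFun b x) = R.compr g (R.rep.toFun b (R.inclL g (R.compr g x)))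
      rw [inclL_apply, ← incl_compr_rep, compr_incl]
    exact this ht

theorem left_apply (g : G) (b : Be) (x : 𝓑.fibre g) :
    (R.left g).toFun b x = R.compr g (R.rep.toFun b (R.inclL g x)) := rfl

theorem inclL_left (g : G) (b : Be) (x : 𝓑.fibre g) :
    R.inclL g ((R.left g).toFun b x) = R.rep.toFun b (R.inclL g x) :=
  R.incl_compr_rep_incl g b x

theorem compr_rep (g : G) (b : Be) (t : R.T) :
    R.compr g (R.rep.toFun b t) = (R.left g).toFun b (R.compr g t) := by
  rw [left_apply, inclL_apply, ← incl_compr_rep, compr_incl]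

theorem compr_mem_dom (g : G) (t : R.π.dom) : ∃ hd : R.compr g t ∈ (H.Φ (R.left g)).dom,
    ∀ a : 𝒜.unitFibre, R.compr g (R.π.toFun a t) = (H.Φ (R.left g)).toFun a ⟨_, hd⟩ := by
  have h := fun x => H.Φ_intertwines (ρ := R.rep) (ρ' := R.left g) (R.compr g) (R.compr_rep g) x
  rw [R.fib.Φ_rep] at h
  exact h t

theorem inclL_mem_dom (g : G) (x : (H.Φ (R.left g)).dom) : ∃ hd : R.inclL g x ∈ R.π.dom,
    ∀ a : 𝒜.unitFibre, R.inclL g ((H.Φ (R.left g)).toFun a x) = R.π.toFun a ⟨_, hd⟩ := by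
  have h := H.Φ_intertwines (ρ := R.left g) (ρ' := R.rep) (R.inclL g) (R.inclL_left g) x
  rw [R.fib.Φ_rep] at h
  exact h

/-- This identifies the representation of `A_e` behind the left action on `B_g⁺`: it is left
multiplication on the factor `A_g`. -/
theorem ι_mem_dom (g : G) (a : 𝒜.fibre g) (b : H.univ.dom) :
    ∃ hd : 𝓑.ι g a b ∈ (H.Φ (R.left g)).dom, ∀ c : 𝒜.unitFibre,
      ((H.Φ (R.left g)).toFun c ⟨_, hd⟩ : 𝓑.fibre g) = 𝓑.ι g (𝒜.unitMul c a) b := by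
  have e : R.compr g (R.ι a b) = 𝓑.ι g a b := by rw [compr_ι, 𝒜.proj_coe]
  obtain ⟨hd, h⟩ := R.compr_mem_dom g ⟨R.ι a b, R.mem_dom a b⟩
  simp only [e] at hd h
  refine ⟨hd, fun c => ?_⟩
  rw [← h c, R.π_ι, R.compr_ι]
  congr 2
  exact 𝒜.proj_coe (𝒜.unitMul c a)

/-- A vector of `B_g⁺` is approximated inside the regular representation, and the approximants are
projected back to degree `g`; the projection is continuous for the graph topologies. -/
theorem graphDense_left (g : G) :
    (H.Φ (R.left g)).GraphDense (Submodule.span ℂ {x | ∃ a b, x = 𝓑.ι g a b}) := by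
  refine Rep.graphDense_of_tendsto fun x => ?_
  obtain ⟨hd, hx⟩ := R.inclL_mem_dom g x
  obtain ⟨l, hl, hlS, hlt⟩ := R.graphDense.exists_tendsto ⟨_, hd⟩
  choose hd' h' using R.compr_mem_dom g
  refine ⟨l.map fun t => ⟨_, hd' t⟩, hl.map _, ?_, fun a => ?_⟩
  · rw [eventually_map]
    filter_upwards [hlS] with t ht
    have : Submodule.span ℂ {t | ∃ a b, t = R.ι a b} ≤
        (Submodule.span ℂ {x | ∃ a b, x = 𝓑.ι g a b}).comap (R.compr g).toLinearMap := by
      rw [Submodule.span_le]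
      rintro _ ⟨a, b, rfl⟩
      exact Submodule.subset_span ⟨𝒜.proj g a, b, R.compr_ι g a b⟩
    exact this ht
  · rw [tendsto_map'_iff]
    simp only [Function.comp_def, ← h']
    have h1 : ((H.Φ (R.left g)).toFun a x : 𝓑.fibre g) = R.compr g (R.π.toFun a ⟨_, hd⟩) := by
      rw [← hx, inclL_apply, compr_incl]
    rw [h1]
    exact ((R.compr g).continuous.tendsto _).comp (hlt a)

/-- The operators induced by integrable representations are compatible with the left action of
`B_e` on the fibres. -/
theorem rep_op {D : Type u} [NonUnitalCStarAlgebra D] {E : HilbertModule D} {π : Rep A E}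
    (hπ : π.IsClosed) (F : FibreRep 𝓑 π) (g : G) (b : Be) (x : 𝓑.fibre g) (y : E) :
    F.rep.toFun b (F.op g x y) = F.op g ((R.left g).toFun b x) y := by
  -- This replaces equivariance under `B_e` by equivariance under `A_e`, which on generators is
  -- `π(c)π(a) = π(c a)`.
  refine (H.transfer F.plus (F.op g).toLinearMap (F.op_act g) (F.inner_op g) (R.left g) F.rep).2
    ?_ b x y
  intro x y
  rw [F.Φ_rep]
  let S : 𝓑.fibre g →L[ℂ] E := (F.op g).flip y
  have hS : ∀ x, S x = F.op g x y := fun _ => rfl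
  have key := (hπ.restrict 𝒜).intertwines_of_span (R.graphDense_left g) (by
    rintro _ ⟨a, b, rfl⟩
    exact (R.ι_mem_dom g a b).1) S.toLinearMap S.continuous (by
    rintro _ ⟨a, b, rfl⟩
    obtain ⟨hd, h⟩ := R.ι_mem_dom g a b
    have e : (fun c => S.toLinearMap ((H.Φ (R.left g)).toFun c ⟨𝓑.ι g a b, hd⟩)) =
        (π.restrict 𝒜.unitFibre).graph (π.toFun a ⟨_, F.mem_dom b y⟩) := by
      funext c
      rw [h c]
      change F.op g _ y = (π.toFun c (π.toFun a ⟨_, F.mem_dom b y⟩) : E)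
      rw [F.op_ι]
      change (π.toFun (c * a) _ : E) = _
      rw [map_mul]
      rfl
    rw [e]
    exact Rep.graph_mem_orbit _ _) x
  obtain ⟨hd, h⟩ := key
  exact ⟨hd, fun a => (h a).symm⟩

/-! ### Faithfulness -/

theorem exists_vac : ∃ w : ModuleIsometry (HilbertModule.self 𝓑.unit) R.T,
    ∀ b, w.toLin (𝓑.qDom b) = R.ι 1 b := by
  refine exists_moduleIsometry (E₁ := HilbertModule.self 𝓑.unit) 𝓑.qDom ?_ (R.ι 1) fun b b' => ?_
  · exact 𝓑.denseRange_qDom.mono Submodule.subset_span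
  · have h1 : 𝒜.unitProj (star (1 : A) * 1) = 1 := by
      have := 𝒜.proj_of_mem 𝒜.one_mem
      apply Subtype.ext
      rw [star_one, one_mul, 𝒜.unitProj_coe, this]
      rfl
    rw [R.inner_ι, h1, map_one, map_mul, map_star]
    rfl

/-- The isometry `c ↦ 1 ⊗ c` from `B_e⁺` to the regular representation. -/
def vac : ModuleIsometry (HilbertModule.self 𝓑.unit) R.T := R.exists_vac.choose

theorem vac_qDom (b : H.univ.dom) : R.vac.toLin (𝓑.qDom b) = R.ι 1 b :=
  R.exists_vac.choose_spec b

/-- `vac` is an isometry that intertwines the representations of `A_e`, so by the hull it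
intertwines those of `B_e`. -/
theorem rep_vac (b : Be) (c : 𝓑.unit) :
    R.rep.toFun b (R.vac.toLin c) = R.vac.toLin (𝓑.q b * c) := by
  have h_int : (H.Φ 𝓑.quotRep).Intertwines (R.π.restrict 𝒜.unitFibre) R.vac := by
    have hG := 𝓑.graphDense_qDom
    rw [← Submodule.span_eq (LinearMap.range 𝓑.qDom)] at hG
    refine (R.mem.1.restrict 𝒜).intertwines_of_span hG ?_ R.vac.toLin R.vac.continuous ?_
    · rintro _ ⟨b, rfl⟩
      exact 𝓑.qDom_mem_dom b
    · rintro _ ⟨b, rfl⟩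
      have e : (fun a => R.vac.toLin ((H.Φ 𝓑.quotRep).toFun a
          ⟨𝓑.qDom b, 𝓑.qDom_mem_dom b⟩ : 𝓑.unit)) =
          (R.π.restrict 𝒜.unitFibre).graph ⟨R.ι 1 b, R.mem_dom 1 b⟩ := by
        funext a
        rw [𝓑.Φ_quotRep_apply, R.vac_qDom]
        change _ = (R.π.toFun a ⟨R.ι 1 b, R.mem_dom 1 b⟩ : R.T)
        rw [R.π_ι, mul_one, R.ι_unit]
      rw [e]
      exact Rep.graph_mem_orbit _ _
  rw [← R.fib.Φ_rep] at h_int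
  exact ((H.isometric _ _ _).2 h_int b c).symm

/-- On the copy of `B_e⁺` in degree 1, an element of `B_g⁺` acts as it does in its Hilbert module
structure; this detects its norm. -/
theorem op_vac (g : G) (x : 𝓑.fibre g) (c : 𝓑.unit) :
    R.fib.op g x (R.vac.toLin c) = R.inclL g ((𝓑.fibre g).act x c) := by
  have : (R.fib.op g).flip (R.vac.toLin c) = (R.inclL g).comp ((𝓑.fibre g).actL.flip c) := by
    refine 𝓑.clm_ext fun a b => ?_
    obtain ⟨c, rfl⟩ := 𝓑.q_surjective c
    change R.fib.op g (𝓑.ι g a b) _ = R.inclL g ((𝓑.fibre g).act (𝓑.ι g a b) (𝓑.q c))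
    rw [← 𝓑.ι_act, R.inclL_apply, R.incl_ι, R.fib.op_ι]
    have h1 := R.π_ι a 1 (H.domMul b c)
    rw [mul_one] at h1
    rw [CStarHull.domMul] at h1
    rw [← h1]
    congr 3
    rw [R.rep_vac, ← map_mul, ← R.vac_qDom]
    rfl
  exact congrArg (fun S => S x) this

/-- The operators induced by the regular representation are isometric. -/
theorem norm_op (g : G) (x : 𝓑.fibre g) : ‖R.fib.op g x‖ = ‖x‖ := by
  refine le_antisymm (R.fib.norm_op_le g x) ?_
  rcases eq_or_ne x 0 with rfl | hx
  · simp
  -- The operator is tested on the vector `c = ⟨x, x⟩`: as `‖x c‖² = ‖c³‖`, its norm is at least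
  -- that of `x`.
  let c := (𝓑.fibre g).inner x x
  have hc : ‖c‖ = ‖x‖ ^ 2 := ((𝓑.fibre g).norm_sq_eq x).symm
  have hsa : star c = c := (𝓑.fibre g).star_inner x x
  have h1 : ‖(𝓑.fibre g).act x c‖ ≤ ‖R.fib.op g x‖ * ‖c‖ := by
    have := (R.fib.op g x).le_opNorm (R.vac.toLin c)
    rw [R.op_vac, R.vac.norm_map, R.inclL_apply, (R.incl g).norm_map] at this
    exact this
  have hc0 : 0 < ‖c‖ := by rw [hc]; positivity
  have h2 : (‖x‖ ^ 3) ^ 2 ≤ ‖(𝓑.fibre g).act x c‖ ^ 2 := by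
    rw [(𝓑.fibre g).norm_sq_eq, (𝓑.fibre g).inner_act_right, (𝓑.fibre g).inner_act_left]
    change _ ≤ ‖star c * c * c‖
    -- Only even powers are accessible to the C*-identity, so `‖c³‖ ≥ ‖c‖³` is derived from `‖c⁴‖ =
    -- ‖c‖⁴`.
    have h3 : ‖c‖ ^ 3 * ‖c‖ ≤ ‖star c * c * c‖ * ‖c‖ := by
      refine le_trans (le_of_eq ?_) (norm_mul_le _ _)
      have e : star c * c * c * c = star (star c * c) * (star c * c) := by
        simp only [star_mul, hsa, mul_assoc]
      rw [e, CStarRing.norm_star_mul_self, CStarRing.norm_star_mul_self]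
      ring
    refine le_trans (le_of_eq ?_) (le_of_mul_le_mul_right h3 hc0)
    rw [hc]
    ring
  have h4 := ((sq_le_sq₀ (by positivity) (norm_nonneg _)).1 h2).trans h1
  rw [hc] at h4 hc0
  refine le_of_mul_le_mul_right (le_trans (le_of_eq ?_) h4) hc0
  ring

end RegularRep

end Fibres

end

section

open Filter Topology

/-! ## The Fell bundle structure on the fibres -/

section Fibres

variable {G : Type u} [Group G] {A : Type u} [Ring A] [Algebra ℂ A] [StarRing A] [StarModule ℂ A]
  {𝒜 : StarGrading G A} {𝓘 : RepClass 𝒜.unitFibre} {Be : Type u} [NonUnitalCStarAlgebra Be]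
  {H : CStarHull 𝓘 Be} {𝓑 : PlusFibres H}

namespace PlusFibres

theorem ι_unit (𝓑 : PlusFibres H) (a : 𝒜.unitFibre) (b : H.univ.dom) :
    𝓑.ι 1 ⟨a, a.2⟩ b = 𝓑.ι 1 ⟨1, 𝒜.one_mem⟩ (H.univ.toFun a b) := by
  refine HilbertModule.ext_of_dense (𝓑.ι_dense 1) ?_
  rintro _ ⟨c, b', rfl⟩
  rw [𝓑.ι_inner, 𝓑.ι_inner]
  have e : 𝒜.starMul c ⟨a, a.2⟩ = 𝒜.starMul c ⟨1, 𝒜.one_mem⟩ * a := by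
    apply Subtype.ext
    change star (c : A) * a = star (c : A) * 1 * a
    rw [mul_one]
  rw [e, map_mul H.univ.toFun]
  rfl

/-- The map `q(b) ↦ 1 ⊗ b` preserves inner products. It is onto because `a ⊗ b = 1 ⊗ μ_e(a)b` for `a
∈ A_e`. -/
theorem exists_unitIso (𝓑 : PlusFibres H) : ∃ v : 𝓑.unit ≃ₗᵢ[ℂ] 𝓑.fibre 1,
    ∀ b, v (𝓑.qDom b) = 𝓑.ι 1 ⟨1, 𝒜.one_mem⟩ b := by
  obtain ⟨v, hv⟩ := exists_moduleIsometry (E₁ := HilbertModule.self 𝓑.unit) 𝓑.qDom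
    (𝓑.denseRange_qDom.mono Submodule.subset_span) (𝓑.ι 1 ⟨1, 𝒜.one_mem⟩) fun b b' => by
      have h1 : 𝒜.starMul (⟨1, 𝒜.one_mem⟩ : 𝒜.fibre 1) ⟨1, 𝒜.one_mem⟩ = 1 := by
        apply Subtype.ext
        change star (1 : A) * 1 = 1
        rw [star_one, one_mul]
      rw [𝓑.ι_inner, h1, map_one, map_mul, map_star]
      rfl
  have hs : Function.Surjective v.toLinearIsometry := by
    have hc : IsClosed (LinearMap.range v.toLin : Set (𝓑.fibre 1)) :=
      v.toLinearIsometry.isometry.isClosedEmbedding.isClosed_range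
    have hle : Submodule.span ℂ {x | ∃ a b, x = 𝓑.ι 1 a b} ≤ LinearMap.range v.toLin := by
      rw [Submodule.span_le]
      rintro _ ⟨a, b, rfl⟩
      exact ⟨𝓑.qDom (H.univ.toFun ⟨a, a.2⟩ b), by rw [hv, ← 𝓑.ι_unit]⟩
    intro x
    exact hc.closure_subset_iff.2 hle (𝓑.ι_dense 1 x)
  exact ⟨LinearIsometryEquiv.ofSurjective v.toLinearIsometry hs, hv⟩

/-- The canonical isomorphism between `B_e⁺` and the fibre at the unit. -/
def unitIso (𝓑 : PlusFibres H) : 𝓑.unit ≃ₗᵢ[ℂ] 𝓑.fibre 1 := 𝓑.exists_unitIso.choose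

theorem unitIso_qDom (𝓑 : PlusFibres H) (b : H.univ.dom) :
    𝓑.unitIso (𝓑.qDom b) = 𝓑.ι 1 ⟨1, 𝒜.one_mem⟩ b := 𝓑.exists_unitIso.choose_spec b

theorem unitIso_ι (𝓑 : PlusFibres H) (a : 𝒜.unitFibre) (b : H.univ.dom) :
    𝓑.unitIso (𝓑.qDom (H.univ.toFun a b)) = 𝓑.ι 1 ⟨a, a.2⟩ b := by
  rw [unitIso_qDom, ← ι_unit]

end PlusFibres

namespace FibreRep

variable {D : Type u} [NonUnitalCStarAlgebra D] {E : HilbertModule D} {π : Rep A E}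
  (F : FibreRep 𝓑 π)

theorem op_unitIso (c : 𝓑.unit) : F.op 1 (𝓑.unitIso c) = F.plus.toFun c := by
  have h : ∀ c, ((F.op 1).comp 𝓑.unitIso.toContinuousLinearEquiv.toContinuousLinearMap) c =
      F.plus.toCLM c := fun c => by
    refine 𝓑.denseRange_qDom.induction_on (p := fun c => ((F.op 1).comp
      𝓑.unitIso.toContinuousLinearEquiv.toContinuousLinearMap) c = F.plus.toCLM c) c
      (isClosed_eq (by fun_prop) (by fun_prop)) fun b => ?_
    change F.op 1 (𝓑.unitIso (𝓑.qDom b)) = F.plus.toFun (𝓑.q (H.val b))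
    ext ξ
    rw [𝓑.unitIso_qDom, F.plus_q, F.op_ι]
    change (π.toFun 1 _ : E) = _
    rw [map_one]
    rfl
  exact h c

theorem op_act_left (g : G) (x : 𝓑.fibre g) (c : 𝓑.unit) (ξ : E) :
    F.op g ((𝓑.fibre g).act x c) ξ = F.op g x (F.plus.toFun c ξ) := by
  rw [← sub_eq_zero]
  apply E.inner_self_eq_zero
  simp only [E.inner_sub_left, E.inner_sub_right, F.inner_op, F.plus.adjoint,
    (𝓑.fibre g).inner_act_left, (𝓑.fibre g).inner_act_right, ← F.plus.map_mul, mul_assoc]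
  simp

theorem dense_span_op : Dense (Submodule.span ℂ {y : E | ∃ g b x, y = F.op g b x} : Set E) := by
  refine F.plus.nondegenerate.mono (Submodule.span_mono ?_)
  rintro _ ⟨c, x, rfl⟩
  exact ⟨1, 𝓑.unitIso c, x, by rw [F.op_unitIso]⟩

/-- Vectors in the domain of the left action on a fibre act by maps into the domain of `π`. -/
theorem op_mem_dom (R : RegularRep 𝓑) (hπ : π.IsClosed) (h : G) (w : (H.Φ (R.left h)).dom)
    (ξ : E) : ∃ hd : F.op h w ξ ∈ π.dom, ∀ a : 𝒜.unitFibre,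
      F.op h ((H.Φ (R.left h)).toFun a w) ξ = π.toFun a ⟨_, hd⟩ := by
  have h1 := H.Φ_intertwines (ρ := R.left h) (ρ' := F.rep) ((F.op h).flip ξ)
    (fun b x => (R.rep_op hπ F h b x ξ).symm) w
  rw [F.Φ_rep] at h1
  exact h1

end FibreRep

namespace RegularRep

variable (R : RegularRep 𝓑)

/-- The multiplication of the Fell bundle. -/
def mul (g h : G) : 𝓑.fibre g →L[ℂ] 𝓑.fibre h →L[ℂ] 𝓑.fibre (g * h) :=
  (ContinuousLinearMap.compL ℂ (𝓑.fibre h) R.T (𝓑.fibre (g * h)) (R.compr (g * h))).comp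
    ((((ContinuousLinearMap.compL ℂ (𝓑.fibre h) R.T R.T).flip (R.inclL h))).comp (R.fib.op g))

theorem mul_apply (g h : G) (x : 𝓑.fibre g) (y : 𝓑.fibre h) :
    R.mul g h x y = R.compr (g * h) (R.fib.op g x (R.inclL h y)) := rfl

variable {D : Type u} [NonUnitalCStarAlgebra D] {E : HilbertModule D} {π : Rep A E}

/-- For `w = c ⊗ b` both sides are `π(a c)ρ(b)ξ`. A general `w` in the domain is a limit of such
sums in the graph topology for `A_e`, and this topology also controls the action of `a ∈ A_g`. -/
theorem op_compr_apply (hπ : π.IsClosed) (F : FibreRep 𝓑 π) {g h : G} (a : 𝒜.fibre g)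
    (w : (H.Φ (R.left h)).dom) (ξ : E) (hd₁ : R.inclL h w ∈ R.π.dom) (hd₂ : F.op h w ξ ∈ π.dom) :
    F.op (g * h) (R.compr (g * h) (R.π.toFun a ⟨_, hd₁⟩)) ξ = π.toFun a ⟨_, hd₂⟩ := by
  let X := (H.Φ (R.left h)).dom
  let J : X →ₗ[ℂ] R.π.dom := ((R.inclL h).toLinearMap ∘ₗ X.subtype).codRestrict R.π.dom
    fun z => (R.inclL_mem_dom h z).1
  let K : X →ₗ[ℂ] π.dom := (((F.op h).flip ξ).toLinearMap ∘ₗ X.subtype).codRestrict π.dom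
    fun z => (F.op_mem_dom R hπ h z ξ).1
  have hJ : ∀ z (b : 𝒜.unitFibre), (R.π.toFun b (J z) : R.T) =
      R.inclL h ((H.Φ (R.left h)).toFun b z) := fun z b => ((R.inclL_mem_dom h z).2 b).symm
  have hK : ∀ z (b : 𝒜.unitFibre), (π.toFun b (K z) : E) =
      F.op h ((H.Φ (R.left h)).toFun b z) ξ := fun z b => ((F.op_mem_dom R hπ h z ξ).2 b).symm
  let M₁ : R.T →L[ℂ] E := ((F.op (g * h)).flip ξ).comp (R.compr (g * h))
  let L₁ : X →ₗ[ℂ] E := M₁.toLinearMap ∘ₗ R.π.dom.subtype ∘ₗ R.π.toFun a ∘ₗ J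
  let L₂ : X →ₗ[ℂ] E := π.dom.subtype ∘ₗ π.toFun a ∘ₗ K
  have hspan : Submodule.span ℂ {x | ∃ a b, x = 𝓑.ι h a b} ≤
      (LinearMap.eqLocus L₁ L₂).map X.subtype := by
    rw [Submodule.span_le]
    rintro _ ⟨c, b, rfl⟩
    refine ⟨⟨𝓑.ι h c b, (R.ι_mem_dom h c b).1⟩, ?_, rfl⟩
    change F.op (g * h) (R.compr (g * h) (R.π.toFun a (J _))) ξ = π.toFun a (K _)
    have e1 : J ⟨𝓑.ι h c b, (R.ι_mem_dom h c b).1⟩ = ⟨R.ι c b, R.mem_dom c b⟩ :=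
      Subtype.ext (R.incl_ι h c b)
    have e2 : K ⟨𝓑.ι h c b, (R.ι_mem_dom h c b).1⟩ =
        π.toFun c ⟨_, F.mem_dom b ξ⟩ := Subtype.ext (F.op_ι h c b ξ)
    rw [e1, e2, R.π_ι, R.compr_ι, F.op_ι, 𝒜.proj_of_mem (𝒜.mul_mem a.2 c.2), map_mul]
    rfl
  obtain ⟨l, _, hlS, hlt⟩ := (R.graphDense_left h).exists_tendsto w
  have t₁ : Tendsto L₁ l (𝓝 (L₁ w)) := by
    refine (M₁.continuous.tendsto _).comp (R.π.tendsto_of_unitFibre 𝒜 (fun b hb => ?_) a)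
    have := fun z => hJ z ⟨b, hb⟩
    simp only [this]
    exact ((R.inclL h).continuous.tendsto _).comp (hlt ⟨b, hb⟩)
  have t₂ : Tendsto L₂ l (𝓝 (L₂ w)) := by
    refine π.tendsto_of_unitFibre 𝒜 (fun b hb => ?_) a
    have := fun z => hK z ⟨b, hb⟩
    simp only [this]
    exact (((F.op h).flip ξ).continuous.tendsto _).comp (hlt ⟨b, hb⟩)
  have he : ∀ᶠ z in l, L₁ z = L₂ z := by
    filter_upwards [hlS] with z hz
    obtain ⟨y, hy, hyz⟩ := hspan hz
    have : y = z := Subtype.ext hyz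
    subst this
    exact hy
  exact tendsto_nhds_unique_of_eventuallyEq t₁ t₂ he

/-- All integrable representations are multiplicative on the Fell bundle. -/
theorem op_mul (hπ : π.IsClosed) (F : FibreRep 𝓑 π) {g h : G} (x : 𝓑.fibre g) (y : 𝓑.fibre h)
    (ξ : E) : F.op (g * h) (R.mul g h x y) ξ = F.op g x (F.op h y ξ) := by
  have : (((F.op (g * h)).flip ξ).comp ((R.mul g h).flip y)) = (F.op g).flip (F.op h y ξ) := by
    -- For `x = a ⊗ b`, the element `b` is moved onto `y` by the left action. This puts `y` in the
    -- domain, where `a` may act.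
    refine 𝓑.clm_ext fun a b => ?_
    change F.op (g * h) (R.compr (g * h) (R.fib.op g (𝓑.ι g a b) (R.inclL h y))) ξ =
      F.op g (𝓑.ι g a b) (F.op h y ξ)
    rw [F.op_ι, R.fib.op_ι]
    have hw : (R.left h).toFun (H.val b) y ∈ (H.Φ (R.left h)).dom := H.apply_mem_dom _ _ _
    have e1 : R.fib.rep.toFun (H.val b) (R.inclL h y) = R.inclL h ((R.left h).toFun (H.val b) y) :=
      (R.inclL_left h _ y).symm
    have e2 := R.rep_op hπ F h (H.val b) y ξ
    simp only [e1, e2]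
    exact R.op_compr_apply hπ F a ⟨_, hw⟩ ξ _ _
  exact congrArg (fun S => S x) this

theorem op_injective {g : G} {x y : 𝓑.fibre g} (h : R.fib.op g x = R.fib.op g y) : x = y := by
  rw [← sub_eq_zero, ← norm_eq_zero, ← R.norm_op, map_sub, h, sub_self, norm_zero]

/-- By faithfulness of the regular representation, bundle identities become operator identities, and
the transport between equal degrees disappears. -/
theorem sigma_ext {g h : G} (e : g = h) {x : 𝓑.fibre g} {y : 𝓑.fibre h}
    (hxy : ∀ ξ, R.fib.op g x ξ = R.fib.op h y ξ) : (⟨g, x⟩ : Σ g, 𝓑.fibre g) = ⟨h, y⟩ := by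
  subst e
  rw [R.op_injective (ContinuousLinearMap.ext hxy)]

end RegularRep

/-- `z` is the adjoint of `x` in all integrable representations. -/
def IsAdj {g h : G} (x : 𝓑.fibre g) (z : 𝓑.fibre h) : Prop :=
  ∀ {D : Type u} [NonUnitalCStarAlgebra D] {E : HilbertModule D} {π : Rep A E},
    π.IsClosed → ∀ (F : FibreRep 𝓑 π) (ξ η : E),
      E.inner (F.op g x ξ) η = E.inner ξ (F.op h z η)

theorem IsAdj.add {g h : G} {x x' : 𝓑.fibre g} {z z' : 𝓑.fibre h} (h₁ : IsAdj x z)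
    (h₂ : IsAdj x' z') : IsAdj (x + x') (z + z') := fun {D} _ {E} {π} hπ F ξ η => by
  simp only [map_add, add_apply, E.inner_add_left, E.inner_add_right, h₁ hπ, h₂ hπ]

theorem IsAdj.smul {g h : G} {x : 𝓑.fibre g} {z : 𝓑.fibre h} (h₁ : IsAdj x z) (c : ℂ) :
    IsAdj (c • x) (star c • z) := fun {D} _ {E} {π} hπ F ξ η => by
  simp only [map_smul, smul_apply, E.inner_smul_left, E.inner_smul_right, h₁ hπ]

theorem IsAdj.sub {g h : G} {x x' : 𝓑.fibre g} {z z' : 𝓑.fibre h} (h₁ : IsAdj x z)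
    (h₂ : IsAdj x' z') : IsAdj (x - x') (z - z') := fun {D} _ {E} {π} hπ F ξ η => by
  simp only [map_sub, sub_apply, E.inner_sub_left, E.inner_sub_right, h₁ hπ, h₂ hπ]

namespace RegularRep

/-- In the regular representation norms of fibre elements are operator norms, and adjoint operators
have equal norms. -/
theorem norm_eq_of_isAdj (R : RegularRep 𝓑) {g h : G} {x : 𝓑.fibre g} {z : 𝓑.fibre h}
    (h₁ : IsAdj x z) : ‖z‖ = ‖x‖ := by
  have ha : ∀ ξ η, R.T.inner (R.fib.op g x ξ) η = R.T.inner ξ (R.fib.op h z η) :=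
    h₁ R.mem.1 R.fib
  have hb : ∀ ξ η, R.T.inner (R.fib.op h z ξ) η = R.T.inner ξ (R.fib.op g x η) := fun ξ η => by
    rw [← R.T.star_inner, ← ha, R.T.star_inner]
  have h2 := R.T.opNorm_sq_of_adjoint ha
  have h3 := R.T.opNorm_sq_of_adjoint hb
  have h4 := (R.fib.op h z).opNorm_comp_le (R.fib.op g x)
  have h5 := (R.fib.op g x).opNorm_comp_le (R.fib.op h z)
  rw [h2, R.norm_op, R.norm_op] at h4
  rw [h3, R.norm_op, R.norm_op] at h5
  have := norm_nonneg x
  have := norm_nonneg z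
  nlinarith

end RegularRep

end Fibres

end

/-! ### The involution, and the Fell bundle assembled from it. -/

section

open Filter Topology

section Fibres

variable {G : Type u} [Group G] {A : Type u} [Ring A] [Algebra ℂ A] [StarRing A] [StarModule ℂ A]
  {𝒜 : StarGrading G A} {𝓘 : RepClass 𝒜.unitFibre} {Be : Type u} [NonUnitalCStarAlgebra Be]
  {H : CStarHull 𝓘 Be} {𝓑 : PlusFibres H}

/-- The involution `A_g → A_{g⁻¹}`. -/
def StarGrading.starFibre (𝒜 : StarGrading G A) {g : G} (a : 𝒜.fibre g) : 𝒜.fibre g⁻¹ :=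
  ⟨star (a : A), 𝒜.star_mem a.2⟩

namespace RegularRep

variable (R : RegularRep 𝓑)

/-- The two elements act by `ρ(c)* π(a) ρ(b)` and `ρ(b)* π(a*) ρ(c)`. The extra factor `ρ(c)*` is
needed because the formal adjoint `ρ(b)* π(a*)` of `π(a)ρ(b)` is a priori only defined on the domain
of `π`. -/
theorem isAdj_left_ι {g : G} (c b : H.univ.dom) (a : 𝒜.fibre g) :
    IsAdj ((R.left g).toFun (star (H.val c)) (𝓑.ι g a b))
      ((R.left g⁻¹).toFun (star (H.val b)) (𝓑.ι g⁻¹ (𝒜.starFibre a) c)) := by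
  intro D _ E π hπ F ξ η
  rw [← R.rep_op hπ, ← R.rep_op hπ, F.rep.adjoint, star_star, F.op_ι]
  have h1 := F.rep.adjoint (H.val b) ξ (F.op g⁻¹ (𝓑.ι g⁻¹ (𝒜.starFibre a) c) η)
  rw [← h1, F.op_ι]
  exact π.adjoint a ⟨_, F.mem_dom b ξ⟩ ⟨_, F.mem_dom c η⟩

/-- Elements with an adjoint form a subspace, which is closed because passing to adjoints is
isometric. It contains all `c* · (a ⊗ b)`, and these are total since the left action of `B_e` is
nondegenerate. -/
theorem exists_isAdj (R : RegularRep 𝓑) {g : G} (x : 𝓑.fibre g) : ∃ z : 𝓑.fibre g⁻¹, IsAdj x z := by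
  let X : Submodule ℂ (𝓑.fibre g) :=
    { carrier := {x | ∃ z : 𝓑.fibre g⁻¹, IsAdj x z}
      add_mem' := by
        rintro x y ⟨z, hz⟩ ⟨w, hw⟩
        exact ⟨z + w, hz.add hw⟩
      zero_mem' := ⟨0, fun {D} _ {E} {π} hπ F ξ η => by simp⟩
      smul_mem' := by
        rintro c x ⟨z, hz⟩
        exact ⟨star c • z, hz.smul c⟩ }
  have hXc : IsClosed (X : Set (𝓑.fibre g)) := by
    refine isClosed_of_closure_subset fun x hx => ?_
    obtain ⟨s, hs, hsx⟩ := mem_closure_iff_seq_limit.1 hx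
    choose z hz using hs
    have hc : CauchySeq z := by
      have h0 := hsx.cauchySeq
      rw [Metric.cauchySeq_iff] at h0 ⊢
      intro ε hε
      obtain ⟨N, hN⟩ := h0 ε hε
      refine ⟨N, fun m hm n hn => ?_⟩
      rw [dist_eq_norm, R.norm_eq_of_isAdj (IsAdj.sub (hz m) (hz n)), ← dist_eq_norm]
      exact hN m hm n hn
    obtain ⟨w, hw⟩ := cauchySeq_tendsto_of_complete hc
    refine ⟨w, fun {D} _ {E} {π} hπ F ξ η => ?_⟩
    have h1 : Tendsto (fun n => E.inner (F.op g (s n) ξ) η) atTop (𝓝 (E.inner (F.op g x ξ) η)) :=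
      E.tendsto_inner ((((F.op g).flip ξ).continuous.tendsto x).comp hsx) tendsto_const_nhds
    have h2 : Tendsto (fun n => E.inner ξ (F.op g⁻¹ (z n) η)) atTop
        (𝓝 (E.inner ξ (F.op g⁻¹ w η))) :=
      E.tendsto_inner tendsto_const_nhds ((((F.op g⁻¹).flip η).continuous.tendsto w).comp hw)
    refine tendsto_nhds_unique h1 (h2.congr fun n => (hz n hπ F ξ η).symm)
  have hleft : ∀ (c : H.univ.dom) (y : 𝓑.fibre g), (R.left g).toFun (star (H.val c)) y ∈ X := by
    intro c y
    have hle : Submodule.span ℂ {x | ∃ a b, x = 𝓑.ι g a b} ≤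
        X.comap ((R.left g).toFun (star (H.val c))).toLinearMap := by
      rw [Submodule.span_le]
      rintro _ ⟨a, b, rfl⟩
      exact ⟨_, R.isAdj_left_ι c b a⟩
    have hc := hXc.preimage ((R.left g).toFun (star (H.val c))).continuous
    exact hc.closure_subset_iff.2 hle (𝓑.ι_dense g y)
  have hd : Dense {c : Be | ∃ c' : H.univ.dom, c = star (H.val c')} := by
    have hs : DenseRange (star : Be → Be) := star_involutive.surjective.denseRange
    refine (hs.dense_image continuous_star H.dense_dom).mono ?_
    rintro _ ⟨c, hc, rfl⟩
    exact ⟨⟨c, hc⟩, rfl⟩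
  have hdense := (R.left g).dense_span_of_dense hd
  refine hXc.closure_subset_iff.2 ?_ (hdense x)
  rw [SetLike.coe_subset_coe, Submodule.span_le]
  rintro _ ⟨_, ⟨c, rfl⟩, y, rfl⟩
  exact hleft c y

/-- `z - z'` is an adjoint of `x - x = 0`, and adjoints have equal norm. -/
theorem isAdj_unique (R : RegularRep 𝓑) {g h : G} {x : 𝓑.fibre g} {z z' : 𝓑.fibre h} (hz : IsAdj x z)
    (hz' : IsAdj x z') : z = z' := by
  have := R.norm_eq_of_isAdj (hz.sub hz')
  rw [sub_self, norm_zero, norm_eq_zero, sub_eq_zero] at this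
  exact this

/-- The involution of the Fell bundle. -/
def adj (g : G) : 𝓑.fibre g →ₗ⋆[ℂ] 𝓑.fibre g⁻¹ where
  toFun x := (R.exists_isAdj x).choose
  map_add' x y := R.isAdj_unique (R.exists_isAdj (x + y)).choose_spec
    (IsAdj.add (R.exists_isAdj x).choose_spec (R.exists_isAdj y).choose_spec)
  map_smul' c x := R.isAdj_unique (R.exists_isAdj (c • x)).choose_spec
    (IsAdj.smul (R.exists_isAdj x).choose_spec c)

theorem isAdj_adj {g : G} (x : 𝓑.fibre g) : IsAdj x (R.adj g x) := (R.exists_isAdj x).choose_spec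

theorem op_adj {D : Type u} [NonUnitalCStarAlgebra D] {E : HilbertModule D} {π : Rep A E}
    (hπ : π.IsClosed) (F : FibreRep 𝓑 π) {g : G} (x : 𝓑.fibre g) (ξ η : E) :
    E.inner (F.op g⁻¹ (R.adj g x) ξ) η = E.inner ξ (F.op g x η) := by
  rw [← E.star_inner, ← R.isAdj_adj x hπ, E.star_inner]

theorem op_adj_mul {D : Type u} [NonUnitalCStarAlgebra D] {E : HilbertModule D} {π : Rep A E}
    (hπ : π.IsClosed) (F : FibreRep 𝓑 π) {g : G} (x y : 𝓑.fibre g) (ξ : E) :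
    F.op (g⁻¹ * g) (R.mul _ _ (R.adj g x) y) ξ =
      F.op 1 (𝓑.unitIso ((𝓑.fibre g).inner x y)) ξ := by
  rw [R.op_mul hπ, F.op_unitIso]
  refine HilbertModule.ext_inner fun η => ?_
  rw [← R.isAdj_adj x hπ, F.inner_op]

theorem sigma_adj_mul {g : G} (x y : 𝓑.fibre g) :
    (⟨_, R.mul _ _ (R.adj g x) y⟩ : Σ g, 𝓑.fibre g) = ⟨_, 𝓑.unitIso ((𝓑.fibre g).inner x y)⟩ :=
  R.sigma_ext (inv_mul_cancel g) (R.op_adj_mul R.mem.1 R.fib x y)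

theorem sigma_unit_mul (b c : 𝓑.unit) :
    (⟨_, R.mul _ _ (𝓑.unitIso b) (𝓑.unitIso c)⟩ : Σ g, 𝓑.fibre g) = ⟨_, 𝓑.unitIso (b * c)⟩ :=
  R.sigma_ext (one_mul 1) fun ξ => by
    rw [R.op_mul R.mem.1, R.fib.op_unitIso, R.fib.op_unitIso, R.fib.op_unitIso, R.fib.plus.map_mul]

theorem sigma_unit_adj (b : 𝓑.unit) :
    (⟨_, R.adj _ (𝓑.unitIso b)⟩ : Σ g, 𝓑.fibre g) = ⟨_, 𝓑.unitIso (star b)⟩ :=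
  R.sigma_ext inv_one fun ξ => by
    refine HilbertModule.ext_inner fun η => ?_
    rw [← R.isAdj_adj _ R.mem.1, R.fib.op_unitIso, R.fib.op_unitIso, R.fib.plus.adjoint]

/-- The Fell bundle structure on the fibres `B_g⁺`. -/
def fellBundle : FellBundle (fun g => 𝓑.fibre g) where
  mul g h := ContinuousLinearMap.coeLM ℂ ∘ₗ (R.mul g h).toLinearMap
  star := R.adj
  mul_assoc {g h k} a b c := R.sigma_ext (mul_assoc g h k) fun ξ => by
    change R.fib.op _ (R.mul _ _ (R.mul _ _ a b) c) ξ = R.fib.op _ (R.mul _ _ a (R.mul _ _ b c)) ξ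
    rw [R.op_mul R.mem.1, R.op_mul R.mem.1, R.op_mul R.mem.1, R.op_mul R.mem.1]
  norm_mul_le {g h} a b := by
    change ‖R.mul g h a b‖ ≤ _
    rw [R.mul_apply]
    refine (R.norm_compr_le _ _).trans ((R.fib.norm_op_apply_le g a _).trans (le_of_eq ?_))
    rw [R.inclL_apply, (R.incl h).norm_map]
  star_star {g} a := R.sigma_ext (inv_inv g) fun ξ => by
    refine HilbertModule.ext_inner fun η => ?_
    rw [← R.isAdj_adj _ R.mem.1, R.op_adj R.mem.1]
  star_mul {g h} a b := R.sigma_ext (mul_inv_rev g h) fun ξ => by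
    refine HilbertModule.ext_inner fun η => ?_
    change R.T.inner η (R.fib.op _ (R.adj _ (R.mul g h a b)) ξ) =
      R.T.inner η (R.fib.op _ (R.mul _ _ (R.adj h b) (R.adj g a)) ξ)
    rw [← R.isAdj_adj _ R.mem.1, R.op_mul R.mem.1, R.op_mul R.mem.1, R.isAdj_adj _ R.mem.1,
      R.isAdj_adj _ R.mem.1]
  norm_star a := R.norm_eq_of_isAdj (R.isAdj_adj a)
  norm_star_mul_self {g} a := by
    change ‖R.mul _ _ (R.adj g a) a‖ = _
    have h : (⟨_, R.mul _ _ (R.adj g a) a⟩ : Σ g, 𝓑.fibre g) = _ := R.sigma_adj_mul a a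
    have h2 : ∀ s t : Σ g, 𝓑.fibre g, s = t → ‖s.2‖ = ‖t.2‖ := by
      rintro _ _ rfl
      rfl
    rw [h2 _ _ h, LinearIsometryEquiv.norm_map, (𝓑.fibre g).norm_sq_eq]
  star_mul_self_pos {g} a := by
    -- `a* a` corresponds to `⟨a, a⟩ = c* c` in `B_e⁺`, so `c`, moved to the unit fibre, is a
    -- witness.
    obtain ⟨c, hc⟩ := (𝓑.fibre g).inner_self_pos a
    refine ⟨𝓑.unitIso c, ?_⟩
    have h1 := R.sigma_adj_mul a a
    have h2 := R.sigma_adj_mul (𝓑.unitIso c) (𝓑.unitIso c)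
    refine h1.trans ?_
    refine R.sigma_ext (by simp) fun ξ => ?_
    change _ = R.fib.op _ (R.mul _ _ (R.adj _ _) _) ξ
    rw [hc, R.op_mul R.mem.1, R.fib.op_unitIso, R.fib.op_unitIso]
    refine HilbertModule.ext_inner fun η => ?_
    rw [← R.isAdj_adj _ R.mem.1, R.fib.op_unitIso, R.fib.plus.map_mul, R.fib.plus.adjoint]

theorem fellBundle_mul {g h : G} (x : 𝓑.fibre g) (y : 𝓑.fibre h) :
    R.fellBundle.mul g h x y = R.mul g h x y := rfl

theorem fellBundle_star {g : G} (x : 𝓑.fibre g) : R.fellBundle.star g x = R.adj g x := rfl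

theorem isRep_op {D : Type u} [NonUnitalCStarAlgebra D] {E : HilbertModule D} {π : Rep A E}
    (hπ : π.IsClosed) (F : FibreRep 𝓑 π) : R.fellBundle.IsRep F.op where
  map_mul a b x := R.op_mul hπ F a b x
  adjoint a x y := R.isAdj_adj a hπ F x y
  nondegenerate := F.dense_span_op

theorem isCanonical_fellBundle : 𝓑.IsCanonical R.fellBundle := fun {D} _ {E} π hπ => by
  obtain ⟨F⟩ := exists_fibreRep 𝓑 hπ
  exact ⟨F.op, F.isFibreRep, R.isRep_op hπ.1 F⟩

/-- The operators in the regular representation are determined by it and are faithful, so they force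
the product and the involution. -/
theorem eq_fellBundle (𝓕 : FellBundle (fun g => 𝓑.fibre g)) (h : 𝓑.IsCanonical 𝓕) :
    𝓕 = R.fellBundle := by
  obtain ⟨σ, hσ, hr⟩ := h R.π R.mem
  obtain rfl := R.fib.op_eq hσ
  refine FellBundle.ext ?_ ?_
  · funext g h
    ext x y
    refine R.op_injective ?_
    ext ξ
    rw [hr.map_mul, fellBundle_mul, R.op_mul R.mem.1]
  · funext g
    ext x
    refine R.op_injective ?_
    ext ξ
    refine HilbertModule.ext_inner fun η => ?_
    rw [← hr.adjoint, fellBundle_star, ← R.isAdj_adj x R.mem.1]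

theorem isUnitIso : 𝓑.IsUnitIso R.fellBundle 𝓑.unitIso where
  map_ι a b := 𝓑.unitIso_ι a b
  map_mul b c := R.sigma_unit_mul b c
  map_star b := R.sigma_unit_adj b
  mul_eq_act {g} x b := R.sigma_ext (mul_one g) fun ξ => by
    rw [R.fib.op_act_left, fellBundle_mul, R.op_mul R.mem.1, R.fib.op_unitIso]
  star_mul_eq_inner x y := R.sigma_adj_mul x y

end RegularRep

end Fibres

end

section

/-! ## The section C*-algebra -/

section Sections

open scoped Classical

variable {G : Type u} [Group G] {β : G → Type u} [∀ g, NormedAddCommGroup (β g)]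
    [∀ g, NormedSpace ℂ (β g)] [∀ g, CompleteSpace (β g)]

theorem lof_eq_of_sigma {g h : G} {x : β g} {y : β h} (e : (⟨g, x⟩ : Σ g, β g) = ⟨h, y⟩) :
    DirectSum.lof ℂ G β g x = DirectSum.lof ℂ G β h y := by
  obtain ⟨rfl, e⟩ := Sigma.mk.inj e
  rw [eq_of_heq e]

namespace FellBundle

variable (𝓕 : FellBundle β)

theorem sectionMul_lof {g h : G} (x : β g) (y : β h) :
    𝓕.sectionMul (DirectSum.lof ℂ G β g x) (DirectSum.lof ℂ G β h y) =
      DirectSum.lof ℂ G β (g * h) (𝓕.mul g h x y) := by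
  simp [sectionMul]

theorem sectionStar_lof {g : G} (x : β g) :
    𝓕.sectionStar (DirectSum.lof ℂ G β g x) = DirectSum.lof ℂ G β g⁻¹ (𝓕.star g x) := by
  change 𝓕.sectionStar (DirectSum.of β g x) = DirectSum.of β g⁻¹ (𝓕.star g x)
  simp [sectionStar]

theorem section_induction {P : (⨁ g, β g) → Prop} (h : ∀ g x, P (DirectSum.lof ℂ G β g x))
    (hadd : ∀ x y, P x → P y → P (x + y)) (x : ⨁ g, β g) : P x := by
  induction x using DirectSum.induction_on with
  | zero => simpa using h 1 0
  | of g x => exact h g x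
  | add x y hx hy => exact hadd x y hx hy

theorem sectionMul_assoc (x y z : ⨁ g, β g) :
    𝓕.sectionMul (𝓕.sectionMul x y) z = 𝓕.sectionMul x (𝓕.sectionMul y z) := by
  induction x using section_induction with
  | hadd x x' hx hx' => simp only [map_add, LinearMap.add_apply, hx, hx']
  | h g x =>
    induction y using section_induction with
    | hadd y y' hy hy' => simp only [map_add, LinearMap.add_apply, hy, hy']
    | h h y =>
      induction z using section_induction with
      | hadd z z' hz hz' => simp only [map_add, hz, hz']
      | h k z =>
        simp only [sectionMul_lof]
        exact lof_eq_of_sigma (𝓕.mul_assoc x y z)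

theorem sectionStar_smul (c : ℂ) (x : ⨁ g, β g) :
    𝓕.sectionStar (c • x) = Star.star c • 𝓕.sectionStar x := by
  induction x using section_induction with
  | hadd x x' hx hx' => simp only [map_add, smul_add, hx, hx']
  | h g x =>
    rw [← map_smul, sectionStar_lof, sectionStar_lof, ← map_smul, map_smulₛₗ]
    rfl

theorem sectionStar_sectionStar (x : ⨁ g, β g) : 𝓕.sectionStar (𝓕.sectionStar x) = x := by
  induction x using section_induction with
  | hadd x x' hx hx' => simp only [map_add, hx, hx']
  | h g x =>
    rw [sectionStar_lof, sectionStar_lof]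
    exact lof_eq_of_sigma (𝓕.star_star x)

theorem sectionStar_sectionMul (x y : ⨁ g, β g) :
    𝓕.sectionStar (𝓕.sectionMul x y) = 𝓕.sectionMul (𝓕.sectionStar y) (𝓕.sectionStar x) := by
  induction x using section_induction with
  | hadd x x' hx hx' => simp only [map_add, LinearMap.add_apply, hx, hx']
  | h g x =>
    induction y using section_induction with
    | hadd y y' hy hy' => simp only [map_add, LinearMap.add_apply, hy, hy']
    | h h y =>
      simp only [sectionMul_lof, sectionStar_lof]
      exact lof_eq_of_sigma (𝓕.star_mul x y)

/-- The section C*-algebra exists if the C*-seminorms are bounded on the fibres. -/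
theorem exists_isSectionAlgebra (hbd : ∀ p, 𝓕.IsCStarSeminorm p → ∀ g x,
      p (DirectSum.lof ℂ G β g x) ≤ ‖x‖) :
    ∃ (B : Type u) (_ : NonUnitalCStarAlgebra B) (j : (⨁ g, β g) →ₗ[ℂ] B),
      𝓕.IsSectionAlgebra B j := by
  let P := {p : Seminorm ℂ (⨁ g, β g) // 𝓕.IsCStarSeminorm p}
  -- The zero seminorm makes the family nonempty, as is needed for upper bounds of suprema of real
  -- numbers.
  have _ : Nonempty P := ⟨⟨0, ⟨fun x y => by simp, fun x => by simp⟩⟩⟩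
  have hb : ∀ x, BddAbove (Set.range fun p : P => p.1 x) := fun x => by
    induction x using section_induction with
    | h g x =>
      refine ⟨‖x‖, ?_⟩
      rintro _ ⟨p, rfl⟩
      exact hbd p.1 p.2 g x
    | hadd x y hx hy =>
      obtain ⟨C, hC⟩ := hx
      obtain ⟨C', hC'⟩ := hy
      refine ⟨C + C', ?_⟩
      rintro _ ⟨p, rfl⟩
      exact (map_add_le_add p.1 x y).trans (add_le_add (hC ⟨p, rfl⟩) (hC' ⟨p, rfl⟩))
  let p : Seminorm ℂ (⨁ g, β g) := ⨆ i : P, i.1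
  have hp : ∀ x, p x = ⨆ i : P, i.1 x := fun x =>
    Seminorm.iSup_apply (Seminorm.bddAbove_range_iff.2 hb)
  have hle : ∀ (i : P) x, i.1 x ≤ p x := fun i x => by
    rw [hp]
    exact le_ciSup (hb x) i
  obtain ⟨B, _, j, h1, h2, h3, h4⟩ := exists_cstar_completion 𝓕.sectionMul 𝓕.sectionStar
    𝓕.sectionMul_assoc 𝓕.sectionStar_smul 𝓕.sectionStar_sectionStar 𝓕.sectionStar_sectionMul p
    (fun x y => by
      rw [hp (𝓕.sectionMul x y)]
      refine ciSup_le fun i => (i.2.mul_le x y).trans ?_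
      exact mul_le_mul (hle i x) (hle i y) (apply_nonneg _ _) (apply_nonneg _ _))
    (fun x => by
      refine le_antisymm ?_ ?_
      · rw [hp (𝓕.sectionMul _ x)]
        refine ciSup_le fun i => ?_
        rw [i.2.star_mul_self]
        have := hle i x
        gcongr
      · have : p x ≤ √(p (𝓕.sectionMul (𝓕.sectionStar x) x)) := by
          rw [hp x]
          refine ciSup_le fun i => ?_
          refine Real.le_sqrt_of_sq_le ?_
          rw [← i.2.star_mul_self]
          exact hle i _
        rwa [Real.le_sqrt (apply_nonneg _ _) (apply_nonneg _ _)] at this)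
  exact ⟨B, _, j, h1, h2, h3, fun q hq x => by rw [h4]; exact hle ⟨q, hq⟩ x⟩

end FellBundle

end Sections

section Fibres

open scoped Classical

variable {G : Type u} [Group G] {A : Type u} [Ring A] [Algebra ℂ A] [StarRing A] [StarModule ℂ A]
  {𝒜 : StarGrading G A} {𝓘 : RepClass 𝒜.unitFibre} {Be : Type u} [NonUnitalCStarAlgebra Be]
  {H : CStarHull 𝓘 Be} {𝓑 : PlusFibres H}

/-- C*-seminorms on the section algebra are bounded by the norms on the fibres. -/
theorem PlusFibres.IsUnitIso.seminorm_lof_le {𝓕 : FellBundle fun g => 𝓑.fibre g}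
    {v : 𝓑.unit ≃ₗᵢ[ℂ] 𝓑.fibre 1} (hv : 𝓑.IsUnitIso 𝓕 v)
    {p : Seminorm ℂ (⨁ g, 𝓑.fibre g)} (hp : 𝓕.IsCStarSeminorm p) {g : G} (x : 𝓑.fibre g) :
    p (DirectSum.lof ℂ G (fun g => 𝓑.fibre g) g x) ≤ ‖x‖ := by
  -- On the unit fibre `p` is a C*-seminorm on the C*-algebra `B_e⁺`. For the other fibres, `p(x)² =
  -- p(x* x)` reduces to this case.
  have h1 : ∀ c : 𝓑.unit, p (DirectSum.lof ℂ G (fun g => 𝓑.fibre g) 1 (v c)) ≤ ‖c‖ := by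
    refine cstarSeminorm_le_norm (p.comp ((DirectSum.lof ℂ G (fun g => 𝓑.fibre g) 1) ∘ₗ
      v.toLinearEquiv.toLinearMap)) fun c => ?_
    change p (DirectSum.lof ℂ G (fun g => 𝓑.fibre g) 1 (v (star c * c))) =
      p (DirectSum.lof ℂ G (fun g => 𝓑.fibre g) 1 (v c)) ^ 2
    rw [← hp.star_mul_self, 𝓕.sectionStar_lof, lof_eq_of_sigma (hv.map_star c), 𝓕.sectionMul_lof,
      lof_eq_of_sigma (hv.map_mul (star c) c)]
  refine (sq_le_sq₀ (apply_nonneg _ _) (norm_nonneg _)).1 ?_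
  rw [← hp.star_mul_self, 𝓕.sectionStar_lof, 𝓕.sectionMul_lof,
    lof_eq_of_sigma (hv.star_mul_eq_inner x x), (𝓑.fibre g).norm_sq_eq]
  exact h1 _

end Fibres

end

section

open Filter Topology

/-! ## Integrable representations from representations of the Fell bundle -/

section Fibres

variable {G : Type u} [Group G] {A : Type u} [Ring A] [Algebra ℂ A] [StarRing A] [StarModule ℂ A]
  {𝒜 : StarGrading G A} {𝓘 : RepClass 𝒜.unitFibre} {Be : Type u} [NonUnitalCStarAlgebra Be]
  {H : CStarHull 𝓘 Be} {𝓑 : PlusFibres H}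

theorem Rep.GraphDense.of_restrict {D : Type u} [NonUnitalCStarAlgebra D] {E : HilbertModule D}
    {π : Rep A E} {S : Set E} (h : (π.restrict 𝒜.unitFibre).GraphDense S) : π.GraphDense S := by
  refine Rep.graphDense_of_tendsto fun ξ => ?_
  obtain ⟨l, hl, hS, ha⟩ := h.exists_tendsto ξ
  exact ⟨l, hl, hS, π.tendsto_of_unitFibre 𝒜 fun a h => ha ⟨a, h⟩⟩

namespace FibreRep

variable {D₁ D₂ : Type u} [NonUnitalCStarAlgebra D₁] [NonUnitalCStarAlgebra D₂]
  {E₁ : HilbertModule D₁} {E₂ : HilbertModule D₂} {π₁ : Rep A E₁} {π₂ : Rep A E₂}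

theorem rep_eq_op (F : FibreRep 𝓑 π₁) (b : Be) : F.rep.toFun b = F.op 1 (𝓑.unitIso (𝓑.q b)) := by
  rw [F.op_unitIso, F.plus_q]

theorem graphDense (F : FibreRep 𝓑 π₁) : π₁.GraphDense (Submodule.span ℂ
    {y | ∃ (b : H.univ.dom) (x : E₁), y = F.rep.toFun (H.val b) x}) := by
  refine Rep.GraphDense.of_restrict (𝒜 := 𝒜) ?_
  rw [← F.Φ_rep]
  exact H.graphDense_Φ F.rep

/-- A bounded operator that intertwines the operators on the fibres intertwines the
representations of `A`. -/
theorem intertwines (F₁ : FibreRep 𝓑 π₁) (F₂ : FibreRep 𝓑 π₂) (h₂ : π₂.IsClosed)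
    (S : E₁ →L[ℂ] E₂) (hS : ∀ g x ξ, S (F₁.op g x ξ) = F₂.op g x (S ξ)) (x : π₁.dom) :
    ∃ hd : S x ∈ π₂.dom, ∀ a, S (π₁.toFun a x) = π₂.toFun a ⟨S x, hd⟩ := by
  refine h₂.intertwines_of_span F₁.graphDense ?_ S.toLinearMap S.continuous ?_ x
  · rintro _ ⟨b, x, rfl⟩
    exact F₁.mem_dom b x
  · rintro _ ⟨b, x, rfl⟩
    have e : (fun a => S.toLinearMap (π₁.toFun a ⟨_, F₁.mem_dom b x⟩)) =
        π₂.graph ⟨_, F₂.mem_dom b (S x)⟩ := by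
      funext a
      change S (π₁.toFun a ⟨_, F₁.mem_dom b x⟩) = (π₂.toFun a ⟨_, F₂.mem_dom b (S x)⟩ : E₂)
      induction a using StarGrading.induction (𝒜 := 𝒜) with
      | h g a => rw [← F₁.op_ι, ← F₂.op_ι, hS]
      | hadd a a' ha ha' =>
        rw [map_add, map_add, LinearMap.add_apply, LinearMap.add_apply, Submodule.coe_add,
          Submodule.coe_add, map_add, ha, ha']
    exact e ▸ Rep.graph_mem_orbit _ _

/-- Integrable representations are determined by their operators on the fibres. -/
theorem eq_of_op_eq {π₂ : Rep A E₁} (F₁ : FibreRep 𝓑 π₁) (F₂ : FibreRep 𝓑 π₂) (h₁ : π₁.IsClosed)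
    (h₂ : π₂.IsClosed) (h : F₁.op = F₂.op) : π₁ = π₂ := by
  have h12 := F₁.intertwines F₂ h₂ (ContinuousLinearMap.id ℂ E₁) fun g x ξ => by rw [h]; rfl
  have h21 := F₂.intertwines F₁ h₁ (ContinuousLinearMap.id ℂ E₁) fun g x ξ => by rw [h]; rfl
  refine Rep.ext_of_apply (le_antisymm (fun x hx => (h12 ⟨x, hx⟩).1) fun x hx => (h21 ⟨x, hx⟩).1)
    fun a x hx _ => (h12 ⟨x, hx⟩).2 a

end FibreRep

theorem exists_fibreRep_of_isFibreRep {D : Type u} [NonUnitalCStarAlgebra D] {E : HilbertModule D}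
    {π : Rep A E} (hπ : (𝓘.extend 𝒜).Mem π) {σ : ∀ g, 𝓑.fibre g →L[ℂ] (E →L[ℂ] E)}
    (h : 𝓑.IsFibreRep π σ) : ∃ F : FibreRep 𝓑 π, F.op = σ := by
  obtain ⟨F⟩ := exists_fibreRep 𝓑 hπ
  exact ⟨F, (F.op_eq h).symm⟩

theorem apply_eq_of_sigma {M : Type*} {f : ∀ g, 𝓑.fibre g → M} {g h : G} {x : 𝓑.fibre g}
    {y : 𝓑.fibre h} (e : (⟨g, x⟩ : Σ g, 𝓑.fibre g) = ⟨h, y⟩) : f g x = f h y := by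
  obtain ⟨rfl, e⟩ := Sigma.mk.inj e
  rw [eq_of_heq e]

namespace RegularRep

variable (R : RegularRep 𝓑)

theorem sigma_q_mul {g : G} (b : Be) (y : 𝓑.fibre g) :
    (⟨_, R.mul _ _ (𝓑.unitIso (𝓑.q b)) y⟩ : Σ g, 𝓑.fibre g) = ⟨_, (R.left g).toFun b y⟩ :=
  R.sigma_ext (one_mul g) fun ξ => by
    rw [R.op_mul R.mem.1, ← R.rep_op R.mem.1, R.fib.op_unitIso, R.fib.plus_q]

/-- This expresses `(a c)* c' = c* (a* c')` inside the bundle. So it is available in representations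
of the bundle, before `A` is known to act there. -/
theorem sigma_ι_mul {k g h : G} (a : 𝒜.fibre k) (c : 𝒜.fibre g) (c' : 𝒜.fibre h)
    (b b' : H.univ.dom) :
    (⟨_, R.mul _ _ (R.adj _ (𝓑.ι _ (𝒜.mul a c) b)) (𝓑.ι h c' b')⟩ : Σ g, 𝓑.fibre g) =
      ⟨_, R.mul _ _ (R.adj _ (𝓑.ι g c b)) (𝓑.ι _ (𝒜.mul (𝒜.starFibre a) c') b')⟩ := by
  refine R.sigma_ext (by group) fun ξ => ?_
  refine HilbertModule.ext_inner fun η => ?_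
  rw [R.op_mul R.mem.1, R.op_mul R.mem.1, ← R.isAdj_adj _ R.mem.1, ← R.isAdj_adj _ R.mem.1,
    R.fib.op_ι, R.fib.op_ι, R.fib.op_ι, R.fib.op_ι, R.π.inner_apply_apply, R.π.inner_apply_apply]
  change R.T.inner _ (R.π.toFun (star ((a : A) * c) * c') _ : R.T) =
    R.T.inner _ (R.π.toFun (star (c : A) * (star (a : A) * c')) _ : R.T)
  rw [star_mul, mul_assoc]

variable {D : Type u} [NonUnitalCStarAlgebra D] {E : HilbertModule D}
  {σ : ∀ g, 𝓑.fibre g →L[ℂ] (E →L[ℂ] E)}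

theorem isRep_left (hσ : R.fellBundle.IsRep σ) (g : G) (b : Be) (x : 𝓑.fibre g) (ξ : E) :
    σ 1 (𝓑.unitIso (𝓑.q b)) (σ g x ξ) = σ g ((R.left g).toFun b x) ξ := by
  rw [← hσ.map_mul, ← apply_eq_of_sigma (f := fun g x => σ g x ξ) (R.sigma_q_mul b x)]
  rfl

theorem isRep_act (hσ : R.fellBundle.IsRep σ) {g : G} (x : 𝓑.fibre g) (y : E) (d : D) :
    σ g x (E.act y d) = E.act (σ g x y) d := by
  refine HilbertModule.ext_inner_left fun z => ?_
  rw [hσ.adjoint, E.inner_act_left, E.inner_act_left, hσ.adjoint]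

/-- The representation of `B_e⁺` given by a representation of the Fell bundle. -/
def unitRep (hσ : R.fellBundle.IsRep σ) : CStarRep 𝓑.unit E where
  toFun := (σ 1).toLinearMap ∘ₗ 𝓑.unitIso.toLinearEquiv.toLinearMap
  map_mul b c x := by
    change σ 1 (𝓑.unitIso (b * c)) x = σ 1 (𝓑.unitIso b) (σ 1 (𝓑.unitIso c) x)
    rw [← hσ.map_mul, ← apply_eq_of_sigma (f := fun g y => σ g y x) (R.sigma_unit_mul b c)]
    rfl
  adjoint b x y := by
    change E.inner (σ 1 (𝓑.unitIso b) x) y = E.inner x (σ 1 (𝓑.unitIso (star b)) y)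
    rw [hσ.adjoint, ← apply_eq_of_sigma (f := fun g z => σ g z y) (R.sigma_unit_adj b)]
    rfl
  nondegenerate := by
    -- The left action of `B_e` on `B_g⁺` is nondegenerate; so all `σ g x ξ` lie in the closed span
    -- of the range of the unit fibre.
    let X : Submodule ℂ E := (Submodule.span ℂ {y : E | ∃ b x, y =
      ((σ 1).toLinearMap ∘ₗ 𝓑.unitIso.toLinearEquiv.toLinearMap) b x}).topologicalClosure
    have hX : IsClosed (X : Set E) := Submodule.isClosed_topologicalClosure _
    have h1 : ∀ g (x : 𝓑.fibre g) ξ, σ g x ξ ∈ X := fun g x ξ => by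
      have hc := hX.preimage ((σ g).flip ξ).continuous
      refine hc.closure_subset_iff.2 ?_ ((R.left g).nondegenerate x)
      change Submodule.span ℂ _ ≤ X.comap ((σ g).flip ξ).toLinearMap
      rw [Submodule.span_le]
      rintro _ ⟨b, y, rfl⟩
      refine Submodule.le_topologicalClosure _ (Submodule.subset_span ⟨𝓑.q b, σ g y ξ, ?_⟩)
      exact (R.isRep_left hσ g b y ξ).symm
    intro z
    refine hX.closure_subset_iff.2 ?_ (hσ.nondegenerate z)
    change Submodule.span ℂ _ ≤ X
    rw [Submodule.span_le]
    rintro _ ⟨g, x, ξ, rfl⟩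
    exact h1 g x ξ

/-- A representation of the Fell bundle comes from an integrable representation of `A`. -/
theorem exists_integrable (hσ : R.fellBundle.IsRep σ) :
    ∃ π : Rep A E, (𝓘.extend 𝒜).Mem π ∧ 𝓑.IsFibreRep π σ := by
  classical
  let ρ : CStarRep Be E := (R.unitRep hσ).comp 𝓑.q 𝓑.q_surjective
  have hρ : ∀ b, ρ.toFun b = σ 1 (𝓑.unitIso (𝓑.q b)) := fun _ => rfl
  -- `S b a` is the future `π(a)ρ(b)`, defined degree by degree as `σ_g(a ⊗ b)`.
  let S : H.univ.dom → A →ₗ[ℂ] (E →L[ℂ] E) := fun b =>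
    DirectSum.toModule ℂ G _ (fun g => (σ g).toLinearMap ∘ₗ (𝓑.ι g).flip b) ∘ₗ
      𝒜.decompose.toLinearMap
  have hS : ∀ b g (a : 𝒜.fibre g), S b a = σ g (𝓑.ι g a b) := fun b g a => by
    change DirectSum.toModule ℂ G _ (fun g => (σ g).toLinearMap ∘ₗ (𝓑.ι g).flip b)
      (𝒜.decompose a) = _
    rw [𝒜.decompose_coe, DirectSum.toModule_lof]
    rfl
  have hS1 : ∀ b, S b 1 = ρ.toFun (H.val b) := fun b => by
    rw [hρ, ← 𝓑.qDom_apply, 𝓑.unitIso_qDom]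
    exact hS b 1 ⟨1, 𝒜.one_mem⟩
  have hadj : ∀ a c c' b b' y y', E.inner (S b (a * c) y) (S b' c' y') =
      E.inner (S b c y) (S b' (star a * c') y') := fun a c c' b b' y y' => by
    induction a using StarGrading.induction (𝒜 := 𝒜) with
    | hadd a a' ha ha' =>
      simp only [add_mul, star_add, map_add, add_apply, E.inner_add_left, E.inner_add_right, ha,
        ha']
    | h k a =>
      induction c using StarGrading.induction (𝒜 := 𝒜) with
      | hadd c d hc hd => simp only [mul_add, map_add, add_apply, E.inner_add_left, hc, hd]
      | h g c =>
        induction c' using StarGrading.induction (𝒜 := 𝒜) with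
        | hadd c d hc hd => simp only [mul_add, map_add, add_apply, E.inner_add_right, hc, hd]
        | h h c' =>
          have e1 : S b ((a : A) * c) = σ _ (𝓑.ι _ (𝒜.mul a c) b) := hS b _ (𝒜.mul a c)
          have e2 : S b' (star (a : A) * c') = σ _ (𝓑.ι _ (𝒜.mul (𝒜.starFibre a) c') b') :=
            hS b' _ (𝒜.mul (𝒜.starFibre a) c')
          rw [e1, e2, hS, hS, hσ.adjoint, hσ.adjoint, ← hσ.map_mul, ← hσ.map_mul]
          exact congrArg (E.inner y)
            (apply_eq_of_sigma (f := fun g z => σ g z y') (R.sigma_ι_mul a c c' b b'))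
  have hact : ∀ a b y d, S b a (E.act y d) = E.act (S b a y) d := fun a b y d => by
    induction a using StarGrading.induction (𝒜 := 𝒜) with
    | hadd a a' ha ha' => simp only [map_add, add_apply, E.add_act, ha, ha']
    | h g a => rw [hS, R.isRep_act hσ]
  -- The future orbit map of the vector `π(c)ρ(b)y`. The index contains `c` to make the family
  -- stable under `A`.
  let e : A → A × H.univ.dom × E → E := fun a p => S p.2.1 (a * p.1) p.2.2
  obtain ⟨π, hcl, hcore, hπ⟩ := exists_closed_rep e
    (fun a a' p => by simp only [e, add_mul, map_add, add_apply])
    (fun z a p => by simp only [e, smul_mul_assoc, map_smul, smul_apply])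
    (fun a a' p p' => by simp only [e, one_mul]; rw [hadj, mul_assoc])
    (fun a p => ⟨(a * p.1, p.2), fun c => by simp only [e, mul_assoc]⟩)
    (fun p d => ⟨(p.1, p.2.1, E.act p.2.2 d), fun a => hact _ _ _ _⟩)
    (by
      refine (ρ.dense_span_of_dense H.dense_dom).mono (Submodule.span_mono ?_)
      rintro _ ⟨b, hb, x, rfl⟩
      refine ⟨(1, ⟨b, hb⟩, x), ?_⟩
      simp only [e, mul_one, hS1]
      rfl)
  -- For `c ∈ A_g`, the map `x ↦ σ_g(x)y` commutes with `B_e`, hence carries the domain for `A_e` in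
  -- `B_g⁺` to the domain of `Φ(ρ)`.
  have horb : ∀ c b y, (fun a : 𝒜.unitFibre => S b (a * c) y) ∈ (H.Φ ρ).orbit := fun c b y => by
    induction c using StarGrading.induction (𝒜 := 𝒜) with
    | hadd c d hc hd =>
      have := add_mem hc hd
      refine (congrArg (· ∈ (H.Φ ρ).orbit) (funext fun a => ?_)).mp this
      simp only [Pi.add_apply, mul_add, map_add, add_apply]
    | h g c =>
      obtain ⟨hd, h1⟩ := R.ι_mem_dom g c b
      obtain ⟨hd', h2⟩ := H.Φ_intertwines (ρ := R.left g) (ρ' := ρ) ((σ g).flip y)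
        (fun b x => (R.isRep_left hσ g b x y).symm) ⟨_, hd⟩
      have e' : (fun a : 𝒜.unitFibre => S b (a * c) y) = (H.Φ ρ).graph ⟨_, hd'⟩ := by
        funext a
        refine Eq.trans ?_ (h2 a)
        rw [h1 a]
        have := hS b g (𝒜.unitMul a c)
        exact congrArg (fun T => T y) this
      rw [e']
      exact Rep.graph_mem_orbit _ _
  have hdom : Set.range (e 1) ⊆ (π.restrict 𝒜.unitFibre).dom := fun x hx =>
    hcore.le_dom (Submodule.subset_span hx)
  have hX : ∀ x : (π.restrict 𝒜.unitFibre).dom, (x : E) ∈ Submodule.span ℂ (Set.range (e 1)) →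
      ∃ h : (x : E) ∈ (H.Φ ρ).dom, ∀ a, ((H.Φ ρ).toFun a ⟨x, h⟩ : E) =
        (π.restrict 𝒜.unitFibre).toFun a x := fun x hx => by
    refine (Rep.mem_orbit_iff_of_eq (f := fun a => ((π.restrict 𝒜.unitFibre).toFun a x : E))
      (by simp)).1 ?_
    refine Rep.map_graph_mem_orbit_of_span hdom LinearMap.id ?_ x hx
    rintro _ ⟨p, rfl⟩
    obtain ⟨hd, ha⟩ := hπ p
    refine (congrArg (· ∈ (H.Φ ρ).orbit) (funext fun a => ?_)).mp (horb p.1 p.2.1 p.2.2)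
    exact (ha a).symm
  -- Both are closed representations of `A_e`, and they agree on the span of the vectors
  -- `π(c)ρ(b)y`, which is a core for both.
  have hΦ : H.Φ ρ = π.restrict 𝒜.unitFibre := by
    refine Rep.eq_of_common_dense (H.isClosed_Φ ρ) (hcl.restrict 𝒜)
      (S := Submodule.span ℂ (Set.range (e 1))) ((H.graphDense_Φ ρ).mono ?_)
      (hcore.graphDense.restrict _) (fun x hx => (hX ⟨x, hcore.le_dom hx⟩ hx).1)
      (fun x hx => hcore.le_dom hx) fun a x hx => (hX ⟨x, hcore.le_dom hx⟩ hx).2 a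
    rw [SetLike.coe_subset_coe]
    refine Submodule.span_mono ?_
    rintro _ ⟨b, x, rfl⟩
    refine ⟨(1, b, x), ?_⟩
    simp only [e, mul_one, hS1]
  refine ⟨π, ⟨hcl, hΦ ▸ H.mem_Φ ρ⟩, ρ, hΦ, fun g a b x => ?_⟩
  obtain ⟨hd, ha⟩ := hπ (1, b, x)
  have e1 : e 1 (1, b, x) = ρ.toFun (H.val b) x := by simp only [e, mul_one, hS1]
  simp only [e1] at hd ha
  refine ⟨hd, ?_⟩
  rw [ha a, ← hS]
  simp only [e, mul_one]

end RegularRep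

end Fibres

end

section

open Filter Topology

/-! ## The section C*-algebra is a C*-hull -/

section Fibres

open scoped Classical

variable {G : Type u} [Group G] {A : Type u} [Ring A] [Algebra ℂ A] [StarRing A] [StarModule ℂ A]
  {𝒜 : StarGrading G A} {𝓘 : RepClass 𝒜.unitFibre} {Be : Type u} [NonUnitalCStarAlgebra Be]
  {H : CStarHull 𝓘 Be} {𝓑 : PlusFibres H}

namespace FellBundle

variable {𝓕 : FellBundle fun g => 𝓑.fibre g} {B : Type u} [NonUnitalCStarAlgebra B]
  {j : (⨁ g, 𝓑.fibre g) →ₗ[ℂ] B} {D : Type u} [NonUnitalCStarAlgebra D] {E : HilbertModule D}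

theorem IsSectionAlgebra.norm_lof_le (hj : 𝓕.IsSectionAlgebra B j) {v : 𝓑.unit ≃ₗᵢ[ℂ] 𝓑.fibre 1}
    (hv : 𝓑.IsUnitIso 𝓕 v) {g : G} (x : 𝓑.fibre g) :
    ‖j (DirectSum.lof ℂ G (fun g => 𝓑.fibre g) g x)‖ ≤ ‖x‖ := by
  refine hv.seminorm_lof_le (p := (normSeminorm ℂ B).comp j) ⟨fun x y => ?_, fun x => ?_⟩ x
  · change ‖j (𝓕.sectionMul x y)‖ ≤ ‖j x‖ * ‖j y‖
    rw [hj.map_mul x y]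
    exact _root_.norm_mul_le _ _
  · change ‖j (𝓕.sectionMul (𝓕.sectionStar x) x)‖ = ‖j x‖ ^ 2
    rw [hj.map_mul (𝓕.sectionStar x) x, hj.map_star x, CStarRing.norm_star_mul_self, sq]

/-- The operators on the fibres that are given by a representation of the section algebra. -/
theorem IsSectionAlgebra.exists_isRep (hj : 𝓕.IsSectionAlgebra B j)
    {v : 𝓑.unit ≃ₗᵢ[ℂ] 𝓑.fibre 1} (hv : 𝓑.IsUnitIso 𝓕 v) (ϱ : CStarRep B E) :
    ∃ σ : ∀ g, 𝓑.fibre g →L[ℂ] (E →L[ℂ] E), 𝓕.IsRep σ ∧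
      ∀ g x, ϱ.toFun (j (DirectSum.lof ℂ G (fun g => 𝓑.fibre g) g x)) = σ g x := by
  let σ : ∀ g, 𝓑.fibre g →L[ℂ] (E →L[ℂ] E) := fun g =>
    LinearMap.mkContinuous (ϱ.toFun ∘ₗ j ∘ₗ DirectSum.lof ℂ G (fun g => 𝓑.fibre g) g) 1 fun x => by
      rw [one_mul]
      refine ContinuousLinearMap.opNorm_le_bound _ (norm_nonneg _) fun ξ => ?_
      refine (ϱ.norm_apply_le _ ξ).trans ?_
      gcongr
      exact hj.norm_lof_le hv x
  have hσ : ∀ g x, ϱ.toFun (j (DirectSum.lof ℂ G (fun g => 𝓑.fibre g) g x)) = σ g x :=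
    fun _ _ => rfl
  refine ⟨σ, ⟨fun a b x => ?_, fun a x y => ?_, ?_⟩, hσ⟩
  · rw [← hσ, ← hσ, ← hσ, ← 𝓕.sectionMul_lof, hj.map_mul, ϱ.map_mul]
  · rw [← hσ, ← hσ, ← 𝓕.sectionStar_lof, hj.map_star, ϱ.adjoint]
  · have h := ϱ.dense_span_of_dense hj.dense
    refine h.mono ?_
    rw [SetLike.coe_subset_coe, Submodule.span_le]
    rintro _ ⟨_, ⟨w, rfl⟩, x, rfl⟩
    change ϱ.toFun (j w) x ∈ Submodule.span ℂ _
    induction w using section_induction with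
    | h g w => exact Submodule.subset_span ⟨g, w, x, by rw [hσ]⟩
    | hadd w w' hw hw' =>
      rw [map_add, map_add, add_apply]
      exact add_mem hw hw'

/-- A representation of the Fell bundle extends to the section algebra. -/
theorem IsSectionAlgebra.exists_cstarRep (hj : 𝓕.IsSectionAlgebra B j)
    {σ : ∀ g, 𝓑.fibre g →L[ℂ] (E →L[ℂ] E)} (hσ : 𝓕.IsRep σ) :
    ∃ ϱ : CStarRep B E,
      ∀ g x, ϱ.toFun (j (DirectSum.lof ℂ G (fun g => 𝓑.fibre g) g x)) = σ g x := by
  let s : (⨁ g, 𝓑.fibre g) →ₗ[ℂ] (E →L[ℂ] E) :=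
    DirectSum.toModule ℂ G _ fun g => (σ g).toLinearMap
  have hs : ∀ g x, s (DirectSum.lof ℂ G (fun g => 𝓑.fibre g) g x) = σ g x := fun g x => by
    simp only [s, DirectSum.toModule_lof, ContinuousLinearMap.coe_coe]
  have hmul : ∀ x y ξ, s (𝓕.sectionMul x y) ξ = s x (s y ξ) := fun x y ξ => by
    induction x using section_induction with
    | hadd x x' hx hx' => simp only [map_add, LinearMap.add_apply, add_apply, hx, hx']
    | h g x =>
      induction y using section_induction with
      | hadd y y' hy hy' => simp only [map_add, add_apply, hy, hy']
      | h h y => rw [𝓕.sectionMul_lof, hs, hs, hs, hσ.map_mul]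
  have hadj : ∀ x ξ η, E.inner (s x ξ) η = E.inner ξ (s (𝓕.sectionStar x) η) := fun x ξ η => by
    induction x using section_induction with
    | hadd x x' hx hx' =>
      simp only [map_add, add_apply, E.inner_add_left, E.inner_add_right, hx, hx']
    | h g x => rw [𝓕.sectionStar_lof, hs, hs, hσ.adjoint]
  have hcomp : ∀ x y, s (𝓕.sectionMul x y) = (s x).comp (s y) := fun x y =>
    ContinuousLinearMap.ext (hmul x y)
  -- The operator norm of `s` is a C*-seminorm on the sections, so maximality of the norm of `B`
  -- bounds it.
  have hn : ∀ x, ‖s x‖ ≤ 1 * ‖j x‖ := fun x => by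
    rw [one_mul]
    refine hj.maximal ((normSeminorm ℂ (E →L[ℂ] E)).comp s) ⟨fun x y => ?_, fun x => ?_⟩ x
    · change ‖s _‖ ≤ ‖s x‖ * ‖s y‖
      rw [hcomp]
      exact ContinuousLinearMap.opNorm_comp_le _ _
    · change ‖s _‖ = ‖s x‖ ^ 2
      rw [hcomp]
      exact E.opNorm_sq_of_adjoint (hadj x)
  let r : B →L[ℂ] (E →L[ℂ] E) := s.extendOfNorm j
  have hr : ∀ x, r (j x) = s x := LinearMap.extendOfNorm_eq hj.dense ⟨1, hn⟩
  refine ⟨⟨r.toLinearMap, fun b c x => ?_, fun b x y => ?_, ?_⟩, fun g x => (hr _).trans (hs g x)⟩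
  · refine hj.dense.induction_on₂ (p := fun b c => r (b * c) x = r b (r c x)) ?_
      (fun w w' => by rw [← hj.map_mul, hr, hr, hr, hmul]) b c
    exact isClosed_eq (by fun_prop) (by fun_prop)
  · refine hj.dense.induction_on (p := fun b => E.inner (r b x) y = E.inner x (r (Star.star b) y)) b ?_
      (fun w => by rw [← hj.map_star, hr, hr, hadj])
    exact isClosed_eq (E.continuous_inner (by fun_prop) (by fun_prop))
      (E.continuous_inner (by fun_prop) (by fun_prop))
  · refine hσ.nondegenerate.mono (Submodule.span_mono ?_)
    rintro _ ⟨g, b, x, rfl⟩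
    exact ⟨j (DirectSum.lof ℂ G (fun g => 𝓑.fibre g) g b), x, by
      rw [← hs, ← hr]; rfl⟩

/-- Relations for representations of the section algebra may be checked on the fibres. -/
theorem IsSectionAlgebra.induction (hj : 𝓕.IsSectionAlgebra B j) {M : Type*}
    [NormedAddCommGroup M] [NormedSpace ℂ M] {S T : B →L[ℂ] M}
    (h : ∀ g x, S (j (DirectSum.lof ℂ G (fun g => 𝓑.fibre g) g x)) =
      T (j (DirectSum.lof ℂ G (fun g => 𝓑.fibre g) g x))) : S = T := by
  refine ContinuousLinearMap.ext fun b => ?_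
  refine hj.dense.induction_on (p := fun b => S b = T b) b
    (isClosed_eq (by fun_prop) (by fun_prop)) fun w => ?_
  induction w using section_induction with
  | h g w => exact h g w
  | hadd w w' hw hw' => rw [map_add, map_add, map_add, hw, hw']

end FellBundle

namespace RegularRep

variable (R : RegularRep 𝓑) {B : Type u} [NonUnitalCStarAlgebra B]
  {j : (⨁ g, 𝓑.fibre g) →ₗ[ℂ] B} (hj : R.fellBundle.IsSectionAlgebra B j)

theorem exists_hullRep (R : RegularRep 𝓑) (hj : R.fellBundle.IsSectionAlgebra B j) {D : Type u} [NonUnitalCStarAlgebra D] {E : HilbertModule D}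
    (ϱ : CStarRep B E) : ∃ π : Rep A E, (𝓘.extend 𝒜).Mem π ∧ ∃ F : FibreRep 𝓑 π,
      ∀ g x, ϱ.toFun (j (DirectSum.lof ℂ G (fun g => 𝓑.fibre g) g x)) = F.op g x := by
  obtain ⟨σ, hσ, h⟩ := hj.exists_isRep R.isUnitIso ϱ
  obtain ⟨π, hπ, hF⟩ := R.exists_integrable hσ
  obtain ⟨F, rfl⟩ := exists_fibreRep_of_isFibreRep hπ hF
  exact ⟨π, hπ, F, h⟩

/-- The integrable representation that corresponds to a representation of the section algebra. -/
def hullRep {D : Type u} [NonUnitalCStarAlgebra D] {E : HilbertModule D} (ϱ : CStarRep B E) :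
    Rep A E := (R.exists_hullRep hj ϱ).choose

theorem mem_hullRep {D : Type u} [NonUnitalCStarAlgebra D] {E : HilbertModule D}
    (ϱ : CStarRep B E) : (𝓘.extend 𝒜).Mem (R.hullRep hj ϱ) :=
  (R.exists_hullRep hj ϱ).choose_spec.1

/-- The operators on the fibres of the representation `hullRep`. -/
def hullFib {D : Type u} [NonUnitalCStarAlgebra D] {E : HilbertModule D} (ϱ : CStarRep B E) :
    FibreRep 𝓑 (R.hullRep hj ϱ) := (R.exists_hullRep hj ϱ).choose_spec.2.choose

theorem hullFib_op {D : Type u} [NonUnitalCStarAlgebra D] {E : HilbertModule D} (ϱ : CStarRep B E)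
    (g : G) (x : 𝓑.fibre g) : ϱ.toFun (j (DirectSum.lof ℂ G (fun g => 𝓑.fibre g) g x)) =
      (R.hullFib hj ϱ).op g x := (R.exists_hullRep hj ϱ).choose_spec.2.choose_spec g x

theorem hullRep_intertwines {D₁ D₂ : Type u} [NonUnitalCStarAlgebra D₁] [NonUnitalCStarAlgebra D₂]
    {E₁ : HilbertModule D₁} {E₂ : HilbertModule D₂} (ϱ₁ : CStarRep B E₁) (ϱ₂ : CStarRep B E₂)
    (S : E₁ →L[ℂ] E₂) (hS : ∀ b x, S (ϱ₁.toFun b x) = ϱ₂.toFun b (S x))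
    (x : (R.hullRep hj ϱ₁).dom) : ∃ hd : S x ∈ (R.hullRep hj ϱ₂).dom,
      ∀ a, S ((R.hullRep hj ϱ₁).toFun a x) = (R.hullRep hj ϱ₂).toFun a ⟨S x, hd⟩ :=
  (R.hullFib hj ϱ₁).intertwines (R.hullFib hj ϱ₂) (R.mem_hullRep hj ϱ₂).1 S
    (fun g x ξ => by rw [← hullFib_op, ← hullFib_op, hS]) x

theorem bijOn_hullRep {D : Type u} [NonUnitalCStarAlgebra D] (E : HilbertModule D) :
    Set.BijOn (R.hullRep hj (E := E)) Set.univ {π | (𝓘.extend 𝒜).Mem π} := by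
  refine ⟨fun ϱ _ => R.mem_hullRep hj ϱ, fun ϱ₁ _ ϱ₂ _ h => ?_, fun π hπ => ?_⟩
  -- The two families of operators belong to representations that are only propositionally equal;
  -- with `π` as a variable the equation can be substituted.
  · have key : ∀ (π : Rep A E) (F : FibreRep 𝓑 π), π = R.hullRep hj ϱ₂ →
        F.op = (R.hullFib hj ϱ₂).op := by
      rintro _ F rfl
      exact (R.hullFib hj ϱ₂).op_eq F.isFibreRep
    have e := key _ (R.hullFib hj ϱ₁) h
    have e2 : ϱ₁.toCLM = ϱ₂.toCLM := hj.induction fun g x => by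
      rw [CStarRep.toCLM_apply, CStarRep.toCLM_apply, R.hullFib_op hj, R.hullFib_op hj, e]
    exact CStarRep.ext_apply fun b x => congrArg (fun T => T b x) e2
  · obtain ⟨F⟩ := exists_fibreRep 𝓑 hπ
    obtain ⟨ϱ, hϱ⟩ := hj.exists_cstarRep (R.isRep_op hπ.1 F)
    refine ⟨ϱ, Set.mem_univ _, ?_⟩
    refine (R.hullFib hj ϱ).eq_of_op_eq F (R.mem_hullRep hj ϱ).1 hπ.1 ?_
    funext g
    ext1 x
    rw [← R.hullFib_op hj, hϱ]

/-- If `I` intertwines the representations of `A`, then it does so over `A_e`, and the hull `B_e`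
gives that it commutes with `ρ(b)`. Hence it commutes with `π(a)ρ(b)`, that is, with all fibres, and
these generate `B`. Conversely, operators that commute with the fibres respect the orbits of the
core `ρ(b)x`. -/
theorem isometric_hullRep {D : Type u} [NonUnitalCStarAlgebra D] {E₁ E₂ : HilbertModule D}
    (ϱ₁ : CStarRep B E₁) (ϱ₂ : CStarRep B E₂) (I : ModuleIsometry E₁ E₂) :
    ϱ₁.Intertwines ϱ₂ I ↔ (R.hullRep hj ϱ₁).Intertwines (R.hullRep hj ϱ₂) I := by
  let IL : E₁ →L[ℂ] E₂ := I.toLinearIsometry.toContinuousLinearMap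
  constructor
  · intro h
    exact R.hullRep_intertwines hj ϱ₁ ϱ₂ IL h
  · intro h
    let F₁ := R.hullFib hj ϱ₁
    let F₂ := R.hullFib hj ϱ₂
    have hres : (H.Φ F₁.rep).Intertwines (H.Φ F₂.rep) I := by
      rw [F₁.Φ_rep, F₂.Φ_rep]
      intro x
      obtain ⟨hd, ha⟩ := h x
      exact ⟨hd, fun a => ha a⟩
    have hrep := (H.isometric _ _ I).2 hres
    have hop : ∀ g x ξ, IL (F₁.op g x ξ) = F₂.op g x (IL ξ) := fun g x ξ => by
      have : IL.comp ((F₁.op g).flip ξ) = (F₂.op g).flip (IL ξ) := 𝓑.clm_ext fun a b => by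
        change I.toLin (F₁.op g (𝓑.ι g a b) ξ) = F₂.op g (𝓑.ι g a b) (I.toLin ξ)
        rw [F₁.op_ι, F₂.op_ι]
        obtain ⟨hd, ha⟩ := h ⟨_, F₁.mem_dom b ξ⟩
        rw [ha a]
        congr 3
        exact hrep _ _
      exact congrArg (fun S => S x) this
    intro b ξ
    have : IL.comp (ϱ₁.toCLM.flip ξ) = ϱ₂.toCLM.flip (IL ξ) := hj.induction fun g x => by
      change IL (ϱ₁.toFun _ ξ) = ϱ₂.toFun _ (IL ξ)
      rw [R.hullFib_op hj, R.hullFib_op hj, hop]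
    exact congrArg (fun S => S b) this

/-- The hull for `A_e` shows that the span of `dom π ⊗ F` is a core for the restriction to `A_e`,
and density in the graph topology passes to `A`. Equivariance of `x ↦ x ⊗ y` under all of `A` gives
invariance of this span and the formula for the action. -/
theorem isTensor_hullRep {D₁ D₂ : Type u} [NonUnitalCStarAlgebra D₁] [NonUnitalCStarAlgebra D₂]
    {E : HilbertModule D₁} {F : HilbertModule D₂} {φ : CStarRep D₁ F} {T : HilbertModule D₂}
    {τ : E →ₗ[ℂ] F →ₗ[ℂ] T} (hT : IsInteriorTensor E F φ T τ) (ϱ : CStarRep B E)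
    (ς : CStarRep B T) (h : ϱ.IsTensor τ ς) : (R.hullRep hj ϱ).IsTensor τ (R.hullRep hj ς) := by
  let F₁ := R.hullFib hj ϱ
  let F₂ := R.hullFib hj ς
  have hres : (H.Φ F₁.rep).IsTensor τ (H.Φ F₂.rep) := by
    refine H.tensor hT _ _ fun b x y => ?_
    rw [F₁.rep_eq_op, F₂.rep_eq_op, ← R.hullFib_op hj, ← R.hullFib_op hj, h]
  rw [F₁.Φ_rep, F₂.Φ_rep] at hres
  have h_int : ∀ (x : (R.hullRep hj ϱ).dom) (y : F), ∃ hd : τ x y ∈ (R.hullRep hj ς).dom,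
      ∀ a, τ ((R.hullRep hj ϱ).toFun a x) y = (R.hullRep hj ς).toFun a ⟨τ x y, hd⟩ := fun x y =>
    R.hullRep_intertwines hj ϱ ς ⟨τ.flip y, hT.continuous_left y⟩ (fun b x => (h b x y).symm) x
  refine ⟨(R.mem_hullRep hj ς).1, ⟨hres.core.le_dom, fun a t ht => ?_, hres.core.act_mem, ?_⟩,
    fun a x y hd => ((h_int x y).2 a).symm⟩
  · have hle : Submodule.span ℂ {t : T | ∃ (x : (R.hullRep hj ϱ).dom) (y : F), t = τ x y} ≤
        ((Submodule.span ℂ {t : T | ∃ (x : (R.hullRep hj ϱ).dom) (y : F), t = τ x y}).comap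
          ((R.hullRep hj ς).dom.subtype ∘ₗ (R.hullRep hj ς).toFun a)).map
            (R.hullRep hj ς).dom.subtype := by
      rw [Submodule.span_le]
      rintro _ ⟨x, y, rfl⟩
      obtain ⟨hd, ha⟩ := h_int x y
      exact ⟨⟨_, hd⟩, Submodule.subset_span ⟨(R.hullRep hj ϱ).toFun a x, y, (ha a).symm⟩, rfl⟩
    obtain ⟨t', ht', e⟩ := hle ht
    have : t' = t := Subtype.ext e
    subst this
    exact ht'
  · refine ((R.hullRep hj ς).graphDense_iff (Submodule.span ℂ
      {t : T | ∃ (x : (R.hullRep hj ϱ).dom) (y : F), t = τ x y})).1 ?_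
    exact Rep.GraphDense.of_restrict hres.core.graphDense

/-- The section algebra as a C*-hull for the integrable representations of `A`. -/
def hull : CStarHull (𝓘.extend 𝒜) B where
  Φ := R.hullRep hj
  bijOn := R.bijOn_hullRep hj
  isometric := R.isometric_hullRep hj
  tensor := R.isTensor_hullRep hj

theorem isCanonicalHull : 𝓑.IsCanonicalHull j (R.hull hj) := fun ϱ =>
  ⟨(R.hullFib hj ϱ).op, (R.hullFib hj ϱ).isFibreRep, R.hullFib_op hj ϱ⟩

end RegularRep

end Fibres

end

end FellInduction

end

/-! ### The Induction Theorem. -/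

theorem mainTheorem1 {G : Type u} [Group G] {A : Type u} [Ring A] [Algebra ℂ A] [StarRing A]
    [StarModule ℂ A] (𝒜 : StarGrading G A) (𝓘 : RepClass 𝒜.unitFibre)
    {Be : Type u} [NonUnitalCStarAlgebra Be] (H : CStarHull 𝓘 Be)
    (hind : CompatibleWithInduction 𝒜 𝓘) :
    -- the C*-algebra `B_e⁺` and the Hilbert modules `B_g⁺` exist
    Nonempty (PlusFibres H) ∧
    ∀ 𝓑 : PlusFibres H,
      -- they form a Fell bundle in a canonical way
      ∃ 𝓕 : FellBundle (fun g => 𝓑.fibre g),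
        (𝓑.IsCanonical 𝓕 ∧ ∀ 𝓕' : FellBundle (fun g => 𝓑.fibre g), 𝓑.IsCanonical 𝓕' → 𝓕' = 𝓕) ∧
        (∃ v : 𝓑.unit ≃ₗᵢ[ℂ] 𝓑.fibre 1, 𝓑.IsUnitIso 𝓕 v) ∧
        -- its section C*-algebra exists and is a C*-hull for the integrable representations of `A`
        (∃ (B : Type u) (_ : NonUnitalCStarAlgebra B)
          (j : (DirectSum G fun g => 𝓑.fibre g) →ₗ[ℂ] B), 𝓕.IsSectionAlgebra B j) ∧
        ∀ (B : Type u) [NonUnitalCStarAlgebra B]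
          (j : (DirectSum G fun g => 𝓑.fibre g) →ₗ[ℂ] B), 𝓕.IsSectionAlgebra B j →
          ∃ K : CStarHull (𝓘.extend 𝒜) B, 𝓑.IsCanonicalHull j K := by
  refine ⟨nonempty_plusFibres H, fun 𝓑 => ?_⟩
  obtain ⟨R⟩ := nonempty_regularRep hind 𝓑
  exact ⟨R.fellBundle, ⟨R.isCanonical_fellBundle, R.eq_fellBundle⟩, ⟨𝓑.unitIso, R.isUnitIso⟩,
    R.fellBundle.exists_isSectionAlgebra fun _ hp _ x => R.isUnitIso.seminorm_lof_le hp x,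
    fun _ _ _ hj => ⟨R.hull hj, R.isCanonicalHull hj⟩⟩
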